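/- Let $\mathcal G$ be a finite plane graph (loops and multiple edges are allowed, and $\mathcal G$ need not be connected), with vertex set $\mathcal V$ and vertices and edges drawn as points and arcs in the plane. Let $F$ be a face of $\mathcal G$ whose boundary $\partial F$ is a Jordan curve, and let $N\ge 3$ be an integer. Suppose that every face of $\mathcal G$ other than $F$ has at most $N$ vertices on its boundary, each vertex being counted once. (This holds in particular if every such face has at most $N$ vertices on its ideal boundary, where vertices are counted with multiplicity.) A path is a finite sequence of at least two vertices in which consecutive vertices are joined by an edge. It is proper if its first and last vertices lie on $\partial F$ and none of its other vertices does. Let $a\neq b$ be vertices on $\partial F$ that are not joined by an edge contained in $\partial F$. Let $\Gamma_{a,b}$ be the family of proper paths from $a$ to $b$, and let $\Gamma_{a,b}^*$ be the family of proper paths that separate $a$ and $b$, i.e. whose end vertices lie in different components of $\partial F\setminus\{a,b\}$. Suppose that $\Gamma_{a,b}$ and $\Gamma_{a,b}^*$ are both non-empty. For a family $\Gamma$ of paths, put $$\mathrm{EW}(\Gamma,\partial F)=\inf_\mu \sum_{v\in\mathcal V}\mu(v)^2\in[0,\infty],\qquad \mathrm{EL}(\Gamma,\partial F)=\frac{1}{\mathrm{EW}(\Gamma,\partial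 F)},$$ where the infimum is over all $\mu:\mathcal V\to[0,\infty)$ that vanish at the vertices on $\partial F$ and satisfy $\sum_{j}\mu(v_j)\ge 1$ for every path $(v_j)_j$ in $\Gamma$. Then: 1. (Duality) If $N=3$, then $\mathrm{EW}(\Gamma_{a,b},\partial F)\cdot \mathrm{EW}(\Gamma_{a,b}^*,\partial F)=1$. 2. (Quasi-duality) In general, $$\frac{1}{(4N+1)^2}\le \mathrm{EW}(\Gamma_{a,b},\partial F)\cdot \mathrm{EW}(\Gamma_{a,b}^*,\partial F)\le 1;$$ equivalently, $$1\le \mathrm{EL}(\Gamma_{a,b},\partial F)\cdot \mathrm{EL}(\Gamma_{a,b}^*,\partial F)\le (4N+1)^2 .$$ -/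

import Mathlib

open scoped NNReal ENNReal

/-- A plane graph with vertex set `V` and edge set `E`: the vertices are distinct points of the
plane, every edge is drawn as an arc (or as a simple loop, if its two ends agree) between its ends,
no interior point of an edge is a vertex, and the interiors of distinct edges are disjoint.
Loops and multiple edges are allowed, and the graph need not be connected. The order of the two
ends of an edge only records how its arc is parametrized. -/
structure PlaneGraph (V E : Type*) where
  /-- position of a vertex -/
  point : V → ℂ
  /-- the two ends of an edge -/
  src : E → V
  tgt : E → V
  /-- the arc that draws an edge -/
  arc : ∀ e, Path (point (src e)) (point (tgt e))
  point_injective : Function.Injective point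
  arc_injOn : ∀ e, Set.InjOn (arc e) (Set.Ioo 0 1)
  arc_ne_point : ∀ e, ∀ t ∈ Set.Ioo (0 : unitInterval) 1, ∀ v, arc e t ≠ point v
  arc_ne_arc : ∀ e e', e ≠ e' → ∀ t ∈ Set.Ioo (0 : unitInterval) 1,
    ∀ t' ∈ Set.Ioo (0 : unitInterval) 1, arc e t ≠ arc e' t'

namespace PlaneGraph

variable {V E : Type*} (G : PlaneGraph V E)

/-- The subset of the plane covered by the vertices and edges. -/
def support : Set ℂ := Set.range G.point ∪ ⋃ e, Set.range (G.arc e)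

/-- A face is a connected component of the complement of the graph (the unbounded one included). -/
def IsFace (F : Set ℂ) : Prop :=
  ∃ z ∈ G.supportᶜ, F = connectedComponentIn G.supportᶜ z

/-- A Jordan face is a face whose boundary is a Jordan curve. -/
def IsJordanFace (F : Set ℂ) : Prop :=
  G.IsFace F ∧ Nonempty (frontier F ≃ₜ Circle)

/-- The vertices on the boundary of a face. -/
def boundaryVertices (F : Set ℂ) : Set V := {v | G.point v ∈ frontier F}

/-- `e` joins `u` and `v`, in either order. -/
def Joins (e : E) (u v : V) : Prop :=
  (G.src e = u ∧ G.tgt e = v) ∨ (G.src e = v ∧ G.tgt e = u)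

/-- Two vertices are adjacent if some edge joins them. -/
def Adj (u v : V) : Prop := ∃ e, G.Joins e u v

/-- `u` and `v` are joined by an edge of the boundary of `F`. -/
def AdjOnBoundary (F : Set ℂ) (u v : V) : Prop :=
  ∃ e, G.Joins e u v ∧ Set.range (G.arc e) ⊆ frontier F

/-- `p` is a proper path from `u` to `v` relative to `∂F`: a sequence of vertices
`u, w₁, …, wₖ, v` (with `k ≥ 0`), consecutive ones adjacent, such that `u` and `v` lie on `∂F` and
no `wᵢ` lies on `∂F`. -/
def IsProperPath (F : Set ℂ) (u v : V) (p : List V) : Prop :=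
  u ∈ G.boundaryVertices F ∧ v ∈ G.boundaryVertices F ∧ p.IsChain G.Adj ∧
    ∃ l : List V, p = u :: (l ++ [v]) ∧ ∀ w ∈ l, w ∉ G.boundaryVertices F

/-- The family of proper paths that connect `a` and `b`. -/
def connecting (F : Set ℂ) (a b : V) : Set (List V) := {p | G.IsProperPath F a b p}

/-- `c` and `d` are points of different components of `∂F ∖ {a, b}`. -/
def InDifferentComponents (F : Set ℂ) (a b c d : V) : Prop :=
  G.point c ∈ frontier F \ {G.point a, G.point b} ∧
  G.point d ∈ frontier F \ {G.point a, G.point b} ∧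
  G.point d ∉ connectedComponentIn (frontier F \ {G.point a, G.point b}) (G.point c)

/-- The family of proper paths that separate `a` and `b`, that is, that connect the two components
of `∂F ∖ {a, b}`. -/
def separating (F : Set ℂ) (a b : V) : Set (List V) :=
  {p | ∃ c d, G.InDifferentComponents F a b c d ∧ G.IsProperPath F c d p}

end PlaneGraph

section ExtremalWidth

variable {V : Type*}

/-- The area of a vertex metric. -/
def vertexArea [Fintype V] (μ : V → ℝ≥0) : ℝ≥0 := ∑ v, μ v ^ 2

/-- The length of a path: the sum of the metric over its vertices, with repetitions. -/
def vertexLength (μ : V → ℝ≥0) (p : List V) : ℝ≥0 := (p.map μ).sum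

/-- `μ` is `Γ`-admissible relative to `W`. -/
def IsAdmissible (Γ : Set (List V)) (W : Set V) (μ : V → ℝ≥0) : Prop :=
  (∀ p ∈ Γ, 1 ≤ vertexLength μ p) ∧ ∀ v ∈ W, μ v = 0

/-- The relative vertex extremal width: the infimum of the areas of the admissible metrics. It is
`∞` when there is no such metric. -/
noncomputable def extremalWidth [Fintype V] (Γ : Set (List V)) (W : Set V) : ℝ≥0∞ :=
  ⨅ μ ∈ {μ : V → ℝ≥0 | IsAdmissible Γ W μ}, (vertexArea μ : ℝ≥0∞)

/-- The relative vertex extremal length, the reciprocal of the width. -/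
noncomputable def extremalLength [Fintype V] (Γ : Set (List V)) (W : Set V) : ℝ≥0∞ :=
  (extremalWidth Γ W)⁻¹

end ExtremalWidth

/-! Upper bound. A path that connects `a` and `b` and one that separates them must cross at a vertex
off `∂F`. Let `μ` be the extremal metric of the connecting family. As the point of least norm in a
convex set it satisfies `|μ|² ≤ ⟨μ, ν⟩` for every admissible `ν`. Because of the crossings, the
indicator of the vertices off `∂F` of a separating path is such a `ν`, so that every separating path
has `μ`-length at least `|μ|²`. Hence `μ / |μ|²` is admissible for the separating family, and the
product of the widths is at most 1.

Lower bound. Let `μ` and `ν` be admissible for the two families, and let `D` be the `μ`-distance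
from `a`. For `0 < t < 1` the vertices with `D < t` form with `a` a connected set, the basin, that
is not adjacent to `b`. The shore consists of the vertices adjacent to the basin on the side of the
rest of `∂F`. If such a vertex `w` is off `∂F`, then `t` lies in the interval `[D w - μ w, D w]`, of
length `μ w`. By plane topology the shore has a sequence of vertices from one component of `∂F ∖ {a,
b}` to the other in which neighbours share a face (`exists_shoreStep_chain`).

If faces have at most three vertices, vertices that are neighbours in this sequence are equal or
adjacent, so the shore carries a separating path and has `ν`-mass at least 1. Integration over `t`
gives `1 ≤ ∑ μ ν`, and Cauchy–Schwarz finishes the argument.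

For general `N` the separating path has to run along the faces, through vertices whose intervals may
miss `t` by a positive gap. The path is covered by cells, connected pieces of face boundaries with
at most `N` vertices that reach the shore. In a shortest chain of cells no vertex lies in more than
two of them (`exists_cells`). Within a cell the total gap is at most a multiple of the part of `μ`
that exceeds a fraction of the gap (`sum_gap_le`). Writing `ν ≤ max 0 (ν - gap / K) + gap / K` and
integrating the resulting trapezoids (`integral_max_sub_gap_le`) yields `1 ≤ ∑ μ ν + K |ν|² + 4 (N -
1) N |μ|² / K`, and the choice `K = 2 N |μ| / |ν|` gives the constant.

The topology rests on Janiszewski's theorem, proved by Eilenberg's criterion: a compact set fails to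
separate `x` from `y` exactly if `(z - x) / (z - y)` has a continuous logarithm on it. -/

section PlaneSeparation

/-! ### Separation of the plane: Eilenberg's criterion and Janiszewski's theorem. -/

open Set Metric Complex

/-- `x` and `y` lie in a connected set that avoids `Z`. -/
def JoinedOff (Z : Set ℂ) (x y : ℂ) : Prop :=
  ∃ S : Set ℂ, IsPreconnected S ∧ x ∈ S ∧ y ∈ S ∧ Disjoint S Z

/-- The function `(z - x) / (z - y)` has a continuous logarithm on `Z`. -/
def HasLog (Z : Set ℂ) (x y : ℂ) : Prop :=
  ∃ g : ℂ → ℂ, ContinuousOn g Z ∧ ∀ z ∈ Z, z - x = (z - y) * exp (g z)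

variable {Z Z₁ Z₂ : Set ℂ} {x y w : ℂ}

theorem JoinedOff.symm (h : JoinedOff Z x y) : JoinedOff Z y x := by
  obtain ⟨S, h1, h2, h3, h4⟩ := h
  exact ⟨S, h1, h3, h2, h4⟩

theorem JoinedOff.trans (h : JoinedOff Z x y) (h' : JoinedOff Z y w) : JoinedOff Z x w := by
  obtain ⟨S, h1, h2, h3, h4⟩ := h
  obtain ⟨S', h1', h2', h3', h4'⟩ := h'
  exact ⟨S ∪ S', h1.union y h3 h2' h1', Or.inl h2, Or.inr h3', disjoint_union_left.2 ⟨h4, h4'⟩⟩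

theorem JoinedOff.mono (h : JoinedOff Z₂ x y) (hZ : Z₁ ⊆ Z₂) : JoinedOff Z₁ x y := by
  obtain ⟨S, h1, h2, h3, h4⟩ := h
  exact ⟨S, h1, h2, h3, h4.mono_right hZ⟩

theorem JoinedOff.left_notMem (h : JoinedOff Z x y) : x ∉ Z := by
  obtain ⟨S, h1, h2, h3, h4⟩ := h
  exact disjoint_left.1 h4 h2

theorem JoinedOff.right_notMem (h : JoinedOff Z x y) : y ∉ Z := h.symm.left_notMem

theorem joinedOff_iff_mem_connectedComponentIn (hx : x ∉ Z) :
    JoinedOff Z x y ↔ y ∈ connectedComponentIn Zᶜ x := by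
  constructor
  · rintro ⟨S, h1, h2, h3, h4⟩
    exact h1.subset_connectedComponentIn h2 (subset_compl_iff_disjoint_right.2 h4) h3
  · intro h
    refine ⟨_, isPreconnected_connectedComponentIn, mem_connectedComponentIn hx, h, ?_⟩
    exact subset_compl_iff_disjoint_right.1 (connectedComponentIn_subset _ _)

/-- Points that are joined off `Z` are exchanged by a connected set meeting both of their
neighbourhoods. -/
theorem joinedOff_of_ball {p : ℂ} {r : ℝ} (h : Disjoint (ball p r) Z) (hx : x ∈ ball p r)
    (hy : y ∈ ball p r) : JoinedOff Z x y :=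
  ⟨ball p r, (convex_ball p r).isPreconnected, hx, hy, h⟩

theorem HasLog.symm (h : HasLog Z x y) : HasLog Z y x := by
  obtain ⟨g, hg, h⟩ := h
  refine ⟨fun z => - g z, hg.neg, fun z hz => ?_⟩
  rw [h z hz, mul_assoc, ← Complex.exp_add]
  simp

theorem HasLog.trans (h : HasLog Z x y) (h' : HasLog Z y w) : HasLog Z x w := by
  obtain ⟨g, hg, h⟩ := h
  obtain ⟨g', hg', h'⟩ := h'
  refine ⟨fun z => g' z + g z, hg'.add hg, fun z hz => ?_⟩
  rw [h z hz, h' z hz, mul_assoc, ← Complex.exp_add]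

theorem HasLog.mono (h : HasLog Z₂ x y) (hZ : Z₁ ⊆ Z₂) : HasLog Z₁ x y := by
  obtain ⟨g, hg, h⟩ := h
  exact ⟨g, hg.mono hZ, fun z hz => h z (hZ hz)⟩

/-- On `Z` the quotient `(z - y) / (z - x)` differs from 1 by less than 1, so the principal branch
of the logarithm is continuous along it. -/
theorem hasLog_of_ball {r : ℝ} (h : Disjoint (ball x r) Z) (hy : y ∈ ball x r) :
    HasLog Z y x := by
  have key : ∀ z ∈ Z, z - x ≠ 0 ∧ (z - y) / (z - x) ∈ slitPlane := by
    intro z hz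
    have hzr : r ≤ dist z x := not_lt.1 fun h' => disjoint_left.1 h (mem_ball.2 h') hz
    have hy' : dist y x < r := hy
    have hpos : 0 < dist z x := (dist_nonneg.trans_lt hy').trans_le hzr
    have hne : z - x ≠ 0 := sub_ne_zero.2 (dist_pos.1 hpos)
    refine ⟨hne, ?_⟩
    have : (z - y) / (z - x) = 1 + (x - y) / (z - x) := by field_simp; ring
    rw [this]
    refine mem_slitPlane_of_norm_lt_one ?_
    rw [norm_div, div_lt_one (norm_pos_iff.2 hne), ← dist_eq_norm, ← dist_eq_norm, dist_comm x y]
    exact hy'.trans_le hzr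
  refine ⟨fun z => log ((z - y) / (z - x)), ?_, fun z hz => ?_⟩
  · refine ContinuousOn.clog ?_ fun z hz => (key z hz).2
    exact ContinuousOn.div (by fun_prop) (by fun_prop) fun z hz => (key z hz).1
  · rw [Complex.exp_log (slitPlane_ne_zero (key z hz).2), mul_div_cancel₀ _ (key z hz).1]

theorem HasLog.refl (x : ℂ) : HasLog Z x x := ⟨fun _ => 0, continuousOn_const, fun z _ => by simp⟩

/-- By `hasLog_of_ball`, having a logarithm relative to `x` is a locally constant property of points
off `Z`, so it propagates along a connected set. This is the easy half of Eilenberg's criterion. -/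
theorem JoinedOff.hasLog (hZ : IsClosed Z) (h : JoinedOff Z x y) : HasLog Z x y := by
  obtain ⟨S, hS, hx, hy, hd⟩ := h
  have hball : ∀ p ∉ Z, ∃ r > 0, Disjoint (ball p r) Z := fun p hp => by
    obtain ⟨r, hr, h⟩ := Metric.isOpen_iff.1 hZ.isOpen_compl p hp
    exact ⟨r, hr, subset_compl_iff_disjoint_right.1 h⟩
  let U := {p | p ∉ Z ∧ HasLog Z p x}
  let U' := {p | p ∉ Z ∧ ¬ HasLog Z p x}
  have hU : IsOpen U := by
    refine Metric.isOpen_iff.2 fun p ⟨hp, hp'⟩ => ?_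
    obtain ⟨r, hr, h⟩ := hball p hp
    exact ⟨r, hr, fun q hq => ⟨disjoint_left.1 h hq, (hasLog_of_ball h hq).trans hp'⟩⟩
  have hU' : IsOpen U' := by
    refine Metric.isOpen_iff.2 fun p ⟨hp, hp'⟩ => ?_
    obtain ⟨r, hr, h⟩ := hball p hp
    exact ⟨r, hr, fun q hq => ⟨disjoint_left.1 h hq,
      fun hl => hp' ((hasLog_of_ball h hq).symm.trans hl)⟩⟩
  have hsub : S ⊆ U ∪ U' := fun p hp => by
    have hp' : p ∉ Z := disjoint_left.1 hd hp
    by_cases hl : HasLog Z p x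
    · exact Or.inl ⟨hp', hl⟩
    · exact Or.inr ⟨hp', hl⟩
  have hdis : Disjoint U U' := disjoint_left.2 fun p h1 h2 => h2.2 h1.2
  exact (hS.subset_left_of_subset_union hU hU' hdis hsub
    ⟨x, hx, disjoint_left.1 hd hx, HasLog.refl x⟩ hy).2.symm

/-- On a connected set, two continuous logarithms of the same function differ by a constant. -/
theorem exists_eq_add_of_exp_eq {X : Type*} [TopologicalSpace X] {S : Set X}
    (hS : IsPreconnected S) {g₁ g₂ : X → ℂ} (h₁ : ContinuousOn g₁ S) (h₂ : ContinuousOn g₂ S)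
    (h : ∀ z ∈ S, exp (g₁ z) = exp (g₂ z)) :
    ∃ n : ℤ, ∀ z ∈ S, g₁ z = g₂ z + n * (2 * Real.pi * I) := by
  rcases S.eq_empty_or_nonempty with rfl | ⟨z₀, hz₀⟩
  · exact ⟨0, by simp⟩
  let f : X → ℝ := fun z => ((g₁ z - g₂ z) / (2 * Real.pi * I)).re
  have hf : ContinuousOn f S := Complex.continuous_re.comp_continuousOn ((h₁.sub h₂).div_const _)
  have hint : ∀ z ∈ S, ∃ n : ℤ, g₁ z = g₂ z + n * (2 * Real.pi * I) := fun z hz =>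
    Complex.exp_eq_exp_iff_exists_int.1 (h z hz)
  have hfn : ∀ z ∈ S, ∀ n : ℤ, g₁ z = g₂ z + n * (2 * Real.pi * I) → f z = n := by
    intro z hz n hn
    simp only [f, hn]
    rw [add_sub_cancel_left, mul_div_cancel_right₀ _ two_pi_I_ne_zero]
    simp
  obtain ⟨n, hn⟩ := hint z₀ hz₀
  refine ⟨n, fun z hz => ?_⟩
  have hT : DiscreteTopology (range ((↑) : ℤ → ℝ)) :=
    Int.isClosedEmbedding_coe_real.isEmbedding.toHomeomorph.symm.isEmbedding.discreteTopology
  have := hS.constant_of_mapsTo (T := range ((↑) : ℤ → ℝ)) ⟨hT⟩ hf (fun z hz => by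
    obtain ⟨n, hn⟩ := hint z hz
    exact ⟨n, (hfn z hz n hn).symm⟩) hz hz₀
  obtain ⟨m, hm⟩ := hint z hz
  rw [hfn z hz m hm, hfn z₀ hz₀ n hn] at this
  rw [hm, Int.cast_injective this]

/-- The two logarithms differ on the connected overlap by a constant multiple of `2πi`; after
shifting one of them they glue. Connectedness of the overlap enters Janiszewski's theorem here. -/
theorem HasLog.union (h₁ : HasLog Z₁ x y) (h₂ : HasLog Z₂ x y) (hc₁ : IsClosed Z₁)
    (hc₂ : IsClosed Z₂) (hp : IsPreconnected (Z₁ ∩ Z₂)) (hx : x ∉ Z₁ ∪ Z₂) :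
    HasLog (Z₁ ∪ Z₂) x y := by
  classical
  obtain ⟨g₁, hg₁, h₁⟩ := h₁
  obtain ⟨g₂, hg₂, h₂⟩ := h₂
  obtain ⟨n, hn⟩ := exists_eq_add_of_exp_eq hp (hg₁.mono inter_subset_left)
    (hg₂.mono inter_subset_right) (fun z hz => by
      have hzx : z - x ≠ 0 := sub_ne_zero.2 fun h => hx (h ▸ Or.inl hz.1)
      have hzy : z - y ≠ 0 := fun h => hzx (by rw [h₁ z hz.1, h, zero_mul])
      exact mul_left_cancel₀ hzy ((h₁ z hz.1).symm.trans (h₂ z hz.2)))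
  let g : ℂ → ℂ := fun z => if z ∈ Z₁ then g₁ z else g₂ z + n * (2 * Real.pi * I)
  have e₁ : EqOn g g₁ Z₁ := fun z hz => if_pos hz
  have e₂ : EqOn g (fun z => g₂ z + n * (2 * Real.pi * I)) Z₂ := fun z hz => by
    by_cases hz₁ : z ∈ Z₁
    · exact (e₁ hz₁).trans (hn z ⟨hz₁, hz⟩)
    · exact if_neg hz₁
  refine ⟨g, (hg₁.congr e₁).union_of_isClosed ((hg₂.add continuousOn_const).congr e₂) hc₁ hc₂, ?_⟩
  rintro z (hz | hz)
  · rw [e₁ hz, h₁ z hz]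
  · rw [e₂ hz, Complex.exp_add, Complex.exp_int_mul_two_pi_mul_I, mul_one, h₂ z hz]

/-- A continuous function that agrees with `z - x` far away has a zero. -/
theorem exists_zero_of_eq_sub {φ : ℂ → ℂ} (hφ : Continuous φ) {x : ℂ} {R : ℝ}
    (h : ∀ z, R ≤ dist z x → φ z = z - x) : ∃ z, φ z = 0 := by
  by_contra! h0
  have hsc : IsSimplyConnected (univ : Set ℂ) := by
    have : ContractibleSpace (univ : Set ℂ) := convex_univ.contractibleSpace univ_nonempty
    exact SimplyConnectedSpace.ofContractible _
  obtain ⟨ψ, hψ, he⟩ := exists_continuousOn_eqOn_exp_comp hsc isOpen_univ hφ.continuousOn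
    (by simpa using h0)
  rw [continuousOn_univ] at hψ
  let r := max R 1
  have hr : 0 < r := zero_lt_one.trans_le (le_max_right _ _)
  -- Along a large circle a logarithm `ψ` of `φ` would be `log r + θ I` up to a constant, which is
  -- not periodic in `θ`.
  let c : ℝ → ℂ := fun θ => x + exp (Real.log r + θ * I)
  have hc : Continuous c := by fun_prop
  have hcφ : ∀ θ, exp (ψ (c θ)) = exp (Real.log r + θ * I) := by
    intro θ
    have := he (mem_univ (c θ))
    simp only [Function.comp] at this
    rw [this, h]
    · simp [c]
    · simp only [c, dist_eq_norm, add_sub_cancel_left, Complex.norm_exp]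
      simp [Real.exp_log hr, r]
  obtain ⟨n, hn⟩ := exists_eq_add_of_exp_eq (S := univ) isPreconnected_univ
    (hψ.comp hc).continuousOn (by fun_prop : Continuous fun θ : ℝ => (Real.log r + θ * I : ℂ)).continuousOn
    (fun θ _ => hcφ θ)
  have e0 := hn 0 trivial
  have e1 := hn (2 * Real.pi) trivial
  have : c 0 = c (2 * Real.pi) := by
    simp only [c, Complex.exp_add]
    simp
  simp only [Function.comp, this] at e0
  simp only [Function.comp] at e1
  rw [e0] at e1
  simp at e1

theorem frontier_connectedComponentIn_compl_subset (hZ : IsClosed Z) :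
    frontier (connectedComponentIn Zᶜ x) ⊆ Z := by
  by_cases hx : x ∈ Z
  · rw [connectedComponentIn_eq_empty (by simpa using hx), frontier_empty]
    exact empty_subset _
  intro p hp
  by_contra hpZ
  have hins : IsPreconnected (insert p (connectedComponentIn Zᶜ x)) :=
    isPreconnected_connectedComponentIn.subset_closure (subset_insert _ _)
      (insert_subset (frontier_subset_closure hp) subset_closure)
  have := hins.subset_connectedComponentIn
    (mem_insert_of_mem _ (mem_connectedComponentIn (F := Zᶜ) hx))
    (insert_subset hpZ (connectedComponentIn_subset _ _)) (mem_insert _ _)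
  rw [hZ.isOpen_compl.connectedComponentIn.frontier_eq] at hp
  exact hp.2 this

/-- If `y` were outside the bounded component `U` of `x`, extend the logarithm continuously to the
plane and replace `z - x` on `U` by `(z - y) * exp (G z)`. The result is continuous, equals `z - x`
far away and has no zero, against `exists_zero_of_eq_sub`. -/
theorem HasLog.joinedOff_of_isBounded (hZ : IsCompact Z) (h : HasLog Z x y) (hx : x ∉ Z)
    (hb : Bornology.IsBounded (connectedComponentIn Zᶜ x)) : JoinedOff Z x y := by
  classical
  rw [joinedOff_iff_mem_connectedComponentIn hx]
  by_contra hyU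
  set U := connectedComponentIn Zᶜ x with hU
  have hUo : IsOpen U := hZ.isClosed.isOpen_compl.connectedComponentIn
  have hxU : x ∈ U := mem_connectedComponentIn hx
  obtain ⟨g, hg, hgz⟩ := h
  have hUZ : frontier U ⊆ Z := frontier_connectedComponentIn_compl_subset hZ.isClosed
  obtain ⟨G, hG⟩ := ContinuousMap.exists_restrict_eq hZ.isClosed ⟨Z.domRestrict g, hg.domRestrict⟩
  have hGZ : ∀ z ∈ Z, G z = g z := fun z hz => congr($hG ⟨z, hz⟩)
  have hyU' : y ∉ closure U := by
    intro hy
    by_cases hyZ : y ∈ Z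
    · have := hgz y hyZ
      rw [sub_self, zero_mul, sub_eq_zero] at this
      exact hx (this ▸ hyZ)
    · exact hyZ (hUZ (by rw [hUo.frontier_eq]; exact ⟨hy, hyU⟩))
  let φ : ℂ → ℂ := fun z => if z ∈ U then (z - y) * exp (G z) else z - x
  have hφ : Continuous φ := by
    refine continuous_if (fun z hz => ?_) ?_ ?_
    · rw [hgz z (hUZ hz), hGZ z (hUZ hz)]
    · exact Continuous.continuousOn (by fun_prop)
    · exact Continuous.continuousOn (by fun_prop)
  obtain ⟨R, hR⟩ := hb.subset_ball x
  obtain ⟨z, hz⟩ := exists_zero_of_eq_sub (φ := φ) hφ (x := x) (R := R) (fun z hz =>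
    if_neg fun hzU => (mem_ball.1 (hR hzU)).not_ge hz)
  simp only [φ] at hz
  split_ifs at hz with hzU
  · have := (mul_eq_zero.1 hz).resolve_right (Complex.exp_ne_zero _)
    exact hyU' (sub_eq_zero.1 this ▸ subset_closure hzU)
  · exact hzU (sub_eq_zero.1 hz ▸ hxU)

theorem isConnected_compl_closedBall (R : ℝ) : IsPreconnected (closedBall (0 : ℂ) R)ᶜ := by
  rcases lt_or_ge R 0 with hR | hR
  · rw [closedBall_eq_empty.2 hR, compl_empty]
    exact isPreconnected_univ
  have : (closedBall (0 : ℂ) R)ᶜ =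
      (fun p : ℝ × ℝ => (p.1 * exp (p.2 * I) : ℂ)) '' (Ioi R ×ˢ univ) := by
    ext z
    simp only [mem_compl_iff, mem_closedBall, dist_zero_right, not_le, mem_image, mem_prod,
      mem_Ioi, mem_univ, and_true, Prod.exists]
    constructor
    · exact fun h => ⟨‖z‖, arg z, h, norm_mul_exp_arg_mul_I z⟩
    · rintro ⟨r, θ, h, rfl⟩
      rw [norm_mul, norm_exp_ofReal_mul_I, mul_one, norm_real, Real.norm_eq_abs]
      exact h.trans_le (le_abs_self r)
  rw [this]
  exact (isPreconnected_Ioi.prod isPreconnected_univ).image _ (Continuous.continuousOn (by fun_prop))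

/-- The hard half of Eilenberg's criterion. Unless one of the components is bounded, both reach the
connected complement of a large disc. -/
theorem HasLog.joinedOff (hZ : IsCompact Z) (h : HasLog Z x y) (hx : x ∉ Z) (hy : y ∉ Z) :
    JoinedOff Z x y := by
  by_cases hbx : Bornology.IsBounded (connectedComponentIn Zᶜ x)
  · exact h.joinedOff_of_isBounded hZ hx hbx
  by_cases hby : Bornology.IsBounded (connectedComponentIn Zᶜ y)
  · exact (h.symm.joinedOff_of_isBounded hZ hy hby).symm
  obtain ⟨R, hR⟩ := hZ.isBounded.subset_closedBall 0
  have key : ∀ p ∉ Z, ¬ Bornology.IsBounded (connectedComponentIn Zᶜ p) →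
      ∃ q ∈ (closedBall (0 : ℂ) R)ᶜ, JoinedOff Z p q := by
    intro p hp hb
    by_contra! hcon
    refine hb ((isBounded_closedBall (x := (0 : ℂ)) (r := R)).subset fun q hq => ?_)
    by_contra hq'
    exact hcon q hq' ((joinedOff_iff_mem_connectedComponentIn hp).2 hq)
  obtain ⟨q, hq, hxq⟩ := key x hx hbx
  obtain ⟨q', hq', hyq⟩ := key y hy hby
  have : JoinedOff Z q q' := ⟨_, isConnected_compl_closedBall R, hq, hq',
    (disjoint_compl_left (a := closedBall (0 : ℂ) R)).mono_right hR⟩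
  exact (hxq.trans this).trans hyq.symm

/-- **Janiszewski's theorem**: if neither of two compact sets with connected intersection separates
two points, their union does not either. -/
theorem JoinedOff.union (h₁ : JoinedOff Z₁ x y) (h₂ : JoinedOff Z₂ x y) (hc₁ : IsCompact Z₁)
    (hc₂ : IsCompact Z₂) (hp : IsPreconnected (Z₁ ∩ Z₂)) : JoinedOff (Z₁ ∪ Z₂) x y := by
  have hx : x ∉ Z₁ ∪ Z₂ := fun h => h.elim h₁.left_notMem h₂.left_notMem
  have hy : y ∉ Z₁ ∪ Z₂ := fun h => h.elim h₁.right_notMem h₂.right_notMem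
  exact ((h₁.hasLog hc₁.isClosed).union (h₂.hasLog hc₂.isClosed) hc₁.isClosed hc₂.isClosed hp
    hx).joinedOff (hc₁.union hc₂) hx hy

/-- An arc does not separate the plane. -/
theorem joinedOff_arc {γ : ℝ → ℂ} {s t : ℝ} (hst : s ≤ t)
    (hγ : ContinuousOn γ (Icc s t)) (hinj : InjOn γ (Icc s t)) (hx : x ∉ γ '' Icc s t)
    (hy : y ∉ γ '' Icc s t) : JoinedOff (γ '' Icc s t) x y := by
  have hne : ∀ {p τ}, p ∉ γ '' Icc s t → γ (projIcc s t hst τ) - p ≠ 0 := fun hp h =>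
    hp ⟨_, (projIcc s t hst _).2, sub_eq_zero.1 h⟩
  have hc : Continuous fun τ => γ (projIcc s t hst τ) :=
    hγ.comp_continuous (continuous_subtype_val.comp continuous_projIcc) fun τ => Subtype.prop _
  have hsc : IsSimplyConnected (univ : Set ℝ) := by
    have : ContractibleSpace (univ : Set ℝ) := convex_univ.contractibleSpace univ_nonempty
    exact SimplyConnectedSpace.ofContractible _
  obtain ⟨ψ, hψ, he⟩ := exists_continuousOn_eqOn_exp_comp hsc isOpen_univ
    (g := fun τ => (γ (projIcc s t hst τ) - x) / (γ (projIcc s t hst τ) - y))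
    (((hc.sub continuous_const).div (hc.sub continuous_const) fun τ => hne hy).continuousOn)
    (by rintro ⟨τ, -, h⟩; exact div_ne_zero (hne hx) (hne hy) h)
  rw [continuousOn_univ] at hψ
  have hemb : Topology.IsClosedEmbedding ((Icc s t).domRestrict γ) :=
    hγ.domRestrict.isClosedEmbedding (injOn_iff_injective.1 hinj)
  obtain ⟨G, hG⟩ := ContinuousMap.exists_extension' hemb ⟨fun τ => ψ τ, by fun_prop⟩
  have hcomp : IsCompact (γ '' Icc s t) := isCompact_Icc.image_of_continuousOn hγ
  refine HasLog.joinedOff hcomp ⟨G, G.continuous.continuousOn, ?_⟩ hx hy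
  rintro _ ⟨τ, hτ, rfl⟩
  have e1 : G (γ τ) = ψ τ := congrFun hG ⟨τ, hτ⟩
  have e2 := he (mem_univ τ)
  simp only [Function.comp, projIcc_of_mem hst hτ] at e2
  have : γ τ - y ≠ 0 := fun h => hy ⟨τ, hτ, sub_eq_zero.1 h⟩
  rw [e1, e2, mul_div_cancel₀ _ this]

theorem inter_frontier_nonempty_of_isPreconnected {S U : Set ℂ} (hS : IsPreconnected S)
    (hne : (S ∩ U).Nonempty) (hne' : (S ∩ Uᶜ).Nonempty) : (S ∩ frontier U).Nonempty := by
  by_contra h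
  have h' : ∀ p ∈ S, p ∈ closure U → p ∈ interior U := fun p hp hpc => by
    by_contra hpi
    exact h ⟨p, hp, hpc, hpi⟩
  have := hS _ _ isOpen_interior isClosed_closure.isOpen_compl (fun p hp => by
    by_cases hpc : p ∈ closure U
    · exact Or.inl (h' p hp hpc)
    · exact Or.inr hpc) (hne.imp fun p hp => ⟨hp.1, h' p hp.1 (subset_closure hp.2)⟩)
    (hne'.imp fun p hp => ⟨hp.1, fun hpc => hp.2 (interior_subset (h' p hp.1 hpc))⟩)
  obtain ⟨p, -, hp, hp'⟩ := this
  exact hp' (subset_closure (interior_subset hp))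

theorem IsPreconnected.subset_of_disjoint_frontier {S U : Set ℂ} (hS : IsPreconnected S)
    (h : Disjoint S (frontier U)) (hne : (S ∩ U).Nonempty) : S ⊆ U := by
  intro p hp
  by_contra hpU
  obtain ⟨q, hq, hq'⟩ := inter_frontier_nonempty_of_isPreconnected hS hne ⟨p, hp, hpU⟩
  exact disjoint_left.1 h hq hq'

/-- The boundary of a region cannot be split at a point by a connected set outside the region. -/
theorem frontier_not_split {f B₁ B₂ M : Set ℂ} {z v v' : ℂ} (hf : IsOpen f)
    (hfc : IsConnected f) (hc₁ : IsCompact B₁) (hc₂ : IsCompact B₂)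
    (hfr : frontier f = B₁ ∪ B₂) (hB : B₁ ∩ B₂ ⊆ {z}) (hzf : z ∉ f)
    (hM : IsPreconnected M) (hMf : Disjoint M f) (hz : z ∉ M) (hv : v ∈ M) (hv₁ : v ∈ B₁)
    (hv' : v' ∈ M) (hv₂ : v' ∈ B₂) : False := by
  obtain ⟨x, hx⟩ := hfc.nonempty
  have hfB : ∀ p ∈ f, p ∉ B₁ ∪ B₂ := fun p hp h => by
    rw [← hfr, hf.frontier_eq] at h
    exact h.2 hp
  have hx₁ : x ∉ B₁ := fun h => hfB x hx (Or.inl h)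
  have hx₂ : x ∉ B₂ := fun h => hfB x hx (Or.inr h)
  have hcl : ∀ p ∈ B₁ ∪ B₂, IsPreconnected (insert p f) := fun p hp =>
    hfc.isPreconnected.subset_closure (subset_insert _ _)
      (insert_subset (frontier_subset_closure (hfr ▸ hp)) subset_closure)
  have h₂₁ : ∀ p ∈ B₂, p ∉ B₁ → JoinedOff B₁ x p := fun p hp hp' =>
    ⟨_, hcl p (Or.inr hp), mem_insert_of_mem _ hx, mem_insert _ _, disjoint_left.2 (by
      rintro q (rfl | hq)
      · exact hp'
      · exact fun h => hfB q hq (Or.inl h))⟩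
  have h₁₂ : ∀ p ∈ B₁, p ∉ B₂ → JoinedOff B₂ x p := fun p hp hp' =>
    ⟨_, hcl p (Or.inl hp), mem_insert_of_mem _ hx, mem_insert _ _, disjoint_left.2 (by
      rintro q (rfl | hq)
      · exact hp'
      · exact fun h => hfB q hq (Or.inr h))⟩
  have hU : ∀ {B : Set ℂ}, IsCompact B → x ∉ B → IsOpen {p | JoinedOff B x p} := by
    intro B hB hxB
    have : {p | JoinedOff B x p} = connectedComponentIn Bᶜ x := by
      ext p; exact joinedOff_iff_mem_connectedComponentIn hxB
    rw [this]
    exact hB.isClosed.isOpen_compl.connectedComponentIn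
  -- By Janiszewski's theorem a point of `M` is cut off from `x` by `B₁` or by `B₂`. Both conditions
  -- are closed and both occur on `M`, so some `y ∈ M` satisfies both.
  have hcov : M ⊆ {p | JoinedOff B₁ x p}ᶜ ∪ {p | JoinedOff B₂ x p}ᶜ := by
    intro y hy
    by_contra hcon
    simp only [mem_union, mem_compl_iff, mem_ofPred_eq, not_or, not_not] at hcon
    obtain ⟨S, hS, hxS, hyS, hd⟩ := hcon.1.union hcon.2 hc₁ hc₂
      (subsingleton_singleton.anti hB).isPreconnected
    rw [← hfr] at hd
    exact disjoint_left.1 hMf hy (hS.subset_of_disjoint_frontier hd ⟨x, hxS, hx⟩ hyS)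
  obtain ⟨y, hyM, hy⟩ := isPreconnected_closed_iff.1 hM _ _ (hU hc₁ hx₁).isClosed_compl
    (hU hc₂ hx₂).isClosed_compl hcov ⟨v, hv, fun h => JoinedOff.right_notMem h hv₁⟩
    ⟨v', hv', fun h => JoinedOff.right_notMem h hv₂⟩
  simp only [mem_inter_iff, mem_compl_iff, mem_ofPred_eq] at hy
  have hyz : y ≠ z := fun h => hz (h ▸ hyM)
  have hy₁ : y ∉ B₁ := fun h => hy.2 (h₁₂ y h fun h' => hyz (hB ⟨h, h'⟩))
  set W := connectedComponentIn B₁ᶜ y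
  have hyW : y ∈ W := mem_connectedComponentIn (F := B₁ᶜ) hy₁
  have hxW : x ∉ W := fun h =>
    hy.1 ((joinedOff_iff_mem_connectedComponentIn hy₁).2 h).symm
  have hWp : IsPreconnected W := isPreconnected_connectedComponentIn
  have hW₁ : ∀ p ∈ W, p ∉ B₁ := fun p hp => connectedComponentIn_subset B₁ᶜ y hp
  have hW₂ : ∀ p ∈ W, p ∉ B₂ := fun p hp hp' =>
    hy.1 ((h₂₁ p hp' (hW₁ p hp)).trans
      ((joinedOff_iff_mem_connectedComponentIn hy₁).2 hp).symm)
  have hxz : x ≠ z := fun h => hzf (h ▸ hx)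
  obtain ⟨q, hqz, hq⟩ := inter_frontier_nonempty_of_isPreconnected
    (isConnected_compl_singleton_of_one_lt_rank
      (by rw [Complex.rank_real_complex]; norm_num) z).isPreconnected
    ⟨y, hyz, hyW⟩ ⟨x, hxz, hxW⟩
  have hq₁ : q ∈ B₁ := frontier_connectedComponentIn_compl_subset hc₁.isClosed hq
  have hq₂ : q ∉ B₂ := fun h => hqz (hB ⟨hq₁, h⟩)
  refine hy.2 ((h₁₂ q hq₁ hq₂).trans ⟨insert q W, ?_, mem_insert _ _, mem_insert_of_mem _ hyW,
    disjoint_left.2 ?_⟩)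
  · exact hWp.subset_closure (subset_insert _ _)
      (insert_subset (frontier_subset_closure hq) subset_closure)
  · rintro p (rfl | hp)
    · exact hq₂
    · exact hW₂ p hp

end PlaneSeparation

/-! ### Regions bounded by a Jordan curve: crosscuts and interlaced pairs of boundary points. -/

section JordanRegion

open Set Metric

/-- `γ` parametrizes the Jordan curve `J` with period one. -/
structure JordanParam (γ : ℝ → ℂ) (J : Set ℂ) : Prop where
  continuous : Continuous γ
  range_eq : range γ = J
  eq_iff : ∀ s t, γ s = γ t ↔ ∃ n : ℤ, s = t + n

theorem exists_jordanParam {J : Set ℂ} (h : Nonempty (J ≃ₜ Circle)) {p : ℂ} (hp : p ∈ J) :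
    ∃ γ, JordanParam γ J ∧ γ 0 = p := by
  obtain ⟨h⟩ := h
  have hpi := Real.pi_pos
  refine ⟨fun t => h.symm (h ⟨p, hp⟩ * Circle.exp (2 * Real.pi * t)), ⟨?_, ?_, ?_⟩, by simp⟩
  · fun_prop
  · ext q
    constructor
    · rintro ⟨t, rfl⟩
      exact Subtype.prop _
    · intro hq
      obtain ⟨θ, hθ⟩ : ∃ θ, Circle.exp θ = (h ⟨p, hp⟩)⁻¹ * h ⟨q, hq⟩ :=
        ⟨_, Circle.exp_arg _⟩
      refine ⟨θ / (2 * Real.pi), ?_⟩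
      simp only
      rw [mul_div_cancel₀ _ (by positivity), hθ, mul_inv_cancel_left, h.symm_apply_apply]
  · intro s t
    rw [Subtype.coe_inj, h.symm.injective.eq_iff, mul_right_inj, Circle.exp_eq_exp]
    refine exists_congr fun n => ⟨fun h => ?_, fun h => by rw [h]; ring⟩
    have : 2 * Real.pi * s = 2 * Real.pi * (t + n) := by rw [h]; ring
    exact mul_left_cancel₀ (by positivity) this

namespace JordanParam

variable {γ : ℝ → ℂ} {J : Set ℂ} (hγ : JordanParam γ J) {s t u : ℝ}

include hγ

theorem shift (s : ℝ) : JordanParam (fun t => γ (t + s)) J where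
  continuous := hγ.continuous.comp (by fun_prop)
  range_eq := by
    rw [← hγ.range_eq]
    exact (Equiv.addRight s).surjective.range_comp γ
  eq_iff u v := by
    rw [hγ.eq_iff]
    exact exists_congr fun n => by constructor <;> intro h <;> linarith

theorem mem (t : ℝ) : γ t ∈ J := hγ.range_eq ▸ mem_range_self t

theorem image_subset (S : Set ℝ) : γ '' S ⊆ J := by
  rintro _ ⟨t, -, rfl⟩
  exact hγ.mem t

theorem add_one (t : ℝ) : γ (t + 1) = γ t := (hγ.eq_iff _ _).2 ⟨1, by simp⟩

theorem eq_of_abs_lt (h : γ s = γ t) (hst : |s - t| < 1) : s = t := by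
  obtain ⟨n, hn⟩ := (hγ.eq_iff s t).1 h
  have : |(n : ℝ)| < 1 := by rwa [hn, add_sub_cancel_left] at hst
  have h0 : n = 0 := by
    rw [← Int.cast_abs] at this
    exact Int.abs_lt_one_iff.1 (by exact_mod_cast this)
  simpa [h0] using hn

theorem injOn (h : t < s + 1) : InjOn γ (Icc s t) := fun u hu v hv huv =>
  hγ.eq_of_abs_lt huv (abs_sub_lt_iff.2 ⟨by linarith [hu.2, hv.1], by linarith [hv.2, hu.1]⟩)

theorem exists_mem_Ico {p : ℂ} (hp : p ∈ J) (s : ℝ) : ∃ t ∈ Ico s (s + 1), γ t = p := by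
  rw [← hγ.range_eq] at hp
  obtain ⟨t, rfl⟩ := hp
  refine ⟨t - ⌊t - s⌋, ⟨?_, ?_⟩, (hγ.eq_iff _ _).2 ⟨-⌊t - s⌋, by push_cast; ring⟩⟩
  · linarith [Int.floor_le (t - s)]
  · linarith [Int.lt_floor_add_one (t - s)]

theorem union_arcs (hst : s ≤ t) (ht : t ≤ s + 1) :
    γ '' Icc s t ∪ γ '' Icc t (s + 1) = J := by
  rw [← image_union, Icc_union_Icc_eq_Icc hst ht]
  refine (hγ.image_subset _).antisymm fun p hp => ?_
  obtain ⟨u, hu, rfl⟩ := hγ.exists_mem_Ico hp s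
  exact ⟨u, Ico_subset_Icc_self hu, rfl⟩

theorem inter_arcs (hst : s ≤ t) (ht : t ≤ s + 1) :
    γ '' Icc s t ∩ γ '' Icc t (s + 1) = {γ s, γ t} := by
  apply Subset.antisymm
  · rintro _ ⟨⟨u, hu, rfl⟩, v, hv, huv⟩
    by_cases h : |v - u| < 1
    · have := hγ.eq_of_abs_lt huv h
      have : u = t := le_antisymm hu.2 (this ▸ hv.1)
      exact Or.inr (this ▸ rfl)
    · have : v - u = |v - u| := (abs_of_nonneg (by linarith [hv.1, hu.2])).symm
      have : u = s := by linarith [hv.2, hu.1, not_lt.1 h]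
      exact Or.inl (this ▸ rfl)
  · rintro _ (rfl | rfl)
    · exact ⟨mem_image_of_mem _ ⟨le_rfl, hst⟩, s + 1, ⟨ht, le_rfl⟩, hγ.add_one s⟩
    · exact ⟨mem_image_of_mem _ ⟨hst, le_rfl⟩, mem_image_of_mem _ ⟨le_rfl, ht⟩⟩

theorem notMem_arc (hut : u < s) (hu : t < u + 1) : γ u ∉ γ '' Icc s t := by
  rintro ⟨v, hv, h⟩
  have := hγ.eq_of_abs_lt h (by rw [abs_lt]; constructor <;> linarith [hv.1, hv.2])
  linarith [hv.1]

theorem isCompact_arc (s t : ℝ) : IsCompact (γ '' Icc s t) := isCompact_Icc.image hγ.continuous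

theorem isPreconnected_arc (s t : ℝ) : IsPreconnected (γ '' Icc s t) :=
  isPreconnected_Icc.image _ hγ.continuous.continuousOn

theorem isCompact : IsCompact J := by
  rw [← hγ.union_arcs (zero_le_one) (by norm_num : (1 : ℝ) ≤ 0 + 1)]
  exact (hγ.isCompact_arc _ _).union (hγ.isCompact_arc _ _)

/-- Near one of its points, the curve coincides with any subarc around that point. -/
theorem exists_ball_inter_subset {η : ℝ} (hη : 0 < η) (hη' : η < 1 / 2) (s : ℝ) :
    ∃ r > 0, ball (γ s) r ∩ J ⊆ γ '' Ioo (s - η) (s + η) := by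
  have hn : γ s ∉ γ '' Icc (s + η) (s + 1 - η) := hγ.notMem_arc (by linarith) (by linarith)
  obtain ⟨r, hr, hd⟩ := Metric.isOpen_iff.1 (hγ.isCompact_arc (s + η) (s + 1 - η)).isClosed.isOpen_compl
    _ hn
  refine ⟨r, hr, fun p ⟨hp, hpJ⟩ => ?_⟩
  obtain ⟨u, hu, rfl⟩ := hγ.exists_mem_Ico hpJ (s - η)
  refine ⟨u, ⟨hu.1.lt_of_ne fun h => ?_, not_le.1 fun h => ?_⟩, rfl⟩
  · refine hd hp ⟨u + 1, ⟨by linarith, by linarith⟩, hγ.add_one u⟩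
  · exact hd hp ⟨u, ⟨h, by linarith [hu.2]⟩, rfl⟩

theorem exists_arc_subset {W : Set ℂ} (hW : IsOpen W) (hs : γ s ∈ W) :
    ∃ η > 0, η < 1 / 2 ∧ γ '' Icc (s - η) (s + η) ⊆ W := by
  obtain ⟨η, hη, h⟩ := Metric.isOpen_iff.1 (hW.preimage hγ.continuous) s hs
  refine ⟨min (η / 2) (1 / 4), by positivity, by linarith [min_le_right (η / 2) (1 / 4)], ?_⟩
  rintro _ ⟨t, ht, rfl⟩
  have := min_le_left (η / 2) (1 / 4)
  refine h (mem_ball.2 ?_)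
  rw [Real.dist_eq, abs_lt]
  constructor <;> linarith [ht.1, ht.2]

end JordanParam

variable {F : Set ℂ} {γ : ℝ → ℂ}

/-- A subarc of the boundary together with a segment that enters the region. -/
theorem exists_hair (hF : IsOpen F) (hγ : JordanParam γ (frontier F)) {s : ℝ} {W : Set ℂ}
    (hW : IsOpen W) (hs : γ s ∈ W) :
    ∃ H β : Set ℂ, IsCompact H ∧ IsPreconnected H ∧ IsPreconnected β ∧ γ s ∈ β ∧
      β ⊆ W ∩ frontier F ∧ H ∩ Fᶜ = β ∧ (H ∩ F).Nonempty := by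
  obtain ⟨η, hη, hη', hβW⟩ := hγ.exists_arc_subset hW hs
  obtain ⟨r, hr, hβ⟩ := hγ.exists_ball_inter_subset hη hη' s
  have hcl : γ s ∈ closure F := frontier_subset_closure (hγ.mem s)
  obtain ⟨x, hx, hxF⟩ := mem_closure_iff.1 hcl _ isOpen_ball (mem_ball_self hr)
  have hnF : ∀ p ∈ frontier F, p ∉ F := fun p hp => by
    rw [hF.frontier_eq] at hp
    exact hp.2
  let σ : ℝ → ℂ := AffineMap.lineMap x (γ s)
  have hσ : Continuous σ := AffineMap.lineMap_continuous
  have hσ0 : σ 0 = x := AffineMap.lineMap_apply_zero _ _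
  have hσ1 : σ 1 = γ s := AffineMap.lineMap_apply_one _ _
  obtain ⟨τ, hτ, hτm⟩ := (isCompact_Icc.inter_right
    ((hF.preimage hσ).isClosed_compl)).exists_isLeast
    ⟨1, ⟨zero_le_one, le_rfl⟩, by simpa [hσ1] using hnF _ (hγ.mem s)⟩
  have hlt : ∀ u ∈ Icc 0 τ, u ≠ τ → σ u ∈ F := fun u hu hne => by
    by_contra h
    exact hne (hu.2.antisymm (hτm ⟨⟨hu.1, hu.2.trans hτ.1.2⟩, h⟩))
  have h0τ : 0 < τ := hτ.1.1.lt_of_ne fun h => hτ.2 (by simpa [← h, hσ0] using hxF)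
  have hστ : σ τ ∈ γ '' Icc (s - η) (s + η) := by
    refine image_mono Ioo_subset_Icc_self (hβ ⟨?_, ?_⟩)
    · exact (convex_ball (γ s) r).lineMap_mem hx (mem_ball_self hr) hτ.1
    · rw [hF.frontier_eq]
      refine ⟨?_, hτ.2⟩
      have : τ ∈ closure (Ico 0 τ) := by
        rw [closure_Ico h0τ.ne]
        exact ⟨h0τ.le, le_rfl⟩
      refine closure_mono ?_ (image_closure_subset_closure_image hσ (mem_image_of_mem _ this))
      rintro _ ⟨u, hu, rfl⟩
      exact hlt u (Ico_subset_Icc_self hu) hu.2.ne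
  refine ⟨γ '' Icc (s - η) (s + η) ∪ σ '' Icc 0 τ, γ '' Icc (s - η) (s + η),
    (hγ.isCompact_arc _ _).union (isCompact_Icc.image hσ), ?_, hγ.isPreconnected_arc _ _,
    ⟨s, ⟨by linarith, by linarith⟩, rfl⟩, subset_inter hβW (hγ.image_subset _), ?_, ?_⟩
  · exact (hγ.isPreconnected_arc _ _).union (σ τ) hστ ⟨τ, ⟨h0τ.le, le_rfl⟩, rfl⟩
      (isPreconnected_Icc.image _ hσ.continuousOn)
  · apply Subset.antisymm
    · rintro p ⟨hp | ⟨u, hu, rfl⟩, hpF⟩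
      · exact hp
      · by_cases h : u = τ
        · exact h ▸ hστ
        · exact absurd (hlt u hu h) hpF
    · exact fun p hp => ⟨Or.inl hp, hnF _ (hγ.image_subset _ hp)⟩
  · exact ⟨x, Or.inr ⟨0, ⟨le_rfl, h0τ.le⟩, hσ0⟩, hxF⟩

/-- Two boundary points can be joined through the region, up to small subarcs of the boundary. -/
theorem exists_crosscut (hF : IsOpen F) (hFc : IsConnected F) (hγ : JordanParam γ (frontier F))
    {s t : ℝ} {Ws Wt : Set ℂ} (hWs : IsOpen Ws) (hs : γ s ∈ Ws) (hWt : IsOpen Wt)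
    (ht : γ t ∈ Wt) :
    ∃ L β₁ β₂ : Set ℂ, IsCompact L ∧ IsPreconnected L ∧ IsPreconnected β₁ ∧ IsPreconnected β₂ ∧
      γ s ∈ β₁ ∧ γ t ∈ β₂ ∧ β₁ ⊆ Ws ∩ frontier F ∧ β₂ ⊆ Wt ∩ frontier F ∧ L ∩ Fᶜ = β₁ ∪ β₂ := by
  obtain ⟨H₁, β₁, h1, h2, h3, h4, h5, h6, x, hx, hxF⟩ := exists_hair hF hγ hWs hs
  obtain ⟨H₂, β₂, k1, k2, k3, k4, k5, k6, y, hy, hyF⟩ := exists_hair hF hγ hWt ht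
  obtain ⟨p, hp⟩ := (hF.isConnected_iff_isPathConnected.1 hFc).joinedIn x hxF y hyF
  refine ⟨H₁ ∪ range p ∪ H₂, β₁, β₂, (h1.union (isCompact_range p.continuous)).union k1, ?_,
    h3, k3, h4, k4, h5, k5, ?_⟩
  · have := h2.union x hx (mem_range.2 ⟨0, p.source⟩) (isPreconnected_range p.continuous)
    exact this.union y (Or.inr (mem_range.2 ⟨1, p.target⟩)) hy k2
  · have : range p ∩ Fᶜ = ∅ := by
      ext q
      simp only [mem_inter_iff, mem_range, mem_compl_iff, mem_empty_iff_false, iff_false, not_and,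
        not_not]
      rintro ⟨u, rfl⟩
      exact hp u
    rw [union_inter_distrib_right, union_inter_distrib_right, h6, k6, this, union_empty]

/-- Every boundary point is adherent to the component of any point outside the closure. -/
theorem exists_joinedOff_of_mem_frontier (hF : IsOpen F) (hFc : IsConnected F)
    (hγ : JordanParam γ (frontier F)) {o : ℂ} (ho : o ∉ closure F) (s : ℝ) {r : ℝ} (hr : 0 < r) :
    ∃ q ∈ ball (γ s) r, JoinedOff (frontier F) o q := by
  obtain ⟨η, hη, hη', hβ⟩ := hγ.exists_arc_subset (W := ball (γ s) r) isOpen_ball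
    (mem_ball_self hr)
  obtain ⟨x, hx⟩ := hFc.nonempty
  have hxJ : x ∉ frontier F := by
    rw [hF.frontier_eq]
    exact fun h => h.2 hx
  have hoJ : o ∉ frontier F := fun h => ho (frontier_subset_closure h)
  -- The complementary subarc of the curve does not separate `o` from `F`, so a connected set leaves
  -- the component of `o` through the small subarc around `γ s`.
  obtain ⟨S, hS, hoS, hxS, hd⟩ := joinedOff_arc (x := o) (y := x)
    (by linarith : s + η ≤ s + 1 - η) hγ.continuous.continuousOn
    (hγ.injOn (by linarith)) (fun h => hoJ (hγ.image_subset _ h))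
    (fun h => hxJ (hγ.image_subset _ h))
  have hne : ¬ JoinedOff (frontier F) o x := by
    rintro ⟨S', hS', hoS', hxS', hd'⟩
    exact ho (subset_closure (hS'.subset_of_disjoint_frontier hd' ⟨x, hxS', hx⟩ hoS'))
  rw [joinedOff_iff_mem_connectedComponentIn hoJ] at hne
  obtain ⟨p, hpS, hp⟩ := inter_frontier_nonempty_of_isPreconnected hS
    ⟨o, hoS, mem_connectedComponentIn (F := (frontier F)ᶜ) hoJ⟩ ⟨x, hxS, hne⟩
  have hpJ : p ∈ frontier F := frontier_connectedComponentIn_compl_subset isClosed_frontier hp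
  have hpβ : p ∈ γ '' Icc (s - η) (s + η) := by
    obtain ⟨u, hu, rfl⟩ := hγ.exists_mem_Ico hpJ (s - η)
    refine ⟨u, ⟨hu.1, not_lt.1 fun h => ?_⟩, rfl⟩
    exact disjoint_left.1 hd hpS ⟨u, ⟨h.le, by linarith [hu.2]⟩, rfl⟩
  obtain ⟨q, hq, hq'⟩ := mem_closure_iff.1 (frontier_subset_closure hp) _ isOpen_ball (hβ hpβ)
  exact ⟨q, hq, (joinedOff_iff_mem_connectedComponentIn hoJ).2 hq'⟩

/-- The component of `o` off the curve misses the closure of `F`, hence `Z`, and comes arbitrarily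
close to `γ s`; a small disc off `Z` bridges the remaining gap. -/
theorem joinedOff_boundary_of_notMem_closure (hF : IsOpen F) (hFc : IsConnected F)
    (hγ : JordanParam γ (frontier F)) {o : ℂ} (ho : o ∉ closure F) {s : ℝ} {Z : Set ℂ}
    (hZ : IsClosed Z) (hZF : Z ⊆ closure F) (hs : γ s ∉ Z) : JoinedOff Z o (γ s) := by
  obtain ⟨r, hr, hd⟩ := Metric.isOpen_iff.1 hZ.isOpen_compl _ hs
  obtain ⟨q, hq, S, hS, hoS, hqS, hSd⟩ := exists_joinedOff_of_mem_frontier hF hFc hγ ho s hr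
  have hSF : Disjoint S (closure F) := by
    refine disjoint_left.2 fun p hp hpc => ?_
    have hpF : p ∈ F := by
      by_contra h
      exact disjoint_left.1 hSd hp (by rw [hF.frontier_eq]; exact ⟨hpc, h⟩)
    exact ho (subset_closure (hS.subset_of_disjoint_frontier hSd ⟨p, hp, hpF⟩ hoS))
  have h1 : JoinedOff Z o q := ⟨S, hS, hoS, hqS, hSF.mono_right hZF⟩
  exact h1.trans (joinedOff_of_ball (subset_compl_iff_disjoint_right.1 hd) hq (mem_ball_self hr))

/-- The complement of the closure of a Jordan region is connected. -/
theorem joinedOff_of_notMem_closure (hF : IsOpen F) (hFc : IsConnected F)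
    (hγ : JordanParam γ (frontier F)) {o o' : ℂ} (ho : o ∉ closure F) (ho' : o' ∉ closure F) :
    JoinedOff (frontier F) o o' := by
  have hnF : ∀ p ∈ frontier F, p ∉ F := fun p hp => by
    rw [hF.frontier_eq] at hp
    exact hp.2
  have hne : ∀ s t : ℝ, s ≠ t → |s - t| < 1 → γ s ≠ γ t := fun s t h h' he =>
    h (hγ.eq_of_abs_lt he h')
  have hW : IsOpen ({γ (1 / 4), γ (3 / 4)} : Set ℂ)ᶜ := (toFinite _).isClosed.isOpen_compl
  obtain ⟨L, β₁, β₂, hLc, hL, -, -, h0, h2, hβ₁, hβ₂, hLF⟩ := exists_crosscut hF hFc hγ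
    (s := 0) (t := 1 / 2) hW (by
      rintro (h | h)
      · exact hne _ _ (by norm_num) (by rw [abs_lt]; norm_num) h
      · exact hne _ _ (by norm_num) (by rw [abs_lt]; norm_num) h) hW (by
      rintro (h | h)
      · exact hne _ _ (by norm_num) (by rw [abs_lt]; norm_num) h
      · exact hne _ _ (by norm_num) (by rw [abs_lt]; norm_num) h)
  have hLW : ∀ p ∈ L, p ∉ F → p ∈ ({γ (1 / 4), γ (3 / 4)} : Set ℂ)ᶜ ∩ frontier F := by
    intro p hp hpF
    have : p ∈ β₁ ∪ β₂ := hLF ▸ ⟨hp, hpF⟩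
    exact this.elim (fun h => hβ₁ h) (fun h => hβ₂ h)
  have hLcl : L ⊆ closure F := fun p hp => by
    by_cases hpF : p ∈ F
    · exact subset_closure hpF
    · exact frontier_subset_closure (hLW p hp hpF).2
  have h0L : γ 0 ∈ L := (hLF.ge (Or.inl h0)).1
  have h2L : γ (1 / 2) ∈ L := (hLF.ge (Or.inr h2)).1
  have e1 := hγ.union_arcs (s := 0) (t := 1 / 2) (by norm_num) (by norm_num)
  have e2 := hγ.inter_arcs (s := 0) (t := 1 / 2) (by norm_num) (by norm_num)
  set α₁ := γ '' Icc 0 (1 / 2)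
  set α₂ := γ '' Icc (1 / 2) (0 + 1)
  have hα₁ : IsCompact (L ∪ α₁) := hLc.union (hγ.isCompact_arc _ _)
  have hα₂ : IsCompact (L ∪ α₂) := hLc.union (hγ.isCompact_arc _ _)
  have hcl₁ : L ∪ α₁ ⊆ closure F :=
    union_subset hLcl ((hγ.image_subset _).trans frontier_subset_closure)
  have hcl₂ : L ∪ α₂ ⊆ closure F :=
    union_subset hLcl ((hγ.image_subset _).trans frontier_subset_closure)
  have hn₁ : γ (3 / 4) ∉ L ∪ α₁ := by
    rintro (h | ⟨u, hu, h⟩)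
    · exact (hLW _ h (hnF _ (hγ.mem _))).1 (Or.inr rfl)
    · exact hne _ _ (by linarith [hu.2]) (by rw [abs_lt]; constructor <;> linarith [hu.1, hu.2]) h
  have hn₂ : γ (1 / 4) ∉ L ∪ α₂ := by
    rintro (h | ⟨u, hu, h⟩)
    · exact (hLW _ h (hnF _ (hγ.mem _))).1 (Or.inl rfl)
    · exact hne _ _ (by linarith [hu.1]) (by rw [abs_lt]; constructor <;> linarith [hu.1, hu.2]) h
  have j : ∀ {p}, p ∉ closure F → JoinedOff (L ∪ α₁) p (γ (3 / 4)) ∧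
      JoinedOff (L ∪ α₂) p (γ (1 / 4)) := fun hp =>
    ⟨joinedOff_boundary_of_notMem_closure hF hFc hγ hp hα₁.isClosed hcl₁ hn₁,
      joinedOff_boundary_of_notMem_closure hF hFc hγ hp hα₂.isClosed hcl₂ hn₂⟩
  -- The crosscut with either arc does not separate `o` from `o'`, because the midpoint of the other
  -- arc is accessible from both. The two sets overlap in the connected set `L`.
  have := ((j ho).1.trans (j ho').1.symm).union ((j ho).2.trans (j ho').2.symm) hα₁ hα₂ (by
    rw [← union_inter_distrib_left, e2, union_eq_self_of_subset_right]
    · exact hL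
    · rintro _ (rfl | rfl)
      · exact h0L
      · exact h2L)
  refine this.mono fun p hp => ?_
  rw [← e1] at hp
  exact hp.imp (fun h => Or.inr h) (fun h => Or.inr h)

/-- Two connected sets outside a Jordan region that join interlaced pairs of boundary points
intersect. -/
theorem inter_nonempty_of_interlaced (hF : IsOpen F) (hFc : IsConnected F)
    (hγ : JordanParam γ (frontier F)) {s₁ s₂ s₃ : ℝ} (h₁ : 0 < s₁) (h₁₂ : s₁ < s₂)
    (h₂₃ : s₂ < s₃) (h₃ : s₃ < 1) {K S : Set ℂ} (hKc : IsCompact K) (hK : IsPreconnected K)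
    (hKF : Disjoint K F) (h0K : γ 0 ∈ K) (h2K : γ s₂ ∈ K) (hS : IsPreconnected S)
    (hSF : Disjoint S F) (hSJ : IsClosed (S ∩ frontier F)) (h1S : γ s₁ ∈ S) (h3S : γ s₃ ∈ S) :
    (K ∩ S).Nonempty := by
  by_contra hKS
  have hKS : ∀ p ∈ K, p ∉ S := fun p hp h => hKS ⟨p, hp, h⟩
  have e1 := hγ.union_arcs (s := 0) (t := s₂) (by linarith) (by linarith)
  have e2 := hγ.inter_arcs (s := 0) (t := s₂) (by linarith) (by linarith)
  have hne : ∀ s t : ℝ, s ≠ t → |s - t| < 1 → γ s ≠ γ t := fun s t h h' he =>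
    h (hγ.eq_of_abs_lt he h')
  have hn₁ : γ s₃ ∉ γ '' Icc 0 s₂ := by
    rintro ⟨u, hu, h⟩
    exact hne _ _ (by linarith [hu.2]) (by rw [abs_lt]; constructor <;> linarith [hu.1, hu.2]) h
  have hn₂ : γ s₁ ∉ γ '' Icc s₂ (0 + 1) := by
    rintro ⟨u, hu, h⟩
    exact hne _ _ (by linarith [hu.1]) (by rw [abs_lt]; constructor <;> linarith [hu.1, hu.2]) h
  have hcα₁ := hγ.isCompact_arc 0 s₂
  have hcα₂ := hγ.isCompact_arc s₂ (0 + 1)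
  have hJα₁ := hγ.image_subset (Icc 0 s₂)
  have hJα₂ := hγ.image_subset (Icc s₂ (0 + 1))
  have h1α : γ s₁ ∈ γ '' Icc 0 s₂ := ⟨s₁, ⟨h₁.le, h₁₂.le⟩, rfl⟩
  have h3α : γ s₃ ∈ γ '' Icc s₂ (0 + 1) := ⟨s₃, ⟨h₂₃.le, by linarith⟩, rfl⟩
  set α₁ := γ '' Icc 0 s₂
  set α₂ := γ '' Icc s₂ (0 + 1)
  by_cases ho : ∃ o, o ∉ closure F
  swap
  -- If `F` is dense, `S` lies on the curve and can pass from one arc to the other only through `γ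
  -- 0` or `γ s₂`, both in `K`.
  · push Not at ho
    have hSα : S ⊆ α₁ ∪ α₂ := fun p hp => by
      rw [e1, hF.frontier_eq]
      exact ⟨ho p, disjoint_left.1 hSF hp⟩
    obtain ⟨p, hp, hp'⟩ := isPreconnected_closed_iff.1 hS _ _ hcα₁.isClosed hcα₂.isClosed hSα
      ⟨_, h1S, h1α⟩ ⟨_, h3S, h3α⟩
    rw [e2] at hp'
    rcases hp' with rfl | rfl
    · exact hKS _ h0K hp
    · exact hKS _ h2K hp
  obtain ⟨o, ho⟩ := ho
  obtain ⟨L, β₁, β₂, hLc, hL, hβ₁c, hβ₂c, h0, h2, hβ₁, hβ₂, hLF⟩ := exists_crosscut hF hFc hγ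
    (s := 0) (t := s₂) hSJ.isOpen_compl (fun h => hKS _ h0K h.1) hSJ.isOpen_compl
    (fun h => hKS _ h2K h.1)
  have hLW : ∀ p ∈ L, p ∉ F → p ∈ (S ∩ frontier F)ᶜ ∩ frontier F := by
    intro p hp hpF
    have : p ∈ β₁ ∪ β₂ := hLF ▸ ⟨hp, hpF⟩
    exact this.elim (fun h => hβ₁ h) (fun h => hβ₂ h)
  have hLS : ∀ p ∈ L, p ∉ S := fun p hp hpS => by
    have := hLW p hp (disjoint_left.1 hSF hpS)
    exact this.1 ⟨hpS, this.2⟩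
  have hLcl : L ⊆ closure F := fun p hp => by
    by_cases hpF : p ∈ F
    · exact subset_closure hpF
    · exact frontier_subset_closure (hLW p hp hpF).2
  have h0L : γ 0 ∈ L := (hLF.ge (Or.inl h0)).1
  have h2L : γ s₂ ∈ L := (hLF.ge (Or.inr h2)).1
  have hnear : ∀ {s : ℝ} {Z : Set ℂ}, IsCompact Z → γ s ∉ Z → ∃ q ∈ F, q ∉ Z ∧
      ∀ Z' ⊆ Z, JoinedOff Z' (γ s) q := by
    intro s Z hZ hs
    obtain ⟨r, hr, hd⟩ := Metric.isOpen_iff.1 hZ.isClosed.isOpen_compl _ hs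
    obtain ⟨q, hq, hqF⟩ := mem_closure_iff.1 (frontier_subset_closure (hγ.mem s)) _ isOpen_ball
      (mem_ball_self hr)
    exact ⟨q, hqF, hd hq, fun Z' hZ' => joinedOff_of_ball
      ((subset_compl_iff_disjoint_right.1 hd).mono_right hZ') (mem_ball_self hr) hq⟩
  obtain ⟨c, hcF, hcZ, hc⟩ := hnear (s := s₁) ((hKc.union hLc).union hcα₂) (by
    rintro ((h | h) | h)
    exacts [hKS _ h h1S, hLS _ h h1S, hn₂ h])
  obtain ⟨d, hdF, hdZ, hd⟩ := hnear (s := s₃) ((hKc.union hLc).union hcα₁) (by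
    rintro ((h | h) | h)
    exacts [hKS _ h h3S, hLS _ h h3S, hn₁ h])
  have hFJ : ∀ p ∈ F, p ∉ frontier F := fun p hp h => by
    rw [hF.frontier_eq] at h
    exact h.2 hp
  have hLα : ∀ {α : Set ℂ}, L ∪ α ⊆ K ∪ L ∪ α := fun {α} => by
    rw [union_assoc]; exact subset_union_right
  have hlog₁ : HasLog (K ∪ L) c d := by
    refine JoinedOff.hasLog (hKc.union hLc).isClosed ?_
    refine ((hc _ subset_union_left).symm.trans ?_).trans (hd _ subset_union_left)
    exact ⟨S, hS, h1S, h3S, disjoint_left.2 fun p hp h => h.elim (hKS p · hp) (hLS p · hp)⟩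
  have hlog₂ : HasLog Fᶜ c d := JoinedOff.hasLog hF.isClosed_compl
    ⟨F, hFc.isPreconnected, hcF, hdF, disjoint_compl_right⟩
  -- `S` joins `c` and `d` off `K ∪ L`, and `F` joins them off `Fᶜ`; the overlap is `K` with the two
  -- subarcs attached, hence connected. The gluing is done with logarithms because `Fᶜ` need not be
  -- compact.
  have hlog : HasLog (frontier F ∪ L) c d := by
    refine (hlog₁.union hlog₂ (hKc.union hLc).isClosed hF.isClosed_compl ?_ ?_).mono ?_
    · rw [union_inter_distrib_right, hLF, inter_eq_left.2 (subset_compl_iff_disjoint_right.2 hKF),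
        ← union_assoc]
      exact (hK.union _ h0K h0 hβ₁c).union _ (Or.inl h2K) h2 hβ₂c
    · rintro (h | h)
      · exact hcZ (Or.inl h)
      · exact h hcF
    · rintro p (h | h)
      · exact Or.inr fun hp => hFJ p hp h
      · exact Or.inl (Or.inr h)
  have hcd : JoinedOff (frontier F ∪ L) c d := by
    refine hlog.joinedOff (hγ.isCompact.union hLc) ?_ ?_
    · rintro (h | h)
      exacts [hFJ c hcF h, hcZ (Or.inl (Or.inr h))]
    · rintro (h | h)
      exacts [hFJ d hdF h, hdZ (Or.inl (Or.inr h))]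
  have hod : JoinedOff (L ∪ α₁) o d :=
    (joinedOff_boundary_of_notMem_closure hF hFc hγ ho (hLc.union hcα₁).isClosed
      (union_subset hLcl (hJα₁.trans frontier_subset_closure))
      (fun h => h.elim (hLS _ · h3S) hn₁)).trans (hd _ hLα)
  have hoc : JoinedOff (L ∪ α₂) o c :=
    (joinedOff_boundary_of_notMem_closure hF hFc hγ ho (hLc.union hcα₂).isClosed
      (union_subset hLcl (hJα₂.trans frontier_subset_closure))
      (fun h => h.elim (hLS _ · h1S) hn₂)).trans (hc _ hLα)
  have hoc' : JoinedOff (L ∪ α₁) o c := hod.trans (hcd.symm.mono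
    (union_subset subset_union_right (hJα₁.trans subset_union_left)))
  -- Since `c` and `d` are joined off the curve and the crosscut, Janiszewski's theorem now joins
  -- the exterior point `o` to `c ∈ F` off the whole curve, which is absurd.
  obtain ⟨T, hT, hoT, hcT, hTd⟩ := hoc'.union hoc (hLc.union hcα₁) (hLc.union hcα₂) (by
    rw [← union_inter_distrib_left, e2, union_eq_self_of_subset_right]
    · exact hL
    · rintro _ (rfl | rfl)
      · exact h0L
      · exact h2L)
  refine ho (subset_closure (hT.subset_of_disjoint_frontier (hTd.mono_right ?_) ⟨c, hcT, hcF⟩ hoT))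
  rw [← e1]
  exact union_subset (fun p h => Or.inl (Or.inr h)) (fun p h => Or.inr (Or.inr h))

end JordanRegion

/-! ### Edges and faces of a plane graph. -/

namespace PlaneGraph

open Set Metric

variable {V E : Type*} (G : PlaneGraph V E)

/-- The interior of an edge. -/
def inner (e : E) : Set ℂ := G.arc e '' Ioo 0 1

variable {G} {e e' : E} {f g : Set ℂ} {v : V} {p : ℂ}

theorem range_arc (e : E) :
    range (G.arc e) = {G.point (G.src e), G.point (G.tgt e)} ∪ G.inner e := by
  apply Subset.antisymm
  · rintro _ ⟨t, rfl⟩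
    rcases eq_or_ne t 0 with rfl | h0
    · exact Or.inl (Or.inl (G.arc e).source)
    rcases eq_or_ne t 1 with rfl | h1
    · exact Or.inl (Or.inr (G.arc e).target)
    · exact Or.inr ⟨t, ⟨unitInterval.pos_iff_ne_zero.2 h0, unitInterval.lt_one_iff_ne_one.2 h1⟩, rfl⟩
  · rintro _ ((rfl | rfl) | ⟨t, -, rfl⟩)
    · exact ⟨0, (G.arc e).source⟩
    · exact ⟨1, (G.arc e).target⟩
    · exact mem_range_self t

theorem inner_subset_range (e : E) : G.inner e ⊆ range (G.arc e) := image_subset_range _ _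

theorem src_mem_range (e : E) : G.point (G.src e) ∈ range (G.arc e) := ⟨0, (G.arc e).source⟩

theorem tgt_mem_range (e : E) : G.point (G.tgt e) ∈ range (G.arc e) := ⟨1, (G.arc e).target⟩

theorem point_notMem_inner (v : V) (e : E) : G.point v ∉ G.inner e := by
  rintro ⟨t, ht, h⟩
  exact G.arc_ne_point e t ht v h

theorem eq_of_mem_inner (h : p ∈ G.inner e) (h' : p ∈ G.inner e') : e = e' := by
  obtain ⟨t, ht, rfl⟩ := h
  obtain ⟨t', ht', h⟩ := h'
  by_contra hne
  exact G.arc_ne_arc e e' hne t ht t' ht' h.symm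

theorem eq_of_mem_inner_of_mem_range (h : p ∈ G.inner e) (h' : p ∈ range (G.arc e')) :
    e = e' := by
  rw [range_arc] at h'
  rcases h' with (rfl | rfl) | h'
  · exact absurd h (point_notMem_inner _ _)
  · exact absurd h (point_notMem_inner _ _)
  · exact eq_of_mem_inner h h'

theorem eq_of_point_mem_range (h : G.point v ∈ range (G.arc e)) : v = G.src e ∨ v = G.tgt e := by
  rw [range_arc] at h
  rcases h with (h | h) | h
  · exact Or.inl (G.point_injective h)
  · exact Or.inr (G.point_injective h)
  · exact absurd h (point_notMem_inner _ _)

theorem isPreconnected_inner (e : E) : IsPreconnected (G.inner e) :=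
  isPreconnected_Ioo.image _ (G.arc e).continuous.continuousOn

theorem range_subset_closure_inner (e : E) : range (G.arc e) ⊆ closure (G.inner e) := by
  rw [← image_univ]
  have : (univ : Set unitInterval) = closure (Ioo 0 1) := by
    rw [closure_Ioo zero_ne_one]
    ext t
    exact ⟨fun _ => ⟨t.2.1, t.2.2⟩, fun _ => trivial⟩
  rw [this]
  exact image_closure_subset_closure_image (G.arc e).continuous

theorem point_mem_support (v : V) : G.point v ∈ G.support := Or.inl (mem_range_self v)

theorem range_subset_support (e : E) : range (G.arc e) ⊆ G.support := fun _ hp =>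
  Or.inr (mem_iUnion.2 ⟨e, hp⟩)

theorem mem_support_iff : p ∈ G.support ↔ (∃ v, p = G.point v) ∨ ∃ e, p ∈ G.inner e := by
  constructor
  · rintro (⟨v, rfl⟩ | h)
    · exact Or.inl ⟨v, rfl⟩
    · obtain ⟨e, he⟩ := mem_iUnion.1 h
      rw [range_arc] at he
      rcases he with (rfl | rfl) | h
      · exact Or.inl ⟨_, rfl⟩
      · exact Or.inl ⟨_, rfl⟩
      · exact Or.inr ⟨e, h⟩
  · rintro (⟨v, rfl⟩ | ⟨e, he⟩)
    · exact point_mem_support v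
    · exact range_subset_support e (inner_subset_range e he)

section Compactness

theorem isCompact_range_arc (e : E) : IsCompact (range (G.arc e)) :=
  isCompact_range (G.arc e).continuous

variable [Finite V] [Finite E]

theorem isCompact_support : IsCompact G.support :=
  (finite_range _).isCompact.union (isCompact_iUnion isCompact_range_arc)

theorem IsFace.isOpen (hf : G.IsFace f) : IsOpen f := by
  obtain ⟨z, -, rfl⟩ := hf
  exact isCompact_support.isClosed.isOpen_compl.connectedComponentIn

theorem IsFace.frontier_subset (hf : G.IsFace f) : frontier f ⊆ G.support := by
  obtain ⟨z, -, rfl⟩ := hf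
  exact frontier_connectedComponentIn_compl_subset isCompact_support.isClosed

omit [Finite V] [Finite E]

theorem IsFace.isConnected (hf : G.IsFace f) : IsConnected f := by
  obtain ⟨z, hz, rfl⟩ := hf
  exact isConnected_connectedComponentIn_iff.2 hz

theorem IsFace.disjoint_support (hf : G.IsFace f) : Disjoint f G.support := by
  obtain ⟨z, -, rfl⟩ := hf
  exact subset_compl_iff_disjoint_right.1 (connectedComponentIn_subset _ _)

theorem IsFace.eq_of_mem (hf : G.IsFace f) (hg : G.IsFace g) (h : p ∈ f) (h' : p ∈ g) :
    f = g := by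
  obtain ⟨z, -, rfl⟩ := hf
  obtain ⟨z', -, rfl⟩ := hg
  rw [connectedComponentIn_eq h, connectedComponentIn_eq h']

theorem exists_isFace (h : p ∉ G.support) : ∃ f, G.IsFace f ∧ p ∈ f :=
  ⟨_, ⟨p, h, rfl⟩, mem_connectedComponentIn (F := G.supportᶜ) h⟩

theorem IsFace.mem_frontier (hf : G.IsFace f) (hp : p ∈ G.support) (h : p ∈ closure f) :
    p ∈ frontier f :=
  ⟨h, fun h' => disjoint_left.1 hf.disjoint_support (interior_subset h') hp⟩

variable [Finite V] [Finite E]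

theorem exists_ball_inter_support_subset (hp : p ∈ G.inner e) :
    ∃ r > 0, ball p r ∩ G.support ⊆ G.inner e := by
  have hc : IsClosed (range G.point ∪ ⋃ e' : {e' // e' ≠ e}, range (G.arc e')) :=
    ((finite_range _).isCompact.union (isCompact_iUnion fun _ => isCompact_range_arc _)).isClosed
  have hn : p ∉ range G.point ∪ ⋃ e' : {e' // e' ≠ e}, range (G.arc e') := by
    rintro (⟨v, rfl⟩ | h)
    · exact point_notMem_inner _ _ hp
    · obtain ⟨e', h⟩ := mem_iUnion.1 h
      exact e'.2 (eq_of_mem_inner_of_mem_range hp h).symm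
  obtain ⟨r, hr, h⟩ := Metric.isOpen_iff.1 hc.isOpen_compl p hn
  refine ⟨r, hr, fun q ⟨hq, hqs⟩ => ?_⟩
  rcases mem_support_iff.1 hqs with ⟨v, rfl⟩ | ⟨e', he'⟩
  · exact absurd (Or.inl (mem_range_self v)) (h hq)
  · by_contra hne
    have : e' ≠ e := fun h => hne (h ▸ he')
    exact h hq (Or.inr (mem_iUnion.2 ⟨⟨e', this⟩, inner_subset_range e' he'⟩))

/-- A face that is adherent to an interior point of an edge has the whole edge on its boundary. -/
theorem IsFace.range_subset_frontier (hf : G.IsFace f) (h : (G.inner e ∩ closure f).Nonempty) :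
    range (G.arc e) ⊆ frontier f := by
  suffices hs : G.inner e ⊆ closure f from fun p hp =>
    hf.mem_frontier (range_subset_support e hp)
      (closure_minimal hs isClosed_closure (range_subset_closure_inner e hp))
  obtain ⟨p, hpe, hpf⟩ := h
  intro q hqe
  by_contra hqf
  obtain ⟨t, ht, rfl⟩ := id hqe
  let γ : ℝ → ℂ := fun u => G.arc e (projIcc 0 1 zero_le_one u)
  have hγ : Continuous γ := (G.arc e).continuous.comp continuous_projIcc
  have hγI : ∀ u (hu : u ∈ Icc (0 : ℝ) 1), γ u = G.arc e ⟨u, hu⟩ := fun u hu => by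
    simp only [γ, projIcc_of_mem _ hu]
  have hγt : γ t = G.arc e t := by rw [hγI t t.2]
  have hγ0 : γ 0 = G.point (G.src e) := by
    rw [hγI 0 ⟨le_rfl, zero_le_one⟩]; exact (G.arc e).source
  have hγ1 : γ 1 = G.point (G.tgt e) := by
    rw [hγI 1 ⟨zero_le_one, le_rfl⟩]; exact (G.arc e).target
  have hγin : ∀ u ∈ Ioo (0 : ℝ) 1, γ u ∈ G.inner e := fun u hu => by
    rw [hγI u (Ioo_subset_Icc_self hu)]
    exact mem_image_of_mem _ ⟨hu.1, hu.2⟩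
  have hγinj : ∀ u ∈ Ioo (0 : ℝ) 1, ∀ u' ∈ Ioo (0 : ℝ) 1, γ u = γ u' → u = u' := by
    intro u hu u' hu' h
    rw [hγI u (Ioo_subset_Icc_self hu), hγI u' (Ioo_subset_Icc_self hu')] at h
    have := G.arc_injOn e (show (⟨u, _⟩ : unitInterval) ∈ Ioo 0 1 from ⟨hu.1, hu.2⟩)
      (show (⟨u', _⟩ : unitInterval) ∈ Ioo 0 1 from ⟨hu'.1, hu'.2⟩) h
    exact congrArg Subtype.val this
  have hpt : ∀ u ∈ Ioo (0 : ℝ) 1, ∀ v, γ u ≠ G.point v := fun u hu v h =>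
    point_notMem_inner v e (h ▸ hγin u hu)
  have ht0 : (0 : ℝ) < t := ht.1
  have ht1 : (t : ℝ) < 1 := ht.2
  obtain ⟨η, hη, hball⟩ := Metric.isOpen_iff.1
    (isClosed_closure.isOpen_compl.preimage hγ : IsOpen (γ ⁻¹' (closure f)ᶜ)) t
    (show γ t ∈ (closure f)ᶜ by rw [hγt]; exact hqf)
  obtain ⟨ε, hε, hε1, hε2, hε3⟩ : ∃ ε > 0, ε < η ∧ ε < t ∧ t + ε < 1 := by
    refine ⟨min (η / 2) (min (t / 2) ((1 - t) / 2)), ?_, ?_, ?_, ?_⟩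
    · have : (0 : ℝ) < 1 - t := by linarith
      positivity
    · linarith [min_le_left (η / 2) (min ((t : ℝ) / 2) ((1 - t) / 2))]
    · linarith [(min_le_right (η / 2) (min ((t : ℝ) / 2) ((1 - t) / 2))).trans (min_le_left _ _)]
    · linarith [(min_le_right (η / 2) (min ((t : ℝ) / 2) ((1 - t) / 2))).trans (min_le_right _ _)]
  -- With a short subarc around the interior point `G.arc e t` removed, the graph still contains
  -- `frontier f`. It is the union of the rest `G₀` and two arcs `E₁`, `E₂`. None of the three
  -- separates that point from `x ∈ f` near `p`: `e` itself leads from `p` to it off `G₀`, and arcs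
  -- do not separate. Two applications of Janiszewski's theorem put the point in `f`.
  set G₀ : Set ℂ := range G.point ∪ ⋃ e' : {e' // e' ≠ e}, range (G.arc e')
  set E₁ := γ '' Icc 0 (t - ε)
  set E₂ := γ '' Icc (t + ε) 1
  have hG₀ : IsCompact G₀ :=
    (finite_range _).isCompact.union (isCompact_iUnion fun _ => isCompact_range_arc _)
  have hE₁ : IsCompact E₁ := isCompact_Icc.image hγ
  have hE₂ : IsCompact E₂ := isCompact_Icc.image hγ
  have hG₀e : ∀ u ∈ G.inner e, u ∉ G₀ := by
    rintro u hu (⟨v, rfl⟩ | h)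
    · exact point_notMem_inner _ _ hu
    · obtain ⟨e', h⟩ := mem_iUnion.1 h
      exact e'.2 (eq_of_mem_inner_of_mem_range hu h).symm
  have hinj : ∀ u ∈ Icc (0 : ℝ) 1, ∀ u' ∈ Ioo (0 : ℝ) 1, γ u = γ u' → u = u' := by
    intro u hu u' hu' h
    rcases hu.1.eq_or_lt with rfl | h0
    · exact absurd (hγ0 ▸ h).symm (hpt u' hu' _)
    rcases hu.2.eq_or_lt with rfl | h1
    · exact absurd (hγ1 ▸ h).symm (hpt u' hu' _)
    exact hγinj u ⟨h0, h1⟩ u' hu' h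
  have hI₁ : InjOn γ (Icc 0 (t - ε)) := by
    intro u hu u' hu' h
    rcases hu'.1.eq_or_lt with rfl | h0
    · rcases hu.1.eq_or_lt with rfl | h0
      · rfl
      · exact (hinj 0 ⟨le_rfl, zero_le_one⟩ u ⟨h0, by linarith [hu.2]⟩ h.symm).symm
    · exact hinj u ⟨hu.1, by linarith [hu.2]⟩ u' ⟨h0, by linarith [hu'.2]⟩ h
  have hI₂ : InjOn γ (Icc (t + ε) 1) := by
    intro u hu u' hu' h
    rcases hu'.2.eq_or_lt with rfl | h0
    · rcases hu.2.eq_or_lt with rfl | h0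
      · rfl
      · exact (hinj 1 ⟨zero_le_one, le_rfl⟩ u ⟨by linarith [hu.1], h0⟩ h.symm).symm
    · exact hinj u ⟨by linarith [hu.1], hu.2⟩ u' ⟨by linarith [hu'.1], h0⟩ h
  have hrange : ∀ S : Set ℝ, γ '' S ⊆ G.support := by
    rintro S _ ⟨u, -, rfl⟩
    exact range_subset_support e (mem_range_self _)
  have hZs : G₀ ∪ E₁ ∪ E₂ ⊆ G.support := by
    refine union_subset (union_subset (union_subset (fun _ h => Or.inl h) ?_) (hrange _)) (hrange _)
    exact iUnion_subset fun e' => range_subset_support _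
  have hfZ : frontier f ⊆ G₀ ∪ E₁ ∪ E₂ := by
    intro u hu
    rcases mem_support_iff.1 (hf.frontier_subset hu) with ⟨v, rfl⟩ | ⟨e', he'⟩
    · exact Or.inl (Or.inl (Or.inl (mem_range_self v)))
    · rcases eq_or_ne e' e with rfl | hne
      · obtain ⟨s, hs, rfl⟩ := he'
        have hs' : γ s = G.arc e' s := by rw [hγI s s.2]
        rcases le_or_gt (s : ℝ) (t - ε) with h1 | h1
        · exact Or.inl (Or.inr ⟨s, ⟨s.2.1, h1⟩, hs'⟩)
        rcases le_or_gt (t + ε) (s : ℝ) with h2 | h2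
        · exact Or.inr ⟨s, ⟨h2, s.2.2⟩, hs'⟩
        · refine absurd (frontier_subset_closure hu) ?_
          rw [← hs']
          refine hball (mem_ball.2 ?_)
          rw [Real.dist_eq, abs_lt]
          constructor <;> linarith
      · exact Or.inl (Or.inl (Or.inr (mem_iUnion.2 ⟨⟨e', hne⟩, inner_subset_range e' he'⟩)))
  obtain ⟨r, hr, hd⟩ := Metric.isOpen_iff.1 hG₀.isClosed.isOpen_compl p (hG₀e p hpe)
  obtain ⟨x, hx, hxf⟩ := mem_closure_iff.1 hpf _ isOpen_ball (mem_ball_self hr)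
  have hxs : x ∉ G.support := disjoint_left.1 hf.disjoint_support hxf
  have j₀ : JoinedOff G₀ x (G.arc e t) :=
    (joinedOff_of_ball (subset_compl_iff_disjoint_right.1 hd) hx (mem_ball_self hr)).trans
      ⟨G.inner e, isPreconnected_inner e, hpe, hqe, disjoint_left.2 hG₀e⟩
  have j₁ : JoinedOff E₁ x (G.arc e t) := by
    refine joinedOff_arc (by linarith) hγ.continuousOn hI₁ (fun h => hxs (hrange _ h)) ?_
    rintro ⟨u, hu, h⟩
    have := hinj u ⟨hu.1, by linarith [hu.2]⟩ t ⟨ht0, ht1⟩ (h.trans hγt.symm)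
    linarith [hu.2]
  have j₂ : JoinedOff E₂ x (G.arc e t) := by
    refine joinedOff_arc (by linarith) hγ.continuousOn hI₂ (fun h => hxs (hrange _ h)) ?_
    rintro ⟨u, hu, h⟩
    have := hinj u ⟨by linarith [hu.1], hu.2⟩ t ⟨ht0, ht1⟩ (h.trans hγt.symm)
    linarith [hu.1]
  have j₀₁ := j₀.union j₁ hG₀ hE₁ (by
    refine (subsingleton_singleton (a := G.point (G.src e))).anti ?_ |>.isPreconnected
    rintro _ ⟨h, u, hu, rfl⟩
    rcases hu.1.eq_or_lt with rfl | h0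
    · exact hγ0
    · exact absurd h (hG₀e _ (hγin u ⟨h0, by linarith [hu.2]⟩)))
  obtain ⟨S, hS, hxS, hqS, hSd⟩ := j₀₁.union j₂ (hG₀.union hE₁) hE₂ (by
    refine (subsingleton_singleton (a := G.point (G.tgt e))).anti ?_ |>.isPreconnected
    rintro _ ⟨h, u, hu, rfl⟩
    rcases hu.2.eq_or_lt with rfl | h0
    · exact hγ1
    · have hu' : u ∈ Ioo (0 : ℝ) 1 := ⟨by linarith [hu.1], h0⟩
      rcases h with h | ⟨u', hu₁, h⟩
      · exact absurd h (hG₀e _ (hγin u hu'))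
      · have := hinj u' ⟨hu₁.1, by linarith [hu₁.2]⟩ u hu' h
        linarith [hu₁.2, hu.1])
  exact disjoint_left.1 hf.disjoint_support
    (hS.subset_of_disjoint_frontier (hSd.mono_right hfZ) ⟨x, hxS, hxf⟩ hqS)
    (range_subset_support e (inner_subset_range e hqe))

/-- A face that comes close to an interior point of an edge has that edge on its boundary. -/
theorem IsFace.range_subset_frontier_of_ball (hf : G.IsFace f) {q y : ℂ} {r : ℝ}
    (hr : ball q r ∩ G.support ⊆ G.inner e) (hp : p ∈ ball q r) (hpe : p ∈ G.inner e)
    (hy : y ∈ ball q r) (hyf : y ∈ f) : range (G.arc e) ⊆ frontier f := by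
  have hseg := (convex_ball q r).segment_subset hy hp
  obtain ⟨x, hx, hxf⟩ := inter_frontier_nonempty_of_isPreconnected
    (convex_segment y p).isPreconnected ⟨y, left_mem_segment ℝ y p, hyf⟩
    ⟨p, right_mem_segment ℝ y p, fun h => disjoint_left.1 hf.disjoint_support h
      (range_subset_support e (inner_subset_range e hpe))⟩
  exact hf.range_subset_frontier ⟨x, hr ⟨hseg hx, hf.frontier_subset hxf⟩,
    frontier_subset_closure hxf⟩

end Compactness

/-! ### Subgraphs spanned by sets of vertices. -/

section Span

variable (G) in
/-- The union of the vertices in `S` and the edges whose ends lie in `S`. -/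
def span (S : Set V) : Set ℂ :=
  G.point '' S ∪ ⋃ e ∈ {e | G.src e ∈ S ∧ G.tgt e ∈ S}, range (G.arc e)

variable {S T : Set V}

theorem mem_span_iff : p ∈ G.span S ↔ (∃ v ∈ S, p = G.point v) ∨
    ∃ e, G.src e ∈ S ∧ G.tgt e ∈ S ∧ p ∈ G.inner e := by
  constructor
  · rintro (⟨v, hv, rfl⟩ | h)
    · exact Or.inl ⟨v, hv, rfl⟩
    · obtain ⟨e, ⟨h1, h2⟩, h⟩ := mem_iUnion₂.1 h
      rw [range_arc] at h
      rcases h with (rfl | rfl) | h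
      · exact Or.inl ⟨_, h1, rfl⟩
      · exact Or.inl ⟨_, h2, rfl⟩
      · exact Or.inr ⟨e, h1, h2, h⟩
  · rintro (⟨v, hv, rfl⟩ | ⟨e, h1, h2, h⟩)
    · exact Or.inl ⟨v, hv, rfl⟩
    · exact Or.inr (mem_iUnion₂.2 ⟨e, ⟨h1, h2⟩, inner_subset_range e h⟩)

theorem point_mem_span : G.point v ∈ G.span S ↔ v ∈ S := by
  rw [mem_span_iff]
  constructor
  · rintro (⟨w, hw, h⟩ | ⟨e, -, -, h⟩)
    · exact G.point_injective h ▸ hw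
    · exact absurd h (point_notMem_inner _ _)
  · exact fun h => Or.inl ⟨v, h, rfl⟩

theorem inner_subset_span (h₁ : G.src e ∈ S) (h₂ : G.tgt e ∈ S) : G.inner e ⊆ G.span S :=
  fun _ h => mem_span_iff.2 (Or.inr ⟨e, h₁, h₂, h⟩)

theorem range_subset_span (h₁ : G.src e ∈ S) (h₂ : G.tgt e ∈ S) :
    range (G.arc e) ⊆ G.span S := fun _ h => Or.inr (mem_iUnion₂.2 ⟨e, ⟨h₁, h₂⟩, h⟩)

theorem span_subset_support : G.span S ⊆ G.support := by
  intro p hp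
  rcases mem_span_iff.1 hp with ⟨v, -, rfl⟩ | ⟨e, -, -, h⟩
  · exact point_mem_support v
  · exact range_subset_support e (inner_subset_range e h)

theorem disjoint_span (h : Disjoint S T) : Disjoint (G.span S) (G.span T) := by
  refine disjoint_left.2 fun p hp hp' => ?_
  rcases mem_span_iff.1 hp with ⟨v, hv, rfl⟩ | ⟨e, h1, -, he⟩
  · exact disjoint_left.1 h hv (point_mem_span.1 hp')
  · rcases mem_span_iff.1 hp' with ⟨v, -, rfl⟩ | ⟨e', h1', -, he'⟩
    · exact absurd he (point_notMem_inner _ _)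
    · exact disjoint_left.1 h h1 (eq_of_mem_inner he he' ▸ h1')

theorem span_mono (h : S ⊆ T) : G.span S ⊆ G.span T := by
  intro p hp
  rcases mem_span_iff.1 hp with ⟨v, hv, rfl⟩ | ⟨e, h1, h2, he⟩
  · exact point_mem_span.2 (h hv)
  · exact inner_subset_span (h h1) (h h2) he

theorem isCompact_span [Finite V] [Finite E] : IsCompact (G.span S) :=
  ((toFinite S).image _).isCompact.union
    ((toFinite _).isCompact_biUnion fun _ _ => isCompact_range_arc _)

theorem Joins.symm {u w : V} (h : G.Joins e u w) : G.Joins e w u := Or.symm h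

theorem Adj.symm {u w : V} (h : G.Adj u w) : G.Adj w u := h.imp fun _ => Joins.symm

theorem Joins.range_subset_span {u w : V} (h : G.Joins e u w) (hu : u ∈ S) (hw : w ∈ S) :
    range (G.arc e) ⊆ G.span S := by
  rcases h with ⟨rfl, rfl⟩ | ⟨rfl, rfl⟩
  · exact PlaneGraph.range_subset_span hu hw
  · exact PlaneGraph.range_subset_span hw hu

theorem Joins.left_mem {u w : V} (h : G.Joins e u w) : G.point u ∈ range (G.arc e) := by
  rcases h with ⟨rfl, rfl⟩ | ⟨rfl, rfl⟩
  · exact src_mem_range e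
  · exact tgt_mem_range e

/-- A set of vertices that is connected by edges spans a connected set. -/
theorem isPreconnected_span {a : V} (ha : a ∈ S)
    (h : ∀ w ∈ S, Relation.ReflTransGen (fun u w => G.Adj u w ∧ w ∈ S) a w) :
    IsPreconnected (G.span S) := by
  have key : ∀ w, Relation.ReflTransGen (fun u w => G.Adj u w ∧ w ∈ S) a w →
      w ∈ S ∧ ∃ T ⊆ G.span S, IsPreconnected T ∧ G.point a ∈ T ∧ G.point w ∈ T := by
    intro w hw
    induction hw with
    | refl => exact ⟨ha, {G.point a}, by simpa using point_mem_span.2 ha,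
        isPreconnected_singleton, rfl, rfl⟩
    | tail _ hbc ih =>
      obtain ⟨hb, T, hT, hTc, h1, h2⟩ := ih
      obtain ⟨⟨e, he⟩, hc⟩ := hbc
      exact ⟨hc, T ∪ range (G.arc e), union_subset hT (he.range_subset_span hb hc),
        hTc.union _ h2 he.left_mem (isPreconnected_range (G.arc e).continuous), Or.inl h1,
        Or.inr he.symm.left_mem⟩
  refine isPreconnected_of_forall (G.point a) fun p hp => ?_
  rcases mem_span_iff.1 hp with ⟨v, hv, rfl⟩ | ⟨e, h1, h2, he⟩
  · obtain ⟨-, T, hT, hTc, h1, h2⟩ := key v (h v hv)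
    exact ⟨T, hT, h1, h2, hTc⟩
  · obtain ⟨-, T, hT, hTc, h3, h4⟩ := key _ (h _ h1)
    exact ⟨T ∪ range (G.arc e), union_subset hT (range_subset_span h1 h2), Or.inl h3,
      Or.inr (inner_subset_range e he),
      hTc.union _ h4 (src_mem_range e) (isPreconnected_range (G.arc e).continuous)⟩

end Span

end PlaneGraph

section JordanRegion

open Set Metric

theorem JordanParam.neg {γ : ℝ → ℂ} {J : Set ℂ} (hγ : JordanParam γ J) :
    JordanParam (fun t => γ (-t)) J where
  continuous := hγ.continuous.comp continuous_neg
  range_eq := by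
    rw [← hγ.range_eq]
    exact (Equiv.neg ℝ).surjective.range_comp γ
  eq_iff s t := by
    rw [hγ.eq_iff]
    constructor
    · rintro ⟨n, hn⟩
      exact ⟨-n, by push_cast; linarith⟩
    · rintro ⟨n, hn⟩
      exact ⟨-n, by push_cast; linarith⟩

theorem exists_mem_ball_notMem_closure {F : Set ℂ} {γ : ℝ → ℂ} (hF : IsOpen F)
    (hFc : IsConnected F) (hγ : JordanParam γ (frontier F)) {o : ℂ} (ho : o ∉ closure F) (s : ℝ)
    {r : ℝ} (hr : 0 < r) : ∃ q ∈ ball (γ s) r, q ∉ closure F := by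
  obtain ⟨q, hq, S, hS, hoS, hqS, hd⟩ := exists_joinedOff_of_mem_frontier hF hFc hγ ho s hr
  refine ⟨q, hq, fun hqc => ?_⟩
  have hqF : q ∈ F := by
    by_contra h
    exact disjoint_left.1 hd hqS (by rw [hF.frontier_eq]; exact ⟨hqc, h⟩)
  exact ho (subset_closure (hS.subset_of_disjoint_frontier hd ⟨q, hqS, hqF⟩ hoS))

end JordanRegion

/-! ### Walks along the boundary of a face, and edges on a Jordan boundary. -/

namespace PlaneGraph

open Set Metric Relation

variable {V E : Type*} {G : PlaneGraph V E} {e e' : E} {f g F : Set ℂ} {a b v v' z : V} {p : ℂ}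
  {γ : ℝ → ℂ} {t : ℝ}

theorem Joins.mem_boundaryVertices {u w : V} (h : G.Joins e u w)
    (hf : range (G.arc e) ⊆ frontier f) : u ∈ G.boundaryVertices f :=
  hf h.left_mem

theorem Joins.range_eq {u w : V} (h : G.Joins e u w) :
    range (G.arc e) = {G.point u, G.point w} ∪ G.inner e := by
  rcases h with ⟨rfl, rfl⟩ | ⟨rfl, rfl⟩
  · exact range_arc e
  · rw [range_arc e, pair_comm]

theorem joins_of_mem {x : V} (hx : x = G.src e ∨ x = G.tgt e) : ∃ w, G.Joins e x w := by
  rcases hx with rfl | rfl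
  · exact ⟨_, Or.inl ⟨rfl, rfl⟩⟩
  · exact ⟨_, Or.inr ⟨rfl, rfl⟩⟩

variable [Finite V] [Finite E]

/-- Vertices of a face that lie in a connected set outside the face are joined by a path along the
boundary of the face, and this path may avoid any vertex outside the connected set. -/
theorem IsFace.reflTransGen_adj (hf : G.IsFace f) {M : Set ℂ} (hM : IsPreconnected M)
    (hMf : Disjoint M f) (hz : G.point z ∉ M) (hv : v ∈ G.boundaryVertices f)
    (hvM : G.point v ∈ M) (hv' : v' ∈ G.boundaryVertices f) (hvM' : G.point v' ∈ M) :
    ReflTransGen (fun u w => G.Adj u w ∧ w ∈ G.boundaryVertices f ∧ w ≠ z) v v' := by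
  set r := fun u w => G.Adj u w ∧ w ∈ G.boundaryVertices f ∧ w ≠ z
  let R : Set V := {w | ReflTransGen r v w}
  have hR : ∀ w ∈ R, w ∈ G.boundaryVertices f := fun w hw => by
    rcases hw.cases_tail with rfl | ⟨_, -, -, h, -⟩
    exacts [hv, h]
  by_contra hcon
  -- The boundary of `f` splits into the part touching the reached vertices and the rest. An end of
  -- an edge in `A` is reached unless it is `z`, so the two parts share at most the point `z`, and
  -- `frontier_not_split` applies.
  set A : Set E := {e | range (G.arc e) ⊆ frontier f ∧ (G.src e ∈ R ∨ G.tgt e ∈ R)}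
  set B : Set E := {e | range (G.arc e) ⊆ frontier f ∧ ¬ (G.src e ∈ R ∨ G.tgt e ∈ R)}
  have hc : ∀ (S : Set V) (D : Set E), IsCompact (G.point '' S ∪ ⋃ e ∈ D, range (G.arc e)) :=
    fun S D => ((toFinite S).image _).isCompact.union
      ((toFinite D).isCompact_biUnion fun _ _ => isCompact_range_arc _)
  refine frontier_not_split (M := M) (z := G.point z) (v := G.point v) (v' := G.point v') hf.isOpen
    hf.isConnected (hc R A) (hc (G.boundaryVertices f \ R) B) ?_ ?_
    (fun h => disjoint_left.1 hf.disjoint_support h (point_mem_support z)) hM hMf hz hvM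
    (Or.inl ⟨v, ReflTransGen.refl, rfl⟩) hvM' (Or.inl ⟨v', ⟨hv', hcon⟩, rfl⟩)
  · apply Subset.antisymm
    · intro p hp
      rcases mem_support_iff.1 (hf.frontier_subset hp) with ⟨w, rfl⟩ | ⟨e, he⟩
      · by_cases hw : w ∈ R
        · exact Or.inl (Or.inl ⟨w, hw, rfl⟩)
        · exact Or.inr (Or.inl ⟨w, ⟨hp, hw⟩, rfl⟩)
      · have he' := hf.range_subset_frontier ⟨p, he, frontier_subset_closure hp⟩
        by_cases h : G.src e ∈ R ∨ G.tgt e ∈ R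
        · exact Or.inl (Or.inr (mem_iUnion₂.2 ⟨e, ⟨he', h⟩, inner_subset_range e he⟩))
        · exact Or.inr (Or.inr (mem_iUnion₂.2 ⟨e, ⟨he', h⟩, inner_subset_range e he⟩))
    · refine union_subset (union_subset ?_ ?_) (union_subset ?_ ?_)
      · rintro _ ⟨w, hw, rfl⟩
        exact hR w hw
      · exact iUnion₂_subset fun e he => he.1
      · rintro _ ⟨w, hw, rfl⟩
        exact hw.1
      · exact iUnion₂_subset fun e he => he.1
  · have h1 : ∀ w, G.point w ∈ G.point '' R ∪ ⋃ e ∈ A, range (G.arc e) → w ∈ R ∨ w = z := by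
      rintro w (⟨w', hw', h⟩ | h)
      · exact Or.inl (G.point_injective h ▸ hw')
      · obtain ⟨e, ⟨he, he'⟩, h⟩ := mem_iUnion₂.1 h
        by_cases hwz : w = z
        · exact Or.inr hwz
        refine Or.inl ?_
        have hwf : w ∈ G.boundaryVertices f := he h
        rcases eq_of_point_mem_range h with rfl | rfl
        · rcases he' with h' | h'
          · exact h'
          · exact h'.tail ⟨⟨e, Or.inr ⟨rfl, rfl⟩⟩, hwf, hwz⟩
        · rcases he' with h' | h'
          · exact h'.tail ⟨⟨e, Or.inl ⟨rfl, rfl⟩⟩, hwf, hwz⟩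
          · exact h'
    have h2 : ∀ w, G.point w ∈ G.point '' (G.boundaryVertices f \ R) ∪ ⋃ e ∈ B, range (G.arc e) →
        w ∉ R := by
      rintro w (⟨w', hw', h⟩ | h)
      · exact G.point_injective h ▸ hw'.2
      · obtain ⟨e, ⟨he, he'⟩, h⟩ := mem_iUnion₂.1 h
        rcases eq_of_point_mem_range h with rfl | rfl
        · exact fun h => he' (Or.inl h)
        · exact fun h => he' (Or.inr h)
    have hsub : ∀ (S : Set V) (D : Set E) (q : ℂ), q ∈ G.point '' S ∪ ⋃ e ∈ D, range (G.arc e) →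
        (∃ w, q = G.point w) ∨ ∃ e ∈ D, q ∈ G.inner e := by
      rintro S D q (⟨w, -, rfl⟩ | h)
      · exact Or.inl ⟨w, rfl⟩
      · obtain ⟨e, he, h⟩ := mem_iUnion₂.1 h
        rw [range_arc] at h
        rcases h with (rfl | rfl) | h
        exacts [Or.inl ⟨_, rfl⟩, Or.inl ⟨_, rfl⟩, Or.inr ⟨e, he, h⟩]
    rintro q ⟨hq, hq'⟩
    rcases hsub _ _ q hq with ⟨w, rfl⟩ | ⟨e, he, hqe⟩
    · exact congrArg _ ((h1 w hq).resolve_left (h2 w hq'))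
    · rcases hsub _ _ q hq' with ⟨w, rfl⟩ | ⟨e', he', hqe'⟩
      · exact absurd hqe (point_notMem_inner _ _)
      · exact absurd he.2 (eq_of_mem_inner hqe hqe' ▸ he'.2)

omit [Finite V] [Finite E]

/-- An edge contained in a Jordan curve lies on one of the two arcs between two vertices. -/
theorem range_subset_arc (hγ : JordanParam γ (frontier F)) (h0 : γ 0 = G.point a)
    (ht : 0 < t) (ht1 : t < 1) (hb : γ t = G.point b) (he : range (G.arc e) ⊆ frontier F)
    (hne : (G.inner e ∩ γ '' Icc 0 t).Nonempty) : range (G.arc e) ⊆ γ '' Icc 0 t := by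
  have e1 := hγ.union_arcs (s := 0) (t := t) ht.le (by linarith)
  have e2 := hγ.inter_arcs (s := 0) (t := t) ht.le (by linarith)
  refine (range_subset_closure_inner e).trans
    (closure_minimal (fun p hp => ?_) (hγ.isCompact_arc 0 t).isClosed)
  by_contra hpα
  have hsub : G.inner e ⊆ γ '' Icc 0 t ∪ γ '' Icc t (0 + 1) :=
    e1 ▸ (inner_subset_range e).trans he
  obtain ⟨q, hq, hq'⟩ := isPreconnected_closed_iff.1 (isPreconnected_inner e) _ _
    (hγ.isCompact_arc 0 t).isClosed (hγ.isCompact_arc t (0 + 1)).isClosed hsub hne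
    ⟨p, hp, (hsub hp).resolve_left hpα⟩
  rw [e2] at hq'
  rcases hq' with rfl | rfl
  · exact point_notMem_inner a e (h0 ▸ hq)
  · exact point_notMem_inner b e (hb ▸ hq)

/-- A loop at `a` would lie on an arc that starts at `a`. The point `γ (u / 2)` separates `a` from
`γ u` within the arc, whereas a loop stays connected after one point is removed. -/
theorem not_loop_of_inter_arc (hγ : JordanParam γ (frontier F)) (h0 : γ 0 = G.point a)
    (ht : 0 < t) (ht1 : t < 1) (hb : γ t = G.point b) (he : range (G.arc e) ⊆ frontier F)
    (hne : (G.inner e ∩ γ '' Icc 0 t).Nonempty) : ¬ G.Joins e a a := by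
  intro hj
  have hsub := range_subset_arc hγ h0 ht ht1 hb he hne
  obtain ⟨_, hp, u, hu, rfl⟩ := hne
  have hu0 : 0 < u := hu.1.lt_of_ne fun h => point_notMem_inner a e (by rwa [← h0, h])
  have hsplit : Icc (0 : ℝ) t = Icc 0 (u / 2) ∪ Icc (u / 2) t :=
    (Icc_union_Icc_eq_Icc (by linarith) (by linarith [hu.2])).symm
  have key : ∀ T : Set ℂ, IsPreconnected T → T ⊆ range (G.arc e) → G.point a ∈ T → γ u ∈ T →
      γ (u / 2) ∈ T := by
    intro T hT hTe haT huT
    have : T ⊆ γ '' Icc 0 (u / 2) ∪ γ '' Icc (u / 2) t := by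
      rw [← image_union, ← hsplit]; exact hTe.trans hsub
    obtain ⟨_, hq, ⟨x, hx, rfl⟩, y, hy, hxy⟩ := isPreconnected_closed_iff.1 hT _ _
      (hγ.isCompact_arc _ _).isClosed (hγ.isCompact_arc _ _).isClosed this
      ⟨_, haT, 0, ⟨le_rfl, by linarith⟩, h0⟩ ⟨_, huT, u, ⟨by linarith, hu.2⟩, rfl⟩
    have := hγ.eq_of_abs_lt hxy (by rw [abs_lt]; constructor <;> linarith [hx.1, hx.2, hy.1, hy.2])
    have : x = u / 2 := by linarith [hx.2, hy.1]
    exact this ▸ hq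
  have hur := inner_subset_range e hp
  have har : G.point a ∈ range (G.arc e) := hj.left_mem
  have h2 := key _ (isPreconnected_range (G.arc e).continuous) Subset.rfl har hur
  have h2a : γ (u / 2) ≠ G.point a := by
    rw [← h0]
    intro h
    have := hγ.eq_of_abs_lt h (by rw [abs_lt]; constructor <;> linarith [hu.2])
    linarith
  rw [hj.range_eq] at h2
  obtain ⟨τ, hτ, hτe⟩ := h2.resolve_left (by simpa using h2a)
  have hsa : G.arc e 0 = G.point a := by
    rw [(G.arc e).source]; rcases hj with h | h <;> rw [h.1]
  have hta : G.arc e 1 = G.point a := by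
    rw [(G.arc e).target]; rcases hj with h | h <;> rw [h.2]
  have hT : IsPreconnected (G.arc e '' Iio τ ∪ G.arc e '' Ioi τ) :=
    (isPreconnected_Iio.image _ (G.arc e).continuous.continuousOn).union (G.point a)
      ⟨0, hτ.1, hsa⟩ ⟨1, hτ.2, hta⟩ (isPreconnected_Ioi.image _ (G.arc e).continuous.continuousOn)
  have hne' : ∀ σ, σ ≠ τ → G.arc e σ ≠ γ (u / 2) := by
    intro σ hσ h
    by_cases h0 : σ = 0
    · exact h2a (by rw [← h, h0, hsa])
    by_cases h1 : σ = 1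
    · exact h2a (by rw [← h, h1, hta])
    exact hσ (G.arc_injOn e ⟨unitInterval.pos_iff_ne_zero.2 h0, unitInterval.lt_one_iff_ne_one.2 h1⟩
      hτ (h.trans hτe.symm))
  obtain ⟨υ, hυ, hυe⟩ := hp
  have hυτ : υ ≠ τ := by
    rintro rfl
    have := hγ.eq_of_abs_lt (hυe.symm.trans hτe) (by
      rw [abs_lt]; constructor <;> linarith [hu.2])
    linarith
  have := key _ hT (union_subset (image_subset_range _ _) (image_subset_range _ _))
    (Or.inl ⟨0, hτ.1, hsa⟩) (by
      rcases lt_or_gt_of_ne hυτ with h | h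
      exacts [Or.inl ⟨υ, h, hυe⟩, Or.inr ⟨υ, h, hυe⟩])
  rcases this with ⟨σ, hσ, h⟩ | ⟨σ, hσ, h⟩
  · exact hne' σ (ne_of_lt hσ) h
  · exact hne' σ (ne_of_gt hσ) h

theorem neg_param_apply (hγ : JordanParam γ (frontier F)) (t : ℝ) : γ (-(1 - t)) = γ t := by
  rw [← hγ.add_one (-(1 - t))]; congr 1; ring

theorem not_loop (hγ : JordanParam γ (frontier F)) (h0 : γ 0 = G.point a)
    (ht : 0 < t) (ht1 : t < 1) (hb : γ t = G.point b) (he : range (G.arc e) ⊆ frontier F) :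
    ¬ G.Joins e a a := by
  obtain ⟨p, hp⟩ : (G.inner e).Nonempty := ⟨_, mem_image_of_mem _
    (show (⟨1 / 2, by norm_num, by norm_num⟩ : unitInterval) ∈ Ioo 0 1 from
      ⟨Subtype.mk_lt_mk.2 (by norm_num), Subtype.mk_lt_mk.2 (by norm_num)⟩)⟩
  have hpJ := he (inner_subset_range e hp)
  rw [← hγ.union_arcs (s := 0) (t := t) ht.le (by linarith)] at hpJ
  rcases hpJ with h | ⟨u, hu, hup⟩
  · exact not_loop_of_inter_arc hγ h0 ht ht1 hb he ⟨p, hp, h⟩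
  · refine not_loop_of_inter_arc (γ := fun t => γ (-t)) (t := 1 - t) hγ.neg (by simpa using h0)
      (by linarith) (by linarith) (by rw [neg_param_apply hγ, hb]) he
      ⟨p, hp, 1 - u, ⟨by linarith [hu.2], by linarith [hu.1]⟩, ?_⟩
    simp only
    rw [neg_param_apply hγ, hup]

variable [Finite V] [Finite E]

/-- The edge of a Jordan face that leaves a boundary vertex in the positive direction. -/
theorem exists_boundary_edge (hF : G.IsFace F) (hγ : JordanParam γ (frontier F))
    (h0 : γ 0 = G.point a) (ht : 0 < t) (ht1 : t < 1) (hb : γ t = G.point b)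
    (hab : ¬ G.AdjOnBoundary F a b) :
    ∃ e w, ∃ s ∈ Ioo 0 t, ∃ h ∈ Ioo (0 : ℝ) (1 / 2), G.Joins e a w ∧
      range (G.arc e) ⊆ frontier F ∧ γ s = G.point w ∧ γ '' Ioc 0 h ⊆ G.inner e := by
  have hW : IsOpen (G.point '' {a}ᶜ)ᶜ := ((toFinite _).image _).isClosed.isOpen_compl
  obtain ⟨h, hh, hh2, hW'⟩ := hγ.exists_arc_subset hW (s := 0) (by
    rw [h0]
    rintro ⟨w, hw, h⟩
    exact hw (G.point_injective h))
  have hnv : ∀ u ∈ Ioc 0 h, ∀ w, γ u ≠ G.point w := by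
    intro u hu w hw
    by_cases hwa : w = a
    · have := hγ.eq_of_abs_lt (hw.trans (hwa ▸ h0.symm)) (by
        rw [abs_lt]; constructor <;> linarith [hu.1, hu.2])
      linarith [hu.1]
    · exact hW' ⟨u, ⟨by linarith [hu.1], by linarith [hu.2]⟩, rfl⟩ ⟨w, hwa, hw.symm⟩
  have hin : ∀ u ∈ Ioc 0 h, ∃ e, γ u ∈ G.inner e := by
    intro u hu
    rcases mem_support_iff.1 (hF.frontier_subset (hγ.mem u)) with ⟨w, hw⟩ | h
    · exact absurd hw (hnv u hu w)
    · exact h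
  obtain ⟨e, he⟩ := hin h ⟨hh, le_rfl⟩
  have heF : range (G.arc e) ⊆ frontier F :=
    hF.range_subset_frontier ⟨_, he, frontier_subset_closure (hγ.mem h)⟩
  have hsub : γ '' Ioc 0 h ⊆ G.inner e := by
    rintro _ ⟨u, hu, rfl⟩
    obtain ⟨e', he'⟩ := hin u hu
    by_contra hne
    have hee' : e' ≠ e := fun h => hne (h ▸ he')
    have hcl : IsClosed (⋃ e' : {e' // e' ≠ e}, range (G.arc e')) :=
      (isCompact_iUnion fun _ => isCompact_range_arc _).isClosed
    obtain ⟨_, ⟨x, hx, rfl⟩, hq, hq'⟩ := isPreconnected_closed_iff.1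
      ((isPreconnected_Ioc (a := 0) (b := h)).image γ hγ.continuous.continuousOn) _ _
      (isCompact_range_arc e).isClosed hcl (by
        rintro _ ⟨x, hx, rfl⟩
        obtain ⟨e'', he''⟩ := hin x hx
        by_cases h : e'' = e
        · exact Or.inl (h ▸ inner_subset_range _ he'')
        · exact Or.inr (mem_iUnion.2 ⟨⟨e'', h⟩, inner_subset_range _ he''⟩))
      ⟨_, ⟨h, ⟨hh, le_rfl⟩, rfl⟩, inner_subset_range _ he⟩
      ⟨_, ⟨u, hu, rfl⟩, mem_iUnion.2 ⟨⟨e', hee'⟩, inner_subset_range _ he'⟩⟩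
    obtain ⟨e₁, he₁⟩ := hin x hx
    obtain ⟨e₂, he₂⟩ := mem_iUnion.1 hq'
    exact e₂.2 ((eq_of_mem_inner_of_mem_range he₁ he₂).symm.trans
      (eq_of_mem_inner_of_mem_range he₁ hq))
  have hae : G.point a ∈ range (G.arc e) := by
    have : (0 : ℝ) ∈ closure (Ioc 0 h) := by
      rw [closure_Ioc hh.ne]; exact ⟨le_rfl, hh.le⟩
    rw [← h0]
    exact closure_minimal (hsub.trans (inner_subset_range e)) (isCompact_range_arc e).isClosed
      (image_closure_subset_closure_image hγ.continuous (mem_image_of_mem _ this))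
  obtain ⟨w, hw⟩ := joins_of_mem (eq_of_point_mem_range hae)
  have hmin : 0 < min h t := lt_min hh ht
  have hα := range_subset_arc hγ h0 ht ht1 hb heF ⟨γ (min h t),
    hsub ⟨_, ⟨hmin, min_le_left _ _⟩, rfl⟩, _, ⟨hmin.le, min_le_right _ _⟩, rfl⟩
  obtain ⟨s, hs, hsw⟩ := hα hw.symm.left_mem
  -- The other end of the edge is not `a`, as there are no loops, and not `b`, as `a` and `b` are
  -- not adjacent on the boundary.
  refine ⟨e, w, s, ⟨hs.1.lt_of_ne ?_, hs.2.lt_of_ne ?_⟩, h, ⟨hh, hh2⟩, hw, heF, hsw, hsub⟩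
  · rintro rfl
    have : w = a := G.point_injective (hsw.symm.trans h0)
    exact not_loop hγ h0 ht ht1 hb heF (this ▸ hw)
  · rintro rfl
    have : w = b := G.point_injective (hsw.symm.trans hb)
    exact hab ⟨e, this ▸ hw, heF⟩

end PlaneGraph

/-! ### Going around a set of vertices through faces. -/

namespace PlaneGraph

open Set Metric Relation

variable {V E : Type*} {G : PlaneGraph V E} {e e' : E} {f g F : Set ℂ} {a b v v' z : V} {p : ℂ}
  {γ : ℝ → ℂ} {t : ℝ} {S : Set V}

theorem mem_of_inner_inter_span (h : (G.inner e ∩ G.span S).Nonempty) :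
    G.src e ∈ S ∧ G.tgt e ∈ S := by
  obtain ⟨p, hp, hp'⟩ := h
  rcases mem_span_iff.1 hp' with ⟨v, -, rfl⟩ | ⟨e', h1, h2, he'⟩
  · exact absurd hp (point_notMem_inner _ _)
  · exact eq_of_mem_inner hp he' ▸ ⟨h1, h2⟩

theorem Joins.mem_of_mem {u w : V} (h : G.Joins e u w) (hS : G.src e ∈ S ∧ G.tgt e ∈ S) :
    u ∈ S ∧ w ∈ S := by
  rcases h with ⟨rfl, rfl⟩ | ⟨rfl, rfl⟩
  · exact hS
  · exact hS.symm

variable (G) in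
/-- Two faces other than `F` share an edge with exactly one end in `S`. -/
def FaceStep (F : Set ℂ) (S : Set V) (f g : Set ℂ) : Prop :=
  G.IsFace g ∧ g ≠ F ∧ ∃ e u w, G.Joins e u w ∧ u ∈ S ∧ w ∉ S ∧
    range (G.arc e) ⊆ frontier f ∧ range (G.arc e) ⊆ frontier g

variable (G) in
/-- Two vertices outside `S`, the second one adjacent to `S`, lie on a common face other than `F`
that has a vertex of `S`. -/
def VertexStep (F : Set ℂ) (S : Set V) (w w' : V) : Prop :=
  (w' ∉ S ∧ ∃ u ∈ S, G.Adj u w') ∧ ∃ f, G.IsFace f ∧ f ≠ F ∧ w ∈ G.boundaryVertices f ∧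
    w' ∈ G.boundaryVertices f ∧ ∃ u ∈ S, u ∈ G.boundaryVertices f

variable [Finite V] [Finite E]

/-- A connected set that avoids `F`, the edges inside `S` and the edges inside the complement of `S`
passes only through faces that are connected by edges with exactly one end in `S`. -/
theorem reflTransGen_faceStep {T : Set ℂ} (hT : IsPreconnected T) (hTF : Disjoint T (closure F))
    (hTS : Disjoint T (G.span S)) (hTS' : Disjoint T (G.span Sᶜ))
    (hf : G.IsFace f) (hg : G.IsFace g) {x y : ℂ} (hx : x ∈ T) (hxf : x ∈ f) (hy : y ∈ T)
    (hyg : y ∈ g) : ReflTransGen (G.FaceStep F S) f g := by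
  let Q : Set E := {e | (∃ u w, G.Joins e u w ∧ u ∈ S ∧ w ∉ S) ∧
    ¬ range (G.arc e) ⊆ frontier F}
  let R : Set (Set ℂ) := {h | ReflTransGen (G.FaceStep F S) f h}
  have hR : ∀ h ∈ R, G.IsFace h := fun h hh => by
    rcases hh.cases_tail with rfl | ⟨_, -, h, -⟩
    exacts [hf, h]
  let A : Set E := {e | e ∈ Q ∧ ∃ h ∈ R, range (G.arc e) ⊆ frontier h}
  let B : Set E := {e | e ∈ Q ∧ ¬ ∃ h ∈ R, range (G.arc e) ⊆ frontier h}
  -- The reached faces with their mixed edges, and the other faces with theirs, are disjoint open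
  -- sets that cover `T`; openness holds because a face close to an interior point of an edge has
  -- the edge on its boundary.
  let O₁ : Set ℂ := {q | (∃ h ∈ R, q ∈ h) ∨ ∃ e ∈ A, q ∈ G.inner e}
  let O₂ : Set ℂ := {q | (∃ h, G.IsFace h ∧ h ∉ R ∧ q ∈ h) ∨ ∃ e ∈ B, q ∈ G.inner e}
  have hnear : ∀ e, ∀ p ∈ G.inner e, ∃ r > 0, ∀ q ∈ ball p r, q ∈ G.inner e ∨
      ∃ h, G.IsFace h ∧ q ∈ h ∧ range (G.arc e) ⊆ frontier h := by
    intro e p hp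
    obtain ⟨r, hr, hrs⟩ := exists_ball_inter_support_subset hp
    refine ⟨r, hr, fun q hq => ?_⟩
    by_cases hqs : q ∈ G.support
    · exact Or.inl (hrs ⟨hq, hqs⟩)
    · obtain ⟨h, hh, hqh⟩ := exists_isFace hqs
      exact Or.inr ⟨h, hh, hqh,
        hh.range_subset_frontier_of_ball hrs (mem_ball_self hr) hp hq hqh⟩
  have hstep : ∀ e ∈ A, ∀ h, G.IsFace h → range (G.arc e) ⊆ frontier h → h ∈ R := by
    rintro e ⟨⟨⟨u, w, hj, hu, hw⟩, heF⟩, h', hh', heh'⟩ h hh heh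
    exact hh'.tail ⟨hh, fun hFh => heF (hFh ▸ heh), e, u, w, hj, hu, hw, heh', heh⟩
  have hO₁ : IsOpen O₁ := by
    refine Metric.isOpen_iff.2 ?_
    rintro p (⟨h, hh, hp⟩ | ⟨e, he, hp⟩)
    · obtain ⟨r, hr, hrs⟩ := Metric.isOpen_iff.1 (hR h hh).isOpen p hp
      exact ⟨r, hr, fun q hq => Or.inl ⟨h, hh, hrs hq⟩⟩
    · obtain ⟨r, hr, hrs⟩ := hnear e p hp
      refine ⟨r, hr, fun q hq => ?_⟩
      rcases hrs q hq with hq | ⟨h, hh, hqh, heh⟩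
      · exact Or.inr ⟨e, he, hq⟩
      · exact Or.inl ⟨h, hstep e he h hh heh, hqh⟩
  have hO₂ : IsOpen O₂ := by
    refine Metric.isOpen_iff.2 ?_
    rintro p (⟨h, hh, hhR, hp⟩ | ⟨e, he, hp⟩)
    · obtain ⟨r, hr, hrs⟩ := Metric.isOpen_iff.1 hh.isOpen p hp
      exact ⟨r, hr, fun q hq => Or.inl ⟨h, hh, hhR, hrs hq⟩⟩
    · obtain ⟨r, hr, hrs⟩ := hnear e p hp
      refine ⟨r, hr, fun q hq => ?_⟩
      rcases hrs q hq with hq | ⟨h, hh, hqh, heh⟩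
      · exact Or.inr ⟨e, he, hq⟩
      · exact Or.inl ⟨h, hh, fun hhR => he.2 ⟨h, hhR, heh⟩, hqh⟩
  have hdis : Disjoint O₁ O₂ := by
    refine disjoint_left.2 ?_
    rintro p (⟨h, hh, hp⟩ | ⟨e, he, hp⟩) (⟨h', hh', hhR', hp'⟩ | ⟨e', he', hp'⟩)
    · exact hhR' ((hR h hh).eq_of_mem hh' hp hp' ▸ hh)
    · exact disjoint_left.1 (hR h hh).disjoint_support hp
        (range_subset_support e' (inner_subset_range e' hp'))
    · exact disjoint_left.1 hh'.disjoint_support hp'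
        (range_subset_support e (inner_subset_range e hp))
    · exact he'.2 (eq_of_mem_inner hp hp' ▸ he.2)
  have hcov : T ⊆ O₁ ∪ O₂ := by
    intro p hp
    by_cases hps : p ∈ G.support
    · rcases mem_support_iff.1 hps with ⟨v, rfl⟩ | ⟨e, he⟩
      · by_cases hv : v ∈ S
        · exact absurd (point_mem_span.2 hv) (disjoint_left.1 hTS hp)
        · exact absurd (point_mem_span.2 hv) (disjoint_left.1 hTS' hp)
      · have heF : ¬ range (G.arc e) ⊆ frontier F := fun h =>
          disjoint_left.1 hTF hp (frontier_subset_closure (h (inner_subset_range e he)))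
        have hmix : ∃ u w, G.Joins e u w ∧ u ∈ S ∧ w ∉ S := by
          by_cases h1 : G.src e ∈ S <;> by_cases h2 : G.tgt e ∈ S
          · exact absurd (inner_subset_span h1 h2 he) (disjoint_left.1 hTS hp)
          · exact ⟨_, _, Or.inl ⟨rfl, rfl⟩, h1, h2⟩
          · exact ⟨_, _, Or.inr ⟨rfl, rfl⟩, h2, h1⟩
          · exact absurd (inner_subset_span (S := Sᶜ) h1 h2 he) (disjoint_left.1 hTS' hp)
        by_cases h : ∃ h ∈ R, range (G.arc e) ⊆ frontier h
        · exact Or.inl (Or.inr ⟨e, ⟨⟨hmix, heF⟩, h⟩, he⟩)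
        · exact Or.inr (Or.inr ⟨e, ⟨⟨hmix, heF⟩, h⟩, he⟩)
    · obtain ⟨h, hh, hph⟩ := exists_isFace hps
      by_cases hhR : h ∈ R
      · exact Or.inl (Or.inl ⟨h, hhR, hph⟩)
      · exact Or.inr (Or.inl ⟨h, hh, hhR, hph⟩)
  have := hT.subset_left_of_subset_union hO₁ hO₂ hdis hcov ⟨x, hx, Or.inl ⟨f, ReflTransGen.refl, hxf⟩⟩ hy
  rcases this with ⟨h, hh, hyh⟩ | ⟨e, -, hye⟩
  · exact (hR h hh).eq_of_mem hg hyh hyg ▸ hh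
  · exact absurd (range_subset_support e (inner_subset_range e hye))
      (disjoint_left.1 hg.disjoint_support hyg)

/-- Going around a set `S` of vertices that meets the boundary of the Jordan face `F` only in `a`,
from one side of `a` to the other, one finds a sequence of vertices adjacent to `S` in which
consecutive vertices lie on a common face. -/
theorem exists_vertexStep_chain (hF : G.IsFace F) (hγ : JordanParam γ (frontier F))
    (h0 : γ 0 = G.point a) (ht : 0 < t) (ht1 : t < 1) (hb : γ t = G.point b)
    (hab : ¬ G.AdjOnBoundary F a b) {o : ℂ} (ho : o ∉ closure F) (ha : a ∈ S)
    (hS : ∀ v ∈ S, v ∈ G.boundaryVertices F → v = a) :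
    ∃ w w', (∃ s ∈ Ioo 0 t, γ s = G.point w) ∧ (∃ s ∈ Ioo t 1, γ s = G.point w') ∧
      (w ∉ S ∧ ∃ u ∈ S, G.Adj u w) ∧ ReflTransGen (G.VertexStep F S) w w' := by
  have hFo := hF.isOpen
  have hFc := hF.isConnected
  obtain ⟨e₁, w₁, s₁, hs₁, h₁, hh₁, hj₁, he₁, hw₁, hsub₁⟩ :=
    exists_boundary_edge hF hγ h0 ht ht1 hb hab
  obtain ⟨e₂, w₂, s₂, hs₂, h₂, hh₂, hj₂, he₂, hw₂, hsub₂⟩ :=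
    exists_boundary_edge (γ := fun t => γ (-t)) (t := 1 - t) hF hγ.neg (by simpa using h0)
      (by linarith) (by linarith) (by rw [neg_param_apply hγ, hb]) hab
  replace hsub₂ : ∀ u ∈ Ico (-h₂) 0, γ u ∈ G.inner e₂ := fun u hu =>
    hsub₂ ⟨-u, ⟨by linarith [hu.2], by linarith [hu.1]⟩, by simp⟩
  replace hsub₁ : ∀ u ∈ Ioc 0 h₁, γ u ∈ G.inner e₁ := fun u hu => hsub₁ ⟨u, hu, rfl⟩
  replace hw₂ : γ (1 - s₂) = G.point w₂ := by rw [← hw₂, ← neg_param_apply hγ]; simp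
  have hwS : ∀ {e w}, G.Joins e a w → range (G.arc e) ⊆ frontier F → w ∉ S := by
    intro e w hj he hw
    exact not_loop hγ h0 ht ht1 hb he (hS w hw (hj.symm.mem_boundaryVertices he) ▸ hj)
  have hw₁S := hwS hj₁ he₁
  have hw₂S := hwS hj₂ he₂
  set K := G.span S
  set Y := G.span Sᶜ
  set α := γ '' Icc h₁ (1 - h₂)
  have hKc : IsCompact K := isCompact_span
  have hYc : IsCompact Y := isCompact_span
  have hαc : IsCompact α := hγ.isCompact_arc _ _
  have hKJ : K ∩ frontier F ⊆ {G.point a} := by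
    rintro p ⟨hp, hpF⟩
    rcases mem_span_iff.1 hp with ⟨v, hv, rfl⟩ | ⟨e, h1, h2, he⟩
    · exact congrArg _ (hS v hv hpF)
    · have heF := hF.range_subset_frontier ⟨p, he, frontier_subset_closure hpF⟩
      have h1' := hS _ h1 (heF (src_mem_range e))
      have h2' := hS _ h2 (heF (tgt_mem_range e))
      exact absurd (Or.inl ⟨h1', h2'⟩) (not_loop hγ h0 ht ht1 hb heF)
  have hKY : Disjoint K Y := disjoint_span disjoint_compl_right
  have hinK : ∀ {e w}, G.Joins e a w → w ∉ S → ∀ p ∈ G.inner e, p ∉ K := fun hj hw p hp hpK =>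
    hw (hj.mem_of_mem (mem_of_inner_inter_span ⟨p, hp, hpK⟩)).2
  have hinY : ∀ {e w}, G.Joins e a w → ∀ p ∈ G.inner e, p ∉ Y := fun hj p hp hpY =>
    (hj.mem_of_mem (mem_of_inner_inter_span ⟨p, hp, hpY⟩)).1 ha
  have hnY : ∀ u ∈ Icc (-h₂) h₁, γ u ∉ Y := by
    intro u hu
    rcases lt_trichotomy u 0 with h | rfl | h
    · exact hinY hj₂ _ (hsub₂ u ⟨hu.1, h⟩)
    · rw [h0]
      exact fun h => point_mem_span.1 h ha
    · exact hinY hj₁ _ (hsub₁ u ⟨h, hu.2⟩)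
  have hnα : ∀ u ∈ Icc (-(h₂ / 2)) (h₁ / 2), γ u ∉ α := by
    rintro u hu ⟨x, hx, hxu⟩
    have := hγ.eq_of_abs_lt hxu (by
      rw [abs_lt]; constructor <;> linarith [hx.1, hx.2, hu.1, hu.2, hh₁.1, hh₂.1])
    linarith [hx.1, hu.2, hh₁.1]
  have hnF : ∀ p ∈ F, p ∉ K := fun p hp h =>
    disjoint_left.1 hF.disjoint_support hp (span_subset_support h)
  have hnear : ∀ {e w s}, G.Joins e a w → w ∉ S → range (G.arc e) ⊆ frontier F →
      γ s ∈ G.inner e → s ∈ Icc (-(h₂ / 2)) (h₁ / 2) → ∃ q f, G.IsFace f ∧ f ≠ F ∧ q ∈ f ∧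
        q ∉ closure F ∧ range (G.arc e) ⊆ frontier f ∧ JoinedOff (Y ∪ α) q (γ s) ∧
        ∃ x ∈ F, JoinedOff K q x := by
    intro e w s hj hw heF hs hsI
    obtain ⟨r, hr, hrs⟩ := exists_ball_inter_support_subset hs
    have hZ : γ s ∉ K ∪ (Y ∪ α) := by
      rintro (h | h | h)
      exacts [hinK hj hw _ hs h, hinY hj _ hs h, hnα s hsI h]
    obtain ⟨r', hr', hd⟩ := Metric.isOpen_iff.1
      (hKc.union (hYc.union hαc)).isClosed.isOpen_compl _ hZ
    have hd' : Disjoint (ball (γ s) (min r r')) (K ∪ (Y ∪ α)) :=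
      subset_compl_iff_disjoint_right.1 ((ball_subset_ball (min_le_right _ _)).trans hd)
    have hrr : 0 < min r r' := lt_min hr hr'
    obtain ⟨q, hq, hqF⟩ := exists_mem_ball_notMem_closure hFo hFc hγ ho s hrr
    obtain ⟨x, hx, hxF⟩ := mem_closure_iff.1 (frontier_subset_closure (hγ.mem s)) _ isOpen_ball
      (mem_ball_self hrr)
    have hqr := ball_subset_ball (min_le_left r r') hq
    have hqs : q ∉ G.support := fun h =>
      hqF (frontier_subset_closure (heF (inner_subset_range e (hrs ⟨hqr, h⟩))))
    obtain ⟨f, hf, hqf⟩ := exists_isFace hqs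
    refine ⟨q, f, hf, ?_, hqf, hqF,
      hf.range_subset_frontier_of_ball hrs (mem_ball_self hr) hs hqr hqf,
      joinedOff_of_ball (hd'.mono_right subset_union_right) hq (mem_ball_self hrr), x, hxF,
      joinedOff_of_ball (hd'.mono_right subset_union_left) hq hx⟩
    rintro rfl
    exact hqF (subset_closure hqf)
  obtain ⟨q₁, f₁, hf₁, hf₁F, hqf₁, hq₁F, hef₁, hj₁c, x₁, hx₁, hjx₁⟩ :=
    hnear (s := h₁ / 2) hj₁ hw₁S he₁ (hsub₁ _ ⟨by linarith [hh₁.1], by linarith [hh₁.1]⟩)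
      ⟨by linarith [hh₁.1, hh₂.1], le_rfl⟩
  obtain ⟨q₂, f₂, hf₂, hf₂F, hqf₂, hq₂F, hef₂, hj₂c, x₂, hx₂, hjx₂⟩ :=
    hnear (s := -(h₂ / 2)) hj₂ hw₂S he₂ (hsub₂ _ ⟨by linarith [hh₂.1], by linarith [hh₂.1]⟩)
      ⟨le_rfl, by linarith [hh₁.1, hh₂.1]⟩
  -- `q₁` and `q₂` lie just outside `F` near the two boundary edges at `a`. They are joined off the
  -- curve through its exterior, off `Y ∪ α` along the curve past `a`, and off `K` through `F`. The
  -- obstacles overlap first in the arc `α`, then at most in `a`, so Janiszewski's theorem joins the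
  -- points off all three.
  have hj1 : JoinedOff (frontier F) q₁ q₂ := joinedOff_of_notMem_closure hFo hFc hγ hq₁F hq₂F
  have hj2 : JoinedOff (Y ∪ α) q₁ q₂ := by
    refine (hj₁c.trans ⟨γ '' Icc (-(h₂ / 2)) (h₁ / 2), hγ.isPreconnected_arc _ _,
      ⟨_, ⟨by linarith [hh₁.1, hh₂.1], le_rfl⟩, rfl⟩, ⟨_, ⟨le_rfl, by linarith [hh₁.1, hh₂.1]⟩, rfl⟩,
      disjoint_left.2 ?_⟩).trans hj₂c.symm
    rintro _ ⟨u, hu, rfl⟩ (h | h)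
    · exact hnY u ⟨by linarith [hu.1, hh₂.1], by linarith [hu.2, hh₁.1]⟩ h
    · exact hnα u hu h
  have hj3 : JoinedOff K q₁ q₂ := by
    refine (hjx₁.trans ⟨F, hFc.isPreconnected, hx₁, hx₂, disjoint_left.2 hnF⟩).trans hjx₂.symm
  have hJY : frontier F ∩ (Y ∪ α) = α := by
    apply Subset.antisymm
    · rintro p ⟨hpJ, h | h⟩
      · obtain ⟨u, hu, rfl⟩ := hγ.exists_mem_Ico hpJ (-h₂)
        refine ⟨u, ⟨?_, by linarith [hu.2]⟩, rfl⟩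
        by_contra hlt
        exact hnY u ⟨hu.1, by linarith [not_le.1 hlt]⟩ h
      · exact h
    · exact fun p hp => ⟨hγ.image_subset _ hp, Or.inr hp⟩
  have hj12 := hj1.union hj2 hγ.isCompact (hYc.union hαc)
    (by rw [hJY]; exact hγ.isPreconnected_arc _ _)
  obtain ⟨T, hT, hq₁T, hq₂T, hTd⟩ := hj12.union hj3 (hγ.isCompact.union (hYc.union hαc)) hKc (by
    refine (subsingleton_singleton (a := G.point a)).anti ?_ |>.isPreconnected
    rintro p ⟨h | h | h, hpK⟩
    · exact hKJ ⟨hpK, h⟩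
    · exact absurd h (disjoint_left.1 hKY hpK)
    · exact hKJ ⟨hpK, hγ.image_subset _ h⟩)
  have hTF : Disjoint T (closure F) := by
    have hTJ : Disjoint T (frontier F) := hTd.mono_right fun p hp => Or.inl (Or.inl hp)
    refine disjoint_left.2 fun p hp hpc => ?_
    have hpF : p ∈ F := by
      by_contra h
      exact disjoint_left.1 hTJ hp (by rw [hFo.frontier_eq]; exact ⟨hpc, h⟩)
    exact hq₁F (subset_closure (hT.subset_of_disjoint_frontier hTJ ⟨p, hp, hpF⟩ hq₁T))
  have hchain := reflTransGen_faceStep hT hTF (hTd.mono_right fun p hp => Or.inr hp)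
    (hTd.mono_right fun p hp => Or.inl (Or.inr (Or.inl hp))) hf₁ hf₂ hq₁T hqf₁ hq₂T hqf₂
  -- Each edge crossed between two faces contributes its end outside `S`; successive ends lie on the
  -- face in between.
  have key : ∀ g, ReflTransGen (G.FaceStep F S) f₁ g → G.IsFace g ∧ g ≠ F ∧
      (∃ u ∈ S, u ∈ G.boundaryVertices g) ∧ ∃ w ∈ G.boundaryVertices g,
        ReflTransGen (G.VertexStep F S) w₁ w := by
    intro g hg
    induction hg with
    | refl => exact ⟨hf₁, hf₁F, ⟨a, ha, hj₁.mem_boundaryVertices hef₁⟩, w₁,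
        hj₁.symm.mem_boundaryVertices hef₁, ReflTransGen.refl⟩
    | tail _ hstep ih =>
      obtain ⟨hg, hgF, hgS, w, hw, hww⟩ := ih
      obtain ⟨hg', hgF', e, u, w', hj, hu, hw', hea, heb⟩ := hstep
      exact ⟨hg', hgF', ⟨u, hu, hj.mem_boundaryVertices heb⟩, w', hj.symm.mem_boundaryVertices heb,
        hww.tail ⟨⟨hw', u, hu, e, hj⟩, _, hg, hgF, hw, hj.symm.mem_boundaryVertices hea, hgS⟩⟩
  obtain ⟨-, -, hfS, w, hw, hww⟩ := key f₂ hchain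
  refine ⟨w₁, w₂, ⟨s₁, hs₁, hw₁⟩, ⟨1 - s₂, ⟨by linarith [hs₂.2], by linarith [hs₂.1]⟩, hw₂⟩,
    ⟨hw₁S, a, ha, e₁, hj₁⟩, hww.tail ⟨⟨hw₂S, a, ha, e₂, hj₂⟩, f₂, hf₂, hf₂F, hw,
      hj₂.symm.mem_boundaryVertices hef₂, hfS⟩⟩

end PlaneGraph

/-! ### The two sides of the boundary, and crossing of paths. -/

namespace PlaneGraph

open Set Metric Relation

variable {V E : Type*} {G : PlaneGraph V E} {e e' : E} {f g F : Set ℂ} {a b c d v v' z : V} {p : ℂ}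
  {γ : ℝ → ℂ} {t : ℝ} {S : Set V}

variable (G) in
/-- The curve `γ` parametrizes the boundary of the face `F`, starts at `a` and passes `b` at time
`t`. -/
structure BoundaryParam (F : Set ℂ) (a b : V) (γ : ℝ → ℂ) (t : ℝ) : Prop where
  isFace : G.IsFace F
  param : JordanParam γ (frontier F)
  zero : γ 0 = G.point a
  pos : 0 < t
  lt_one : t < 1
  apply_eq : γ t = G.point b

variable (G) in
/-- The vertices that `γ` passes at the times in `I`. -/
def side (γ : ℝ → ℂ) (I : Set ℝ) : Set V := {v | ∃ s ∈ I, γ s = G.point v}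

theorem exists_boundaryParam (hF : G.IsJordanFace F) (ha : a ∈ G.boundaryVertices F)
    (hb : b ∈ G.boundaryVertices F) (hne : a ≠ b) : ∃ γ t, G.BoundaryParam F a b γ t := by
  obtain ⟨γ, hγ, h0⟩ := exists_jordanParam hF.2 ha
  obtain ⟨t, ht, htb⟩ := hγ.exists_mem_Ico hb 0
  refine ⟨γ, t, hF.1, hγ, h0, ht.1.lt_of_ne ?_, by linarith [ht.2], htb⟩
  rintro rfl
  exact hne (G.point_injective (h0.symm.trans htb))

namespace BoundaryParam

variable (h : G.BoundaryParam F a b γ t)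

include h

theorem side_subset (I : Set ℝ) : G.side γ I ⊆ G.boundaryVertices F := by
  rintro v ⟨s, -, hs⟩
  exact (hs ▸ h.param.mem s : G.point v ∈ frontier F)

theorem eq_of_apply_eq {s s' : ℝ} (hs : s ∈ Ico (0 : ℝ) 1) (hs' : s' ∈ Ico (0 : ℝ) 1)
    (hss : γ s = γ s') : s = s' :=
  h.param.eq_of_abs_lt hss (by rw [abs_lt]; constructor <;> linarith [hs.1, hs.2, hs'.1, hs'.2])

theorem left_notMem_side {I : Set ℝ} (hI : I ⊆ Ioo 0 1) : a ∉ G.side γ I := by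
  rintro ⟨s, hs, hsa⟩
  have := h.eq_of_apply_eq (Ioo_subset_Ico_self (hI hs)) ⟨le_rfl, zero_lt_one⟩
    (hsa.trans h.zero.symm)
  exact (hI hs).1.ne' this

theorem right_notMem_side {I : Set ℝ} (hI : I ⊆ Ioo 0 1) (htI : t ∉ I) : b ∉ G.side γ I := by
  rintro ⟨s, hs, hsb⟩
  have := h.eq_of_apply_eq (Ioo_subset_Ico_self (hI hs)) ⟨h.pos.le, h.lt_one⟩
    (hsb.trans h.apply_eq.symm)
  exact htI (this ▸ hs)

theorem Ioo_subset_left : Ioo 0 t ⊆ Ioo 0 1 := Ioo_subset_Ioo_right h.lt_one.le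

theorem Ioo_subset_right : Ioo t 1 ⊆ Ioo 0 1 := Ioo_subset_Ioo_left h.pos.le

theorem ne_of_mem_left (hv : v ∈ G.side γ (Ioo 0 t)) : v ≠ a ∧ v ≠ b :=
  ⟨fun hva => h.left_notMem_side h.Ioo_subset_left (hva ▸ hv),
    fun hvb => h.right_notMem_side h.Ioo_subset_left (fun h => h.2.ne rfl) (hvb ▸ hv)⟩

theorem ne_of_mem_right (hv : v ∈ G.side γ (Ioo t 1)) : v ≠ a ∧ v ≠ b :=
  ⟨fun hva => h.left_notMem_side h.Ioo_subset_right (hva ▸ hv),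
    fun hvb => h.right_notMem_side h.Ioo_subset_right (fun h => h.1.ne rfl) (hvb ▸ hv)⟩

theorem disjoint_sides : Disjoint (G.side γ (Ioo 0 t)) (G.side γ (Ioo t 1)) := by
  refine disjoint_left.2 ?_
  rintro v ⟨s, hs, hv⟩ ⟨s', hs', hv'⟩
  have := h.eq_of_apply_eq (Ioo_subset_Ico_self (h.Ioo_subset_left hs))
    (Ioo_subset_Ico_self (h.Ioo_subset_right hs')) (hv.trans hv'.symm)
  linarith [hs.2, hs'.1]

theorem mem_boundaryVertices (hv : v ∈ G.boundaryVertices F) :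
    v = a ∨ v = b ∨ v ∈ G.side γ (Ioo 0 t) ∨ v ∈ G.side γ (Ioo t 1) := by
  obtain ⟨s, hs, hsv⟩ := h.param.exists_mem_Ico hv 0
  rcases hs.1.eq_or_lt with rfl | h0
  · exact Or.inl (G.point_injective (hsv.symm.trans h.zero))
  rcases lt_trichotomy s t with hst | rfl | hst
  · exact Or.inr (Or.inr (Or.inl ⟨s, ⟨h0, hst⟩, hsv⟩))
  · exact Or.inr (Or.inl (G.point_injective (hsv.symm.trans h.apply_eq)))
  · exact Or.inr (Or.inr (Or.inr ⟨s, ⟨hst, by linarith [hs.2]⟩, hsv⟩))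

theorem left_mem : a ∈ G.boundaryVertices F :=
  (h.zero ▸ h.param.mem 0 : G.point a ∈ frontier F)

theorem right_mem : b ∈ G.boundaryVertices F :=
  (h.apply_eq ▸ h.param.mem t : G.point b ∈ frontier F)

theorem apply_notMem {s : ℝ} (hs : s ∈ Ioo (0 : ℝ) 1) (hst : s ≠ t) :
    γ s ∉ ({G.point a, G.point b} : Set ℂ) := by
  rintro (hsa | hsb)
  · exact hs.1.ne' (h.eq_of_apply_eq (Ioo_subset_Ico_self hs) ⟨le_rfl, zero_lt_one⟩
      (hsa.trans h.zero.symm))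
  · exact hst (h.eq_of_apply_eq (Ioo_subset_Ico_self hs) ⟨h.pos.le, h.lt_one⟩
      (Eq.trans hsb h.apply_eq.symm))

/-- The two open arcs are connected, and a connected subset of the curve that meets both closed arcs
contains one of their common ends `a`, `b`. -/
theorem inDifferentComponents_iff : G.InDifferentComponents F a b c d ↔
    (c ∈ G.side γ (Ioo 0 t) ∧ d ∈ G.side γ (Ioo t 1)) ∨
      (c ∈ G.side γ (Ioo t 1) ∧ d ∈ G.side γ (Ioo 0 t)) := by
  have hmem : ∀ {v}, v ∈ G.side γ (Ioo 0 t) ∨ v ∈ G.side γ (Ioo t 1) →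
      G.point v ∈ frontier F \ {G.point a, G.point b} := by
    rintro v (⟨s, hs, hsv⟩ | ⟨s, hs, hsv⟩)
    · exact hsv ▸ ⟨h.param.mem s, h.apply_notMem (h.Ioo_subset_left hs) hs.2.ne⟩
    · exact hsv ▸ ⟨h.param.mem s, h.apply_notMem (h.Ioo_subset_right hs) hs.1.ne'⟩
  have hside : ∀ {v}, G.point v ∈ frontier F \ {G.point a, G.point b} →
      v ∈ G.side γ (Ioo 0 t) ∨ v ∈ G.side γ (Ioo t 1) := by
    rintro v ⟨hv, hv'⟩
    rcases h.mem_boundaryVertices hv with rfl | rfl | hv | hv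
    · exact absurd (Or.inl rfl) hv'
    · exact absurd (Or.inr rfl) hv'
    · exact Or.inl hv
    · exact Or.inr hv
  have hsame : ∀ {I : Set ℝ}, IsPreconnected I → I ⊆ Ioo 0 1 → t ∉ I → c ∈ G.side γ I →
      d ∈ G.side γ I →
      G.point d ∈ connectedComponentIn (frontier F \ {G.point a, G.point b}) (G.point c) := by
    rintro I hI hI1 htI ⟨s, hs, hsc⟩ ⟨s', hs', hsd⟩
    refine (hI.image γ h.param.continuous.continuousOn).subset_connectedComponentIn
      ⟨s, hs, hsc⟩ ?_ ⟨s', hs', hsd⟩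
    rintro _ ⟨x, hx, rfl⟩
    exact ⟨h.param.mem x, h.apply_notMem (hI1 hx) fun hxt => htI (hxt ▸ hx)⟩
  have hα₁ := (h.param.isCompact_arc 0 t).isClosed
  have hα₂ := (h.param.isCompact_arc t (0 + 1)).isClosed
  have e1 := h.param.union_arcs (s := 0) (t := t) h.pos.le (by linarith [h.lt_one])
  have e2 := h.param.inter_arcs (s := 0) (t := t) h.pos.le (by linarith [h.lt_one])
  have hdiff : ∀ T ⊆ frontier F \ {G.point a, G.point b}, IsPreconnected T →
      ∀ x ∈ Ioo 0 t, γ x ∈ T → ∀ y ∈ Ioo t 1, γ y ∈ T → False := by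
    intro T hTs hT x hx hxT y hy hyT
    obtain ⟨q, hq, hq'⟩ := isPreconnected_closed_iff.1 hT _ _ hα₁ hα₂
      (e1 ▸ fun q hq => (hTs hq).1) ⟨_, hxT, x, Ioo_subset_Icc_self hx, rfl⟩
      ⟨_, hyT, y, ⟨hy.1.le, by linarith [hy.2]⟩, rfl⟩
    rw [e2, h.zero, h.apply_eq] at hq'
    exact (hTs hq).2 hq'
  constructor
  · rintro ⟨hc, hd, hcd⟩
    rcases hside hc with hc' | hc' <;> rcases hside hd with hd' | hd'
    · exact absurd (hsame isPreconnected_Ioo h.Ioo_subset_left (fun h => h.2.ne rfl) hc' hd') hcd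
    · exact Or.inl ⟨hc', hd'⟩
    · exact Or.inr ⟨hc', hd'⟩
    · exact absurd (hsame isPreconnected_Ioo h.Ioo_subset_right (fun h => h.1.ne rfl) hc' hd') hcd
  · rintro (⟨hc, hd⟩ | ⟨hc, hd⟩)
    · refine ⟨hmem (Or.inl hc), hmem (Or.inr hd), fun hcd => ?_⟩
      have hcc := mem_connectedComponentIn (hmem (Or.inl hc))
      obtain ⟨x, hx, hxc⟩ := hc
      obtain ⟨y, hy, hyd⟩ := hd
      exact hdiff _ (connectedComponentIn_subset _ _) isPreconnected_connectedComponentIn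
        x hx (by rw [hxc]; exact hcc) y hy (by rw [hyd]; exact hcd)
    · refine ⟨hmem (Or.inr hc), hmem (Or.inl hd), fun hcd => ?_⟩
      have hcc := mem_connectedComponentIn (hmem (Or.inr hc))
      obtain ⟨x, hx, hxc⟩ := hc
      obtain ⟨y, hy, hyd⟩ := hd
      exact hdiff _ (connectedComponentIn_subset _ _) isPreconnected_connectedComponentIn
        y hy (by rw [hyd]; exact hcd) x hx (by rw [hxc]; exact hcc)

end BoundaryParam

theorem reflTransGen_of_isChain {l : List V} : ∀ {u : V} (_ : (u :: l).IsChain G.Adj),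
    (∀ w ∈ l, w ∈ S) → ∀ w ∈ u :: l, ReflTransGen (fun u w => G.Adj u w ∧ w ∈ S) u w := by
  induction l with
  | nil =>
    intro u _ _ w hw
    rw [List.mem_singleton.1 hw]
  | cons x l ih =>
    intro u hc hS w hw
    rw [List.isChain_cons_cons] at hc
    rcases List.mem_cons.1 hw with rfl | hw
    · exact ReflTransGen.refl
    · exact (ih hc.2 (fun w hw => hS w (List.mem_cons_of_mem _ hw)) w hw).head
        ⟨hc.1, hS x List.mem_cons_self⟩

theorem IsProperPath.isPreconnected_span {p : List V} (hp : G.IsProperPath F a b p) :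
    IsPreconnected (G.span {v | v ∈ p}) := by
  obtain ⟨-, -, hc, l, rfl, -⟩ := hp
  exact PlaneGraph.isPreconnected_span (a := a) List.mem_cons_self
    (reflTransGen_of_isChain hc fun w hw => List.mem_cons_of_mem _ hw)

theorem IsProperPath.left_mem {p : List V} (hp : G.IsProperPath F a b p) : a ∈ p := by
  obtain ⟨-, -, -, l, rfl, -⟩ := hp
  simp

theorem IsProperPath.right_mem {p : List V} (hp : G.IsProperPath F a b p) : b ∈ p := by
  obtain ⟨-, -, -, l, rfl, -⟩ := hp
  simp

theorem IsProperPath.left_mem_span {p : List V} (hp : G.IsProperPath F a b p) :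
    G.point a ∈ G.span {v | v ∈ p} := point_mem_span.2 hp.left_mem

theorem IsProperPath.right_mem_span {p : List V} (hp : G.IsProperPath F a b p) :
    G.point b ∈ G.span {v | v ∈ p} := point_mem_span.2 hp.right_mem

theorem IsProperPath.eq_or_eq {p : List V} (hp : G.IsProperPath F a b p) (hv : v ∈ p)
    (hvF : v ∈ G.boundaryVertices F) : v = a ∨ v = b := by
  obtain ⟨-, -, -, l, rfl, hl⟩ := hp
  simp only [List.mem_cons, List.mem_append, List.not_mem_nil, or_false] at hv
  rcases hv with hv | hv | hv
  exacts [Or.inl hv, absurd hvF (hl v hv), Or.inr hv]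

variable [Finite V] [Finite E]

/-- A path that connects `a` and `b` and a path that separates them have a common vertex off the
boundary. -/
theorem BoundaryParam.exists_common_vertex (h : G.BoundaryParam F a b γ t) {p q : List V}
    (hp : p ∈ G.connecting F a b) (hq : q ∈ G.separating F a b) :
    ∃ v ∈ p, v ∈ q ∧ v ∉ G.boundaryVertices F := by
  obtain ⟨c, d, hcd, hq⟩ := hq
  have hp : G.IsProperPath F a b p := hp
  have hdF : ∀ T : Set V, Disjoint (G.span T) F := fun T =>
    h.isFace.disjoint_support.symm.mono_left span_subset_support
  -- The paths span connected sets outside `F` that join interlaced pairs of boundary points, so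
  -- these sets meet; spans of disjoint vertex sets would not.
  have key : ∀ x ∈ q, ∀ y ∈ q, x ∈ G.side γ (Ioo 0 t) → y ∈ G.side γ (Ioo t 1) →
      (G.span {v | v ∈ p} ∩ G.span {v | v ∈ q}).Nonempty := by
    rintro x hx y hy ⟨s₁, hs₁, h₁⟩ ⟨s₃, hs₃, h₃⟩
    exact inter_nonempty_of_interlaced h.isFace.isOpen h.isFace.isConnected h.param hs₁.1 hs₁.2
      hs₃.1 hs₃.2 isCompact_span hp.isPreconnected_span (hdF _)
      (by rw [h.zero]; exact hp.left_mem_span) (by rw [h.apply_eq]; exact hp.right_mem_span)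
      hq.isPreconnected_span (hdF _) (isCompact_span.isClosed.inter isClosed_frontier)
      (by rw [h₁]; exact point_mem_span.2 hx) (by rw [h₃]; exact point_mem_span.2 hy)
  have hne : (G.span {v | v ∈ p} ∩ G.span {v | v ∈ q}).Nonempty := by
    rcases h.inDifferentComponents_iff.1 hcd with ⟨hc, hd⟩ | ⟨hc, hd⟩
    · exact key c hq.left_mem d hq.right_mem hc hd
    · exact key d hq.right_mem c hq.left_mem hd hc
  obtain ⟨v, hvp, hvq⟩ : ∃ v ∈ p, v ∈ q := by
    by_contra! hcon
    obtain ⟨x, hx, hx'⟩ := hne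
    exact disjoint_left.1 (disjoint_span (S := {v | v ∈ p}) (T := {v | v ∈ q})
      (disjoint_left.2 hcon)) hx hx'
  refine ⟨v, hvp, hvq, fun hv => ?_⟩
  have hvab : G.point v ∈ ({G.point a, G.point b} : Set ℂ) := by
    rcases hp.eq_or_eq hvp hv with rfl | rfl <;> simp
  rcases hq.eq_or_eq hvq hv with rfl | rfl
  · exact hcd.1.2 hvab
  · exact hcd.2.1.2 hvab

/-- A face with two of its boundary points added is a connected set outside `F`, and it meets the
graph only in these two points. It would have to cross the span that joins the other pair. -/
theorem IsFace.not_interlaced (hF : G.IsFace F) (hγ : JordanParam γ (frontier F))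
    (hf : G.IsFace f) (hfF : f ≠ F) {s₁ s₂ s₃ : ℝ} (h₁ : 0 < s₁) (h₁₂ : s₁ < s₂)
    (h₂₃ : s₂ < s₃) (h₃ : s₃ < 1) (hS : IsPreconnected (G.span S)) (h0 : γ 0 ∈ G.span S)
    (h2 : γ s₂ ∈ G.span S) (h1 : γ s₁ ∉ G.span S) (h3 : γ s₃ ∉ G.span S)
    (h1f : γ s₁ ∈ closure f) (h3f : γ s₃ ∈ closure f) : False := by
  have hfd : ∀ p ∈ f, p ∉ G.support := fun p hp => disjoint_left.1 hf.disjoint_support hp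
  have hins : IsPreconnected (f ∪ {γ s₁, γ s₃}) := by
    refine hf.isConnected.isPreconnected.subset_closure subset_union_left
      (union_subset subset_closure ?_)
    rintro _ (rfl | rfl)
    exacts [h1f, h3f]
  have hJ : (f ∪ {γ s₁, γ s₃}) ∩ frontier F = {γ s₁, γ s₃} := by
    apply Subset.antisymm
    · rintro p ⟨hp | hp, hpF⟩
      · exact absurd (hF.frontier_subset hpF) (hfd p hp)
      · exact hp
    · rintro _ (rfl | rfl)
      · exact ⟨Or.inr (Or.inl rfl), hγ.mem _⟩
      · exact ⟨Or.inr (Or.inr rfl), hγ.mem _⟩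
  have hnF : ∀ s, γ s ∉ F := fun s hs =>
    disjoint_left.1 hF.disjoint_support hs (hF.frontier_subset (hγ.mem s))
  obtain ⟨p, hp, hp'⟩ := inter_nonempty_of_interlaced hF.isOpen hF.isConnected hγ h₁ h₁₂ h₂₃ h₃
    isCompact_span hS (hF.disjoint_support.symm.mono_left span_subset_support) h0 h2 hins
    (disjoint_left.2 (by
      rintro p (hp | rfl | rfl) hpF
      · exact hfF (hf.eq_of_mem hF hp hpF)
      · exact hnF _ hpF
      · exact hnF _ hpF)) (by rw [hJ]; exact (toFinite _).isClosed) (Or.inr (Or.inl rfl))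
    (Or.inr (Or.inr rfl))
  rcases hp' with hpf | rfl | rfl
  · exact hfd p hpf (span_subset_support hp)
  · exact h1 hp
  · exact h3 hp

/-- If some path connects `a` and `b`, no other face touches both sides. -/
theorem BoundaryParam.face_not_both_sides (h : G.BoundaryParam F a b γ t)
    (hcon : (G.connecting F a b).Nonempty) (hf : G.IsFace f) (hfF : f ≠ F)
    (hc : c ∈ G.side γ (Ioo 0 t)) (hd : d ∈ G.side γ (Ioo t 1)) (hcf : c ∈ G.boundaryVertices f)
    (hdf : d ∈ G.boundaryVertices f) : False := by
  obtain ⟨p, hp⟩ := hcon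
  have hp : G.IsProperPath F a b p := hp
  have hn : ∀ {v}, v ∈ G.boundaryVertices F → v ≠ a ∧ v ≠ b → G.point v ∉ G.span {v | v ∈ p} :=
    fun hv hv' hvp =>
      (hp.eq_or_eq (point_mem_span (S := {v | v ∈ p}).1 hvp) hv).elim hv'.1 hv'.2
  have hc' := hn (h.side_subset _ hc) (h.ne_of_mem_left hc)
  have hd' := hn (h.side_subset _ hd) (h.ne_of_mem_right hd)
  obtain ⟨s₁, hs₁, h₁⟩ := hc
  obtain ⟨s₃, hs₃, h₃⟩ := hd
  exact h.isFace.not_interlaced h.param hf hfF hs₁.1 hs₁.2 hs₃.1 hs₃.2 hp.isPreconnected_span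
    (by rw [h.zero]; exact hp.left_mem_span) (by rw [h.apply_eq]; exact hp.right_mem_span)
    (h₁ ▸ hc') (h₃ ▸ hd') (h₁ ▸ frontier_subset_closure hcf) (h₃ ▸ frontier_subset_closure hdf)

/-- If some path separates `a` and `b`, no other face touches both of them. -/
theorem BoundaryParam.face_not_both_ends (h : G.BoundaryParam F a b γ t)
    (hsep : (G.separating F a b).Nonempty) (hf : G.IsFace f) (hfF : f ≠ F)
    (haf : a ∈ G.boundaryVertices f) (hbf : b ∈ G.boundaryVertices f) : False := by
  obtain ⟨q, c, d, hcd, hq⟩ := hsep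
  have key : ∀ {x y}, x ∈ q → y ∈ q → x ∈ G.side γ (Ioo 0 t) → y ∈ G.side γ (Ioo t 1) →
      False := by
    rintro x y hx hy ⟨s₁, hs₁, h₁⟩ ⟨s₃, hs₃, h₃⟩
    have hn : ∀ {v}, v ∈ G.boundaryVertices F → G.point v ∈ ({G.point a, G.point b} : Set ℂ) →
        G.point v ∉ G.span {v | v ∈ q} := by
      intro v hv hvab hvq
      rcases hq.eq_or_eq (point_mem_span (S := {v | v ∈ q}).1 hvq) hv with rfl | rfl
      · exact hcd.1.2 hvab
      · exact hcd.2.1.2 hvab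
    have e : γ (1 - s₁ + s₁) = G.point a := by
      rw [← h.zero, ← h.param.add_one 0]; congr 1; ring
    -- The parametrization is restarted at time `s₁`, so that `q` joins the times `0` and `s₃ - s₁`,
    -- while `b` and `a` are passed at `t - s₁` and `1 - s₁`.
    refine h.isFace.not_interlaced (h.param.shift s₁) hf hfF (s₁ := t - s₁) (s₂ := s₃ - s₁)
      (s₃ := 1 - s₁) (by linarith [hs₁.2]) (by linarith [hs₃.1]) (by linarith [hs₃.2])
      (by linarith [hs₁.1]) hq.isPreconnected_span ?_ ?_ ?_ ?_ ?_ ?_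
    · simpa [h₁] using point_mem_span (S := {v | v ∈ q}).2 hx
    · simpa [h₃] using point_mem_span (S := {v | v ∈ q}).2 hy
    · simpa [h.apply_eq] using hn h.right_mem (by simp)
    · simpa only [e] using hn h.left_mem (by simp)
    · simpa [h.apply_eq] using frontier_subset_closure hbf
    · simpa only [e] using frontier_subset_closure haf
  rcases h.inDifferentComponents_iff.1 hcd with ⟨hc, hd⟩ | ⟨hc, hd⟩
  · exact key hq.left_mem hq.right_mem hc hd
  · exact key hq.right_mem hq.left_mem hd hc

omit [Finite V] [Finite E]

/-- A path through `U` from one side to the other contains a proper path without repetitions that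
separates `a` and `b`. -/
theorem BoundaryParam.exists_separating_path (h : G.BoundaryParam F a b γ t) {U : Set V}
    (haU : a ∉ U) (hbU : b ∉ U) (hc : c ∈ G.side γ (Ioo 0 t)) (hd : d ∈ G.side γ (Ioo t 1))
    (hcd : ReflTransGen (fun u w => G.Adj u w ∧ w ∈ U) c d) :
    ∃ x l y, x :: (l ++ [y]) ∈ G.separating F a b ∧ x ∈ G.boundaryVertices F ∧
      y ∈ G.boundaryVertices F ∧ l.Nodup ∧ ∀ w ∈ l, w ∈ U := by
  by_contra hcon
  have hend : ∀ {x l y}, x ∈ G.side γ (Ioo 0 t) → y ∈ G.side γ (Ioo t 1) → l.Nodup →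
      (x :: (l ++ [y])).IsChain G.Adj → (∀ w ∈ l, w ∈ U ∧ w ∉ G.boundaryVertices F) → False := by
    intro x l y hx hy hl hlc hlU
    have hx' := h.side_subset _ hx
    have hy' := h.side_subset _ hy
    exact hcon ⟨x, l, y, ⟨x, y, h.inDifferentComponents_iff.2 (Or.inl ⟨hx, hy⟩), hx', hy', hlc, l,
      rfl, fun w hw => (hlU w hw).2⟩, hx', hy', hl, fun w hw => (hlU w hw).1⟩
  -- The path is restarted at each visit to the first side, and loops are cut off at repeated
  -- vertices; the first arrival at the second side would complete a proper path.
  have key : ∀ w, ReflTransGen (fun u w => G.Adj u w ∧ w ∈ U) c w → w ∈ G.side γ (Ioo 0 t) ∨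
      ∃ x ∈ G.side γ (Ioo 0 t), ∃ l : List V, (l ++ [w]).Nodup ∧
        (x :: (l ++ [w])).IsChain G.Adj ∧ ∀ y ∈ l ++ [w], y ∈ U ∧ y ∉ G.boundaryVertices F := by
    intro w hw
    induction hw with
    | refl => exact Or.inl hc
    | @tail w w' _ hww ih =>
      obtain ⟨hadj, hwU⟩ := hww
      by_cases hwF : w' ∈ G.boundaryVertices F
      · rcases h.mem_boundaryVertices hwF with rfl | rfl | hw' | hw'
        · exact absurd hwU haU
        · exact absurd hwU hbU
        · exact Or.inl hw'
        · exfalso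
          rcases ih with hw | ⟨x, hx, l, hl, hlc, hlU⟩
          · exact hend (l := []) hw hw' List.nodup_nil (by simpa using hadj) (by simp)
          · refine hend hx hw' hl ?_ hlU
            refine hlc.append (List.isChain_singleton _) ?_
            rw [← List.cons_append, List.getLast?_concat]
            simpa using hadj
      · refine Or.inr ?_
        rcases ih with hw | ⟨x, hx, l, hl, hlc, hlU⟩
        · exact ⟨w, hw, [], by simp, by simpa using hadj, by simpa using ⟨hwU, hwF⟩⟩
        · by_cases hmem : w' ∈ l ++ [w]
          · obtain ⟨l₁, l₂, hl₁₂⟩ := List.append_of_mem hmem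
            have e : l ++ [w] = (l₁ ++ [w']) ++ l₂ := by simp [hl₁₂]
            rw [e] at hl hlc hlU
            refine ⟨x, hx, l₁, hl.of_append_left, ?_,
              fun y hy => hlU y (List.mem_append_left _ hy)⟩
            rw [← List.cons_append] at hlc
            exact hlc.left_of_append
          · refine ⟨x, hx, l ++ [w], ?_, ?_, ?_⟩
            · exact hl.append (List.nodup_singleton _) (by simpa using hmem)
            · rw [← List.cons_append]
              refine hlc.append (List.isChain_singleton _) ?_
              rw [← List.cons_append, List.getLast?_concat]
              simpa using hadj
            · intro y hy
              rcases List.mem_append.1 hy with hy | hy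
              · exact hlU y hy
              · rw [List.mem_singleton.1 hy]
                exact ⟨hwU, hwF⟩
  rcases key d hcd with hd' | ⟨x, hx, l, -, -, hlU⟩
  · exact disjoint_left.1 h.disjoint_sides hd' hd
  · exact (hlU d (by simp)).2 (h.side_subset _ hd)

/-- The ends do not contribute and no inner vertex is counted twice, so length is bounded by mass.
-/
theorem vertexLength_le [Fintype V] {ν : V → ℝ≥0} {U : Set V} {x y : V} {l : List V} (hx : ν x = 0)
    (hy : ν y = 0) (hl : l.Nodup) (hlU : ∀ w ∈ l, w ∈ U) :
    vertexLength ν (x :: (l ++ [y])) ≤ ∑ w, U.indicator ν w := by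
  classical
  have : vertexLength ν (x :: (l ++ [y])) = ∑ w ∈ l.toFinset, ν w := by
    rw [List.sum_toFinset ν hl]
    simp [vertexLength, hx, hy]
  rw [this]
  refine le_trans (Finset.sum_le_sum fun w hw => ?_)
    (Finset.sum_le_sum_of_subset (f := U.indicator ν) (Finset.subset_univ l.toFinset))
  rw [indicator_of_mem (hlU w (List.mem_toFinset.1 hw))]

end PlaneGraph

/-! ### Basins, their far side and their shore. -/

namespace PlaneGraph

open Set Metric Relation

variable {V E : Type*} {G : PlaneGraph V E} {f F : Set ℂ} {a b c d u v w w' : V} {γ : ℝ → ℂ}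
  {t : ℝ} {S : Set V}

theorem reflTransGen_mem {r : V → V → Prop} (h : ReflTransGen r c v) :
    ReflTransGen (fun u w => r u w ∧ ReflTransGen r c w) c v := by
  induction h with
  | refl => exact ReflTransGen.refl
  | tail hw hr ih => exact ih.tail ⟨hr, hw.tail hr⟩

variable (G) in
/-- `S` is a connected set of vertices that contains `a`, no other boundary vertex of `F`, and no
neighbour of `b`. -/
structure IsBasin (F : Set ℂ) (a b : V) (S : Set V) : Prop where
  mem : a ∈ S
  eq_of_mem : ∀ v ∈ S, v ∈ G.boundaryVertices F → v = a
  connected : ∀ v ∈ S, ReflTransGen (fun u w => G.Adj u w ∧ w ∈ S) a v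
  not_adj : ∀ v ∈ S, ¬ G.Adj v b

variable (G) in
/-- The vertices that are joined off `S` to a boundary vertex of `F` other than `a`. -/
def farSide (F : Set ℂ) (a : V) (S : Set V) : Set V :=
  {v | ∃ c ∈ G.boundaryVertices F, c ≠ a ∧ ReflTransGen (fun u w => G.Adj u w ∧ w ∉ S) c v}

variable (G) in
/-- The vertices of the far side of `S` that have a neighbour in `S`. -/
def shore (F : Set ℂ) (a : V) (S : Set V) : Set V :=
  {w | w ∈ G.farSide F a S ∧ ∃ u ∈ S, G.Adj u w}

namespace IsBasin

variable (hS : G.IsBasin F a b S)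

include hS

theorem notMem_of_mem_farSide (hv : v ∈ G.farSide F a S) : v ∉ S := by
  obtain ⟨c, hc, hca, h⟩ := hv
  rcases h.cases_tail with rfl | ⟨_, -, -, h⟩
  exacts [fun h => hca (hS.eq_of_mem _ h hc), h]

-- The far side is closed under adjacency off `S`. Its complement is therefore `S` with its holes
-- filled, and touches the far side only through `S`.
omit hS in
theorem mem_of_adj (hw : w ∈ G.farSide F a S) (hu : u ∉ G.farSide F a S) (h : G.Adj u w) :
    u ∈ S := by
  by_contra huS
  obtain ⟨c, hc, hca, hcw⟩ := hw
  exact hu ⟨c, hc, hca, hcw.tail ⟨h.symm, huS⟩⟩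

omit hS in
theorem mem_farSide (hv : v ∈ G.boundaryVertices F) (hva : v ≠ a) : v ∈ G.farSide F a S :=
  ⟨v, hv, hva, ReflTransGen.refl⟩

theorem left_notMem_farSide : a ∉ G.farSide F a S := fun h => hS.notMem_of_mem_farSide h hS.mem

omit hS in
theorem mem_shore (hw : w ∉ (G.farSide F a S)ᶜ) (h : ∃ u ∈ (G.farSide F a S)ᶜ, G.Adj u w) :
    w ∈ G.shore F a S := by
  obtain ⟨u, hu, huw⟩ := h
  exact ⟨not_not.1 hw, u, IsBasin.mem_of_adj (not_not.1 hw) hu huw, huw⟩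

theorem ne_of_mem_shore (hw : w ∈ G.shore F a S) : w ≠ a ∧ w ≠ b := by
  constructor
  · rintro rfl
    exact hS.left_notMem_farSide hw.1
  · rintro rfl
    obtain ⟨u, hu, huw⟩ := hw.2
    exact hS.not_adj u hu huw

end IsBasin

theorem BoundaryParam.ne (h : G.BoundaryParam F a b γ t) : a ≠ b := by
  rintro rfl
  exact h.pos.ne (h.eq_of_apply_eq ⟨le_rfl, zero_lt_one⟩ ⟨h.pos.le, h.lt_one⟩
    (h.zero.trans h.apply_eq.symm))

theorem BoundaryParam.isPreconnected_diff_left (h : G.BoundaryParam F a b γ t) :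
    IsPreconnected (frontier F \ {G.point a}) := by
  have : frontier F \ {G.point a} = γ '' Ioo 0 1 := by
    apply Subset.antisymm
    · rintro p ⟨hp, hpa⟩
      obtain ⟨s, hs, rfl⟩ := h.param.exists_mem_Ico hp 0
      refine ⟨s, ⟨hs.1.lt_of_ne ?_, by linarith [hs.2]⟩, rfl⟩
      rintro rfl
      exact hpa h.zero
    · rintro _ ⟨s, hs, rfl⟩
      refine ⟨h.param.mem s, fun hsa => hs.1.ne' ?_⟩
      exact h.eq_of_apply_eq (Ioo_subset_Ico_self hs) ⟨le_rfl, zero_lt_one⟩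
        (Eq.trans hsa h.zero.symm)
  rw [this]
  exact isPreconnected_Ioo.image _ h.param.continuous.continuousOn

theorem BoundaryParam.isPreconnected_diff_right (h : G.BoundaryParam F a b γ t) :
    IsPreconnected (frontier F \ {G.point b}) := by
  have : G.BoundaryParam F b a (fun s => γ (s + t)) (1 - t) :=
    ⟨h.isFace, h.param.shift t, by simp [h.apply_eq], by linarith [h.lt_one],
      by linarith [h.pos], by rw [← h.zero, ← h.param.add_one 0]; congr 1; ring⟩
  exact this.isPreconnected_diff_left

/-- This set contains the whole shore and no vertex outside the far side. With it,
`IsFace.reflTransGen_adj` yields walks along a face that avoid such a vertex, in particular `a`. -/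
theorem isPreconnected_union_farSide (h : G.BoundaryParam F a b γ t)
    (hS : G.IsBasin F a b S) :
    IsPreconnected (frontier F \ {G.point a} ∪ G.span (G.farSide F a S)) := by
  have hJ := h.isPreconnected_diff_left
  have hmem : ∀ {c}, c ∈ G.boundaryVertices F → c ≠ a → G.point c ∈ frontier F \ {G.point a} :=
    fun hc hca => ⟨hc, fun h => hca (G.point_injective h)⟩
  have key : ∀ c ∈ G.boundaryVertices F, c ≠ a →
      ∀ p ∈ G.span {v | ReflTransGen (fun u w => G.Adj u w ∧ w ∉ S) c v},
      ∃ T ⊆ frontier F \ {G.point a} ∪ G.span (G.farSide F a S),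
        G.point b ∈ T ∧ p ∈ T ∧ IsPreconnected T := by
    intro c hc hca p hp
    refine ⟨frontier F \ {G.point a} ∪
      G.span {v | ReflTransGen (fun u w => G.Adj u w ∧ w ∉ S) c v},
      union_subset_union_right _ (span_mono fun v hv => ⟨c, hc, hca, hv⟩),
      Or.inl (hmem h.right_mem h.ne.symm), Or.inr hp, ?_⟩
    exact hJ.union (G.point c) (hmem hc hca) (point_mem_span.2 ReflTransGen.refl)
      (isPreconnected_span (a := c) ReflTransGen.refl fun w hw =>
        ReflTransGen.mono (fun _ _ h => ⟨h.1.1, h.2⟩) _ _ (reflTransGen_mem hw))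
  refine isPreconnected_of_forall (G.point b) ?_
  rintro p (hp | hp)
  · exact ⟨_, subset_union_left, hmem h.right_mem h.ne.symm, hp, hJ⟩
  · rcases mem_span_iff.1 hp with ⟨v, ⟨c, hc, hca, hv⟩, rfl⟩ | ⟨e, ⟨c, hc, hca, hv⟩, he, hpe⟩
    · exact key c hc hca _ (point_mem_span.2 hv)
    · exact key c hc hca _ (inner_subset_span (S := {v | ReflTransGen _ c v}) hv
        (hv.tail ⟨⟨e, Or.inl ⟨rfl, rfl⟩⟩, hS.notMem_of_mem_farSide he⟩) hpe)

/-- The analogous set that contains the shore but not `b`; it yields walks along a face that avoid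
`b`. -/
theorem isPreconnected_union_near (h : G.BoundaryParam F a b γ t) (hS : G.IsBasin F a b S) :
    IsPreconnected (frontier F \ {G.point b} ∪
      G.span (S ∪ {w | w ∉ G.boundaryVertices F ∧ ∃ u ∈ S, G.Adj u w})) := by
  refine h.isPreconnected_diff_right.union (G.point a)
    ⟨h.left_mem, fun hab => h.ne (G.point_injective hab)⟩ (point_mem_span.2 (Or.inl hS.mem))
    (isPreconnected_span (a := a) (Or.inl hS.mem) ?_)
  have key : ∀ w ∈ S, ReflTransGen (fun u w => G.Adj u w ∧
      w ∈ S ∪ {w | w ∉ G.boundaryVertices F ∧ ∃ u ∈ S, G.Adj u w}) a w :=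
    fun w hw => ReflTransGen.mono (fun _ _ h => ⟨h.1, Or.inl h.2⟩) _ _ (hS.connected w hw)
  rintro w (hw | ⟨hw, u, hu, huw⟩)
  · exact key w hw
  · exact (key u hu).tail ⟨huw, Or.inr ⟨hw, u, hu, huw⟩⟩

theorem IsProperPath.exists_mem_notMem {p : List V} (hp : G.IsProperPath F a b p)
    (hab : ¬ G.Adj a b) : ∃ v, v ∉ G.boundaryVertices F := by
  obtain ⟨-, -, hc, l, rfl, hl⟩ := hp
  rcases l with _ | ⟨v, l⟩
  · exact absurd (by simpa using hc) hab
  · exact ⟨v, hl v List.mem_cons_self⟩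

variable (G) in
/-- A step between two shore vertices along the boundary of a face other than `F`. -/
def ShoreStep (F : Set ℂ) (a b : V) (S : Set V) (w w' : V) : Prop :=
  w' ∈ G.shore F a S ∧ ∃ f, G.IsFace f ∧ f ≠ F ∧ w ∈ G.boundaryVertices f ∧
    w' ∈ G.boundaryVertices f ∧
    (∃ u ∈ G.boundaryVertices f, u ∉ G.farSide F a S ∧
      ReflTransGen (fun x y => G.Adj x y ∧ y ∈ G.boundaryVertices f ∧ y ≠ u) w w') ∧
    ReflTransGen (fun x y => G.Adj x y ∧ y ∈ G.boundaryVertices f ∧ y ≠ a ∧ y ≠ b) w w'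

/-- The topological core of the lower bound. Going around the filled basin from one side of `a` to
the other meets only shore vertices, and consecutive ones can be linked along the boundary of a
common face. -/
theorem exists_shoreStep_chain [Finite V] [Finite E] (h : G.BoundaryParam F a b γ t)
    (hab : ¬ G.AdjOnBoundary F a b) (hcon : (G.connecting F a b).Nonempty)
    (hsep : (G.separating F a b).Nonempty) (hS : G.IsBasin F a b S) :
    ∃ c ∈ G.side γ (Ioo 0 t), ∃ d ∈ G.side γ (Ioo t 1), c ∈ G.shore F a S ∧
      ReflTransGen (G.ShoreStep F a b S) c d := by
  obtain ⟨o, ho⟩ : ∃ v, v ∉ G.boundaryVertices F :=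
    hcon.some_mem.exists_mem_notMem (hS.not_adj a hS.mem)
  have ho' : G.point o ∉ closure F := fun hoF =>
    ho (h.isFace.mem_frontier (point_mem_support o) hoF)
  obtain ⟨c, d, hc, hd, hcS, hcd⟩ := exists_vertexStep_chain h.isFace h.param h.zero h.pos
    h.lt_one h.apply_eq hab ho' (S := (G.farSide F a S)ᶜ) hS.left_notMem_farSide
    (fun v hv hvF => by_contra fun hva => hv (IsBasin.mem_farSide hvF hva))
  have hcS := IsBasin.mem_shore hcS.1 hcS.2
  refine ⟨c, hc, d, hd, hcS, ?_⟩
  clear hd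
  suffices hs : d ∈ G.shore F a S ∧ ReflTransGen (G.ShoreStep F a b S) c d from hs.2
  induction hcd with
  | refl => exact ⟨hcS, ReflTransGen.refl⟩
  | @tail w w' _ hww ih =>
    obtain ⟨hwS, hcw⟩ := ih
    obtain ⟨⟨hw', hadj⟩, f, hf, hfF, hwf, hwf', u, hu, huf⟩ := hww
    have hwS' := IsBasin.mem_shore hw' hadj
    refine ⟨hwS', hcw.tail ⟨hwS', f, hf, hfF, hwf, hwf', ?_⟩⟩
    have hdis : ∀ {T T'}, T ⊆ frontier F → Disjoint (T ∪ G.span T') f := fun hT =>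
      hf.disjoint_support.symm.mono_left (union_subset (hT.trans h.isFace.frontier_subset)
        span_subset_support)
    have hfar : ∀ {u}, u ∈ G.boundaryVertices f → u ∉ G.farSide F a S →
        ReflTransGen (fun x y => G.Adj x y ∧ y ∈ G.boundaryVertices f ∧ y ≠ u) w w' := by
      intro u huf hu
      refine hf.reflTransGen_adj (isPreconnected_union_farSide h hS) (hdis sdiff_subset) ?_ hwf
        (Or.inr (point_mem_span.2 hwS.1)) hwf' (Or.inr (point_mem_span.2 hwS'.1))
      rintro (⟨huF, hua⟩ | huS)
      · exact hu (IsBasin.mem_farSide huF fun h => hua (congrArg G.point h))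
      · exact hu (point_mem_span.1 huS)
    refine ⟨⟨u, huf, hu, hfar huf hu⟩, ?_⟩
    -- A face does not touch both `a` and `b`, so it suffices to avoid the one that can occur.
    by_cases haf : a ∈ G.boundaryVertices f
    · have hbf : b ∉ G.boundaryVertices f := fun hbf =>
        h.face_not_both_ends hsep hf hfF haf hbf
      exact ReflTransGen.mono (fun x y hxy =>
        ⟨hxy.1, hxy.2.1, hxy.2.2, fun hyb => hbf (hyb ▸ hxy.2.1)⟩) _ _
        (hfar haf hS.left_notMem_farSide)
    · have hnear : ∀ {w}, w ∈ G.shore F a S → G.point w ∈ frontier F \ {G.point b} ∪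
          G.span (S ∪ {w | w ∉ G.boundaryVertices F ∧ ∃ u ∈ S, G.Adj u w}) := by
        intro w hw
        by_cases hwF : w ∈ G.boundaryVertices F
        · exact Or.inl ⟨hwF, fun hwb => (hS.ne_of_mem_shore hw).2 (G.point_injective hwb)⟩
        · exact Or.inr (point_mem_span.2 (Or.inr ⟨hwF, hw.2⟩))
      refine ReflTransGen.mono (fun x y hxy =>
        ⟨hxy.1, hxy.2.1, fun hya => haf (hya ▸ hxy.2.1), hxy.2.2⟩) _ _
        (hf.reflTransGen_adj (z := b) (isPreconnected_union_near h hS) (hdis sdiff_subset)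
        ?_ hwf (hnear hwS) hwf' (hnear hwS'))
      rintro (⟨-, hbb⟩ | hbS)
      · exact hbb rfl
      · rcases point_mem_span.1 hbS with hbS | ⟨hbF, -⟩
        · exact h.ne (hS.eq_of_mem b hbS h.right_mem).symm
        · exact hbF h.right_mem

end PlaneGraph

/-! ### Shores in the triangulated case, and cells in general. -/

namespace PlaneGraph

open Set Metric Relation

variable {V E : Type*} {G : PlaneGraph V E} {f F : Set ℂ} {a b c d u v w w' : V} {γ : ℝ → ℂ}
  {t : ℝ} {S Q : Set V} {N : ℕ}

theorem reflTransGen_adj_symm {P : V → Prop} (h : ReflTransGen (fun u w => G.Adj u w ∧ P w) v w)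
    (hv : P v) : ReflTransGen (fun u w => G.Adj u w ∧ P w) w v := by
  suffices hs : P w ∧ ReflTransGen (fun u w => G.Adj u w ∧ P w) w v from hs.2
  induction h with
  | refl => exact ⟨hv, ReflTransGen.refl⟩
  | tail _ hr ih => exact ⟨hr.2, ih.2.head ⟨hr.1.symm, ih.1⟩⟩

theorem BoundaryParam.one_le_sum_indicator [Fintype V] (h : G.BoundaryParam F a b γ t)
    {ν : V → ℝ≥0} (hν : IsAdmissible (G.separating F a b) (G.boundaryVertices F) ν) {U : Set V}
    (haU : a ∉ U) (hbU : b ∉ U) (hc : c ∈ G.side γ (Ioo 0 t)) (hd : d ∈ G.side γ (Ioo t 1))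
    (hcd : ReflTransGen (fun u w => G.Adj u w ∧ w ∈ U) c d) :
    1 ≤ ∑ w, U.indicator ν w := by
  obtain ⟨x, l, y, hp, hx, hy, hl, hlU⟩ := h.exists_separating_path haU hbU hc hd hcd
  exact (hν.1 _ hp).trans (vertexLength_le (hν.2 x hx) (hν.2 y hy) hl hlU)

/-- Once `u` is excluded, a walk along the face has only `w` and `w'` at its disposal. -/
theorem adj_or_eq_of_ncard_le_three [Finite V] (hf : (G.boundaryVertices f).ncard ≤ 3)
    (hw : w ∈ G.boundaryVertices f) (hw' : w' ∈ G.boundaryVertices f)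
    (hu : u ∈ G.boundaryVertices f) (huw : u ≠ w) (huw' : u ≠ w')
    (h : ReflTransGen (fun x y => G.Adj x y ∧ y ∈ G.boundaryVertices f ∧ y ≠ u) w w') :
    w = w' ∨ G.Adj w w' := by
  by_contra! hcon
  have hthree : G.boundaryVertices f = {u, w, w'} := by
    refine (eq_of_subset_of_ncard_le ?_ ?_ (toFinite _)).symm
    · rintro x (rfl | rfl | rfl) <;> assumption
    · rwa [ncard_eq_three.2 ⟨u, w, w', huw, huw', hcon.1, rfl⟩]
  have key : ∀ x, ReflTransGen (fun x y => G.Adj x y ∧ y ∈ G.boundaryVertices f ∧ y ≠ u) w x →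
      x = w := by
    intro x hx
    induction hx with
    | refl => rfl
    | tail _ hr ih =>
      obtain ⟨hadj, hy, hyu⟩ := hr
      rw [hthree] at hy
      rcases hy with hy | hy | hy
      · exact absurd hy hyu
      · exact hy
      · rw [ih, hy] at hadj
        exact absurd hadj hcon.2
  exact hcon.1 (key _ h).symm

/-- The face of a shore step also has a vertex outside the far side, so with at most three vertices
per face consecutive shore vertices are equal or adjacent, and the shore carries a separating path.
-/
theorem one_le_sum_shore [Fintype V] [Finite E] (h : G.BoundaryParam F a b γ t)
    (hab : ¬ G.AdjOnBoundary F a b) (hcon : (G.connecting F a b).Nonempty)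
    (hsep : (G.separating F a b).Nonempty) (hS : G.IsBasin F a b S)
    (hfaces : ∀ f, G.IsFace f → f ≠ F → (G.boundaryVertices f).ncard ≤ 3) {ν : V → ℝ≥0}
    (hν : IsAdmissible (G.separating F a b) (G.boundaryVertices F) ν) :
    1 ≤ ∑ w, (G.shore F a S).indicator ν w := by
  obtain ⟨c, hc, d, hd, hcS, hcd⟩ := exists_shoreStep_chain h hab hcon hsep hS
  refine h.one_le_sum_indicator hν (fun h => (hS.ne_of_mem_shore h).1 rfl)
    (fun h => (hS.ne_of_mem_shore h).2 rfl) hc hd ?_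
  clear hd
  suffices hs : d ∈ G.shore F a S ∧
    ReflTransGen (fun u w => G.Adj u w ∧ w ∈ G.shore F a S) c d from hs.2
  induction hcd with
  | refl => exact ⟨hcS, ReflTransGen.refl⟩
  | tail _ hr ih =>
    obtain ⟨hw', f, hf, hfF, hwf, hwf', ⟨u, huf, hu, hww⟩, -⟩ := hr
    refine ⟨hw', ?_⟩
    rcases adj_or_eq_of_ncard_le_three (hfaces f hf hfF) hwf hwf' huf
      (fun h => hu (h ▸ ih.1.1)) (fun h => hu (h ▸ hw'.1)) hww with rfl | hadj
    · exact ih.2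
    · exact ih.2.tail ⟨hadj, hw'⟩

variable (G) in
/-- A cell is a connected set of at most `N` vertices off the boundary of `F`, one of which lies on
the shore of `S`. -/
structure IsCell (F : Set ℂ) (a : V) (S : Set V) (N : ℕ) (Q : Set V) : Prop where
  disjoint : ∀ v ∈ Q, v ∉ G.boundaryVertices F
  ncard_le : Q.ncard ≤ N
  connected : ∃ w ∈ Q, w ∈ G.shore F a S ∧
    ∀ v ∈ Q, ReflTransGen (fun x y => G.Adj x y ∧ y ∈ Q) w v

variable (G) in
/-- The vertices that can be reached from `w` along the boundary of `f` and off the boundary of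
`F`. -/
def cellAt (F f : Set ℂ) (w : V) : Set V :=
  {v | ReflTransGen (fun x y => G.Adj x y ∧ y ∈ G.boundaryVertices f ∧ y ∉ G.boundaryVertices F)
    w v}

theorem mem_cellAt_self : w ∈ G.cellAt F f w := ReflTransGen.refl

theorem of_mem_cellAt (hv : v ∈ G.cellAt F f w) :
    v = w ∨ v ∈ G.boundaryVertices f ∧ v ∉ G.boundaryVertices F := by
  rcases ReflTransGen.cases_tail hv with h | ⟨_, -, -, h⟩
  exacts [Or.inl h, Or.inr h]

theorem isCell_cellAt [Finite V] (hf : (G.boundaryVertices f).ncard ≤ N)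
    (hwf : w ∈ G.boundaryVertices f) (hwF : w ∉ G.boundaryVertices F) (hw : w ∈ G.shore F a S) :
    G.IsCell F a S N (G.cellAt F f w) := by
  have hmem : ∀ v ∈ G.cellAt F f w, v ∈ G.boundaryVertices f ∧ v ∉ G.boundaryVertices F :=
    fun v hv => (of_mem_cellAt hv).elim (fun h => h ▸ ⟨hwf, hwF⟩) id
  exact ⟨fun v hv => (hmem v hv).2,
    (ncard_le_ncard (fun v hv => (hmem v hv).1) (toFinite _)).trans hf, w, mem_cellAt_self, hw,
    fun v hv => ReflTransGen.mono (fun _ _ h => ⟨h.1.1, h.2⟩) _ _ (reflTransGen_mem hv)⟩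

theorem mem_cellAt_or (h : ReflTransGen (fun x y => G.Adj x y ∧ y ∈ G.boundaryVertices f ∧
      y ≠ a ∧ y ≠ b) w v) :
    v ∈ G.cellAt F f w ∨ ∃ x ∈ G.boundaryVertices F, x ∈ G.boundaryVertices f ∧ x ≠ a ∧ x ≠ b ∧
      ∃ y ∈ G.cellAt F f w, G.Adj y x := by
  induction h with
  | refl => exact Or.inl mem_cellAt_self
  | @tail v v' _ hr ih =>
    rcases ih with hv | hx
    · by_cases hv' : v' ∈ G.boundaryVertices F
      · exact Or.inr ⟨v', hv', hr.2.1, hr.2.2.1, hr.2.2.2, v, hv, hr.1⟩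
      · exact Or.inl (ReflTransGen.tail hv ⟨hr.1, hr.2.1, hv'⟩)
    · exact Or.inr hx

/-- Every face of the shore chain provides cells around its two shore vertices. Where a walk along
the face is interrupted by `∂F`, the vertex met there belongs to one of the two sides, and no face
touches both. So the chain of cells is restarted at the first side, continued, or completed at the
second. -/
theorem exists_linked_cells [Finite V] [Finite E] (h : G.BoundaryParam F a b γ t)
    (hab : ¬ G.AdjOnBoundary F a b) (hcon : (G.connecting F a b).Nonempty)
    (hsep : (G.separating F a b).Nonempty) (hS : G.IsBasin F a b S)
    (hfaces : ∀ f, G.IsFace f → f ≠ F → (G.boundaryVertices f).ncard ≤ N) :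
    ∃ Q Q', (G.IsCell F a S N Q ∧ ∃ c ∈ G.side γ (Ioo 0 t), ∃ v ∈ Q, G.Adj c v) ∧
      ReflTransGen (fun Q Q' => G.IsCell F a S N Q' ∧ (Q ∩ Q').Nonempty) Q Q' ∧
      ∃ d ∈ G.side γ (Ioo t 1), ∃ v ∈ Q', G.Adj v d := by
  obtain ⟨c, hc, d, hd, hcS, hcd⟩ := exists_shoreStep_chain h hab hcon hsep hS
  by_contra hdone
  have hsides : ∀ {x}, x ∈ G.boundaryVertices F → x ≠ a → x ≠ b →
      x ∈ G.side γ (Ioo 0 t) ∨ x ∈ G.side γ (Ioo t 1) := fun hx hxa hxb => by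
    rcases h.mem_boundaryVertices hx with hx | hx | hx | hx
    exacts [absurd hx hxa, absurd hx hxb, Or.inl hx, Or.inr hx]
  -- Invariant along the shore chain: the current vertex is on the first side, or it lies in the
  -- last cell of a chain that started there.
  suffices hs : d ∈ G.shore F a S ∧ (d ∈ G.side γ (Ioo 0 t) ∨ d ∉ G.boundaryVertices F ∧
      ∃ Q Q', (G.IsCell F a S N Q ∧ ∃ c ∈ G.side γ (Ioo 0 t), ∃ v ∈ Q, G.Adj c v) ∧
        ReflTransGen (fun Q Q' => G.IsCell F a S N Q' ∧ (Q ∩ Q').Nonempty) Q Q' ∧ d ∈ Q') by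
    rcases hs.2 with hd' | ⟨hd', -⟩
    · exact disjoint_left.1 h.disjoint_sides hd' hd
    · exact hd' (h.side_subset _ hd)
  clear hd
  induction hcd with
  | refl => exact ⟨hcS, Or.inl hc⟩
  | @tail w w' _ hr ih =>
    obtain ⟨hw'S, f, hf, hfF, hwf, hwf', -, hww⟩ := hr
    obtain ⟨hwS, ih⟩ := ih
    have hww' := reflTransGen_adj_symm (P := fun y => y ∈ G.boundaryVertices f ∧ y ≠ a ∧ y ≠ b)
      hww ⟨hwf, hS.ne_of_mem_shore hwS⟩
    refine ⟨hw'S, ?_⟩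
    have hboth : ∀ {x y}, x ∈ G.side γ (Ioo 0 t) → y ∈ G.side γ (Ioo t 1) →
        x ∈ G.boundaryVertices f → y ∈ G.boundaryVertices f → False :=
      fun hx hy hxf hyf => h.face_not_both_sides hcon hf hfF hx hy hxf hyf
    by_cases hw'F : w' ∈ G.boundaryVertices F
    · rcases hsides hw'F (hS.ne_of_mem_shore hw'S).1 (hS.ne_of_mem_shore hw'S).2 with h1 | h2
      · exact Or.inl h1
      · exfalso
        rcases ih with hw | ⟨hwF, Q, Q', hQ, hQQ', hwQ'⟩
        · exact hboth hw h2 hwf hwf'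
        · have hcell := isCell_cellAt (hfaces f hf hfF) hwf hwF hwS
          rcases mem_cellAt_or (F := F) hww with hmem | ⟨x, hx, hxf, hxa, hxb, y, hy, hyx⟩
          · rcases of_mem_cellAt hmem with rfl | hmem
            exacts [hwF hw'F, hmem.2 hw'F]
          · rcases hsides hx hxa hxb with hx1 | hx2
            · exact hboth hx1 h2 hxf hwf'
            · exact hdone ⟨Q, _, hQ, hQQ'.tail ⟨hcell, w, hwQ', mem_cellAt_self⟩, x, hx2, y, hy,
                hyx⟩
    · refine Or.inr ⟨hw'F, ?_⟩
      have hcell := isCell_cellAt (hfaces f hf hfF) hwf' hw'F hw'S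
      have hcell' : w ∉ G.boundaryVertices F → G.IsCell F a S N (G.cellAt F f w) :=
        fun hwF => isCell_cellAt (hfaces f hf hfF) hwf hwF hwS
      rcases mem_cellAt_or (F := F) hww' with hmem | ⟨x, hx, hxf, hxa, hxb, y, hy, hyx⟩
      · have hwF : w ∉ G.boundaryVertices F := by
          rcases of_mem_cellAt hmem with rfl | hmem
          exacts [hw'F, hmem.2]
        rcases ih with hw | ⟨-, Q, Q', hQ, hQQ', hwQ'⟩
        · exact absurd (h.side_subset _ hw) hwF
        · exact ⟨Q, _, hQ, hQQ'.tail ⟨hcell, w, hwQ', hmem⟩, mem_cellAt_self⟩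
      · rcases hsides hx hxa hxb with hx1 | hx2
        · exact ⟨_, _, ⟨hcell, x, hx1, y, hy, hyx.symm⟩, ReflTransGen.refl, mem_cellAt_self⟩
        · exfalso
          rcases ih with hw | ⟨hwF, Q, Q', hQ, hQQ', hwQ'⟩
          · exact hboth hw hx2 hwf hxf
          · rcases mem_cellAt_or (F := F) hww with hmem | ⟨x', hx', hxf', hxa', hxb', y', hy', hyx'⟩
            · have hmem' : w ∈ G.cellAt F f w' :=
                reflTransGen_adj_symm (P := fun y => y ∈ G.boundaryVertices f ∧
                  y ∉ G.boundaryVertices F) hmem ⟨hwf, hwF⟩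
              exact hdone ⟨Q, _, hQ, hQQ'.tail ⟨hcell, w, hwQ', hmem'⟩, x, hx2, y, hy, hyx⟩
            · rcases hsides hx' hxa' hxb' with hx1 | hx2'
              · exact hboth hx1 hx2 hxf' hxf
              · exact hdone ⟨Q, _, hQ, hQQ'.tail ⟨hcell' hwF, w, hwQ', mem_cellAt_self⟩, x', hx2',
                  y', hy', hyx'⟩

end PlaneGraph

/-! ### Shortest chains of cells. -/

namespace PlaneGraph

open Set Metric Relation

variable {V E : Type*} {G : PlaneGraph V E} {f F : Set ℂ} {a b c d u v w w' : V} {γ : ℝ → ℂ}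
  {t : ℝ} {S Q : Set V} {N n : ℕ}

variable (G) in
/-- A sequence of `n + 1` cells, consecutive ones with a common vertex, from the neighbours of `A`
to the neighbours of `B`. -/
structure IsCellChain (F : Set ℂ) (a : V) (S : Set V) (N : ℕ) (A B : Set V) (n : ℕ)
    (Q : ℕ → Set V) : Prop where
  isCell : ∀ i ≤ n, G.IsCell F a S N (Q i)
  start : ∃ c ∈ A, ∃ v ∈ Q 0, G.Adj c v
  finish : ∃ d ∈ B, ∃ v ∈ Q n, G.Adj v d
  overlap : ∀ i < n, (Q i ∩ Q (i + 1)).Nonempty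

theorem exists_isCellChain {A B Q' : Set V} (hQ : G.IsCell F a S N Q)
    (hstart : ∃ c ∈ A, ∃ v ∈ Q, G.Adj c v)
    (h : ReflTransGen (fun Q Q' => G.IsCell F a S N Q' ∧ (Q ∩ Q').Nonempty) Q Q')
    (hB : ∃ d ∈ B, ∃ v ∈ Q', G.Adj v d) : ∃ n C, G.IsCellChain F a S N A B n C := by
  suffices hs : ∃ (n : ℕ) (C : ℕ → Set V), C 0 = Q ∧ C n = Q' ∧
      (∀ i ≤ n, G.IsCell F a S N (C i)) ∧ ∀ i < n, (C i ∩ C (i + 1)).Nonempty by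
    obtain ⟨n, C, h0, hn, hC, ho⟩ := hs
    exact ⟨n, C, hC, h0 ▸ hstart, hn ▸ hB, ho⟩
  clear hB
  induction h with
  | refl => exact ⟨0, fun _ => Q, rfl, rfl, fun _ _ => hQ, by simp⟩
  | @tail Q₁ Q₂ _ hr ih =>
    obtain ⟨n, C, h0, hn, hC, ho⟩ := ih
    refine ⟨n + 1, fun i => if i ≤ n then C i else Q₂, by simpa using h0, by simp, ?_, ?_⟩
    · intro i hi
      by_cases h : i ≤ n
      · simpa [h] using hC i h
      · simpa [h] using hr.1
    · intro i hi
      rcases (Nat.lt_succ_iff.1 hi).eq_or_lt with rfl | h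
      · simpa [hn] using hr.2
      · simpa [h.le, Nat.succ_le_of_lt h] using ho i h

/-- In a shortest chain, only consecutive cells meet. -/
theorem exists_isCellChain_disjoint {A B : Set V} (h : ∃ n C, G.IsCellChain F a S N A B n C) :
    ∃ n C, G.IsCellChain F a S N A B n C ∧ ∀ i j, i + 2 ≤ j → j ≤ n → Disjoint (C i) (C j) := by
  classical
  obtain ⟨C, hC⟩ := Nat.find_spec h
  refine ⟨_, C, hC, fun i j hij hj => ?_⟩
  by_contra hcon
  obtain ⟨k, rfl⟩ := Nat.exists_eq_add_of_le hij
  obtain ⟨m, hm⟩ := Nat.exists_eq_add_of_le hj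
  -- If `C i` meets `C (i + 2 + k)`, the `k + 1` cells between them can be left out.
  refine Nat.find_min h (m := i + 1 + m) (by omega)
    ⟨fun l => if l ≤ i then C l else C (l + (k + 1)), ?_, ?_, ?_, ?_⟩
  · intro l hl
    by_cases h : l ≤ i
    · simpa [h] using hC.isCell l (by omega)
    · simpa [h] using hC.isCell (l + (k + 1)) (by omega)
  · simpa using hC.start
  · have := hC.finish
    rw [hm, show i + 2 + k + m = i + 1 + m + (k + 1) by omega] at this
    simpa [show ¬ i + 1 + m ≤ i by omega] using this
  · intro l hl
    rcases lt_trichotomy l i with h | rfl | h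
    · simpa [h.le, Nat.succ_le_of_lt h] using hC.overlap l (by omega)
    · rw [not_disjoint_iff_nonempty_inter] at hcon
      simpa [show l + 1 + (k + 1) = l + 2 + k by omega] using hcon
    · simpa [show ¬ l ≤ i by omega, show ¬ l + 1 ≤ i by omega,
        show l + 1 + (k + 1) = l + (k + 1) + 1 by omega] using hC.overlap (l + (k + 1)) (by omega)

theorem IsCell.reflTransGen (hQ : G.IsCell F a S N Q) (hv : v ∈ Q) (hw : w ∈ Q) :
    ReflTransGen (fun x y => G.Adj x y ∧ y ∈ Q) v w := by
  obtain ⟨x, hx, -, hx'⟩ := hQ.connected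
  exact (reflTransGen_adj_symm (hx' v hv) hx).trans (hx' w hw)

theorem IsCellChain.reflTransGen {A B : Set V} {C : ℕ → Set V}
    (hC : G.IsCellChain F a S N A B n C) : ∃ c ∈ A, ∃ d ∈ B,
      ReflTransGen (fun x y => G.Adj x y ∧ y ∈ {y | (∃ i ≤ n, y ∈ C i) ∨ y ∈ B}) c d := by
  obtain ⟨c, hc, v, hv, hcv⟩ := hC.start
  obtain ⟨d, hd, w, hw, hwd⟩ := hC.finish
  have hcell : ∀ i ≤ n, ∀ v ∈ C i, ∀ w ∈ C i,
      ReflTransGen (fun x y => G.Adj x y ∧ y ∈ {y | (∃ i ≤ n, y ∈ C i) ∨ y ∈ B}) v w :=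
    fun i hi v hv w hw => ReflTransGen.mono (fun _ _ h => ⟨h.1, Or.inl ⟨i, hi, h.2⟩⟩) _ _
      ((hC.isCell i hi).reflTransGen hv hw)
  have key : ∀ i ≤ n, ∀ w ∈ C i,
      ReflTransGen (fun x y => G.Adj x y ∧ y ∈ {y | (∃ i ≤ n, y ∈ C i) ∨ y ∈ B}) c w := by
    intro i
    induction i with
    | zero =>
      exact fun h0 w hw => (hcell 0 h0 v hv w hw).head ⟨hcv, Or.inl ⟨0, h0, hv⟩⟩
    | succ i ih =>
      intro hi w hw
      obtain ⟨x, hx, hx'⟩ := hC.overlap i hi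
      exact (ih (by omega) x hx).trans (hcell _ hi x hx' w hw)
  exact ⟨c, hc, d, hd, (key n le_rfl w hw).tail ⟨hwd, Or.inr hd⟩⟩

/-- A shortest chain from one side to the other carries a separating path. Its end on the second
side may be dropped from the sum because `ν` vanishes on `∂F`. -/
theorem exists_cells [Fintype V] [Finite E] (h : G.BoundaryParam F a b γ t)
    (hab : ¬ G.AdjOnBoundary F a b) (hcon : (G.connecting F a b).Nonempty)
    (hsep : (G.separating F a b).Nonempty) (hS : G.IsBasin F a b S)
    (hfaces : ∀ f, G.IsFace f → f ≠ F → (G.boundaryVertices f).ncard ≤ N) {ν : V → ℝ≥0}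
    (hν : IsAdmissible (G.separating F a b) (G.boundaryVertices F) ν) :
    ∃ (n : ℕ) (C : ℕ → Set V), (∀ i ≤ n, G.IsCell F a S N (C i)) ∧
      (∀ i j, i + 2 ≤ j → j ≤ n → Disjoint (C i) (C j)) ∧
      1 ≤ ∑ w, {w | ∃ i ≤ n, w ∈ C i}.indicator ν w := by
  obtain ⟨Q, Q', ⟨hQ, hstart⟩, hQQ', hfin⟩ := exists_linked_cells h hab hcon hsep hS hfaces
  obtain ⟨n, C, hC, hdis⟩ :=
    exists_isCellChain_disjoint (exists_isCellChain hQ hstart hQQ' hfin)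
  obtain ⟨c, hc, d, hd, hcd⟩ := hC.reflTransGen
  refine ⟨n, C, hC.isCell, hdis, (h.one_le_sum_indicator hν ?_ ?_ hc hd hcd).trans ?_⟩
  · rintro (⟨i, hi, ha⟩ | ha)
    · exact (hC.isCell i hi).disjoint a ha h.left_mem
    · exact (h.ne_of_mem_right ha).1 rfl
  · rintro (⟨i, hi, hb⟩ | hb)
    · exact (hC.isCell i hi).disjoint b hb h.right_mem
    · exact (h.ne_of_mem_right hb).2 rfl
  · refine Finset.sum_le_sum fun w _ => ?_
    refine indicator_apply_le fun hw => ?_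
    rcases hw with hw | hw
    · exact (indicator_of_mem (s := {w | ∃ i ≤ n, w ∈ C i}) hw ν).ge
    · exact (hν.2 w (h.side_subset _ hw)).trans_le zero_le

end PlaneGraph

/-! ### The distance from `a` and its sublevel sets. -/

namespace PlaneGraph

open Set Metric Relation

variable {V E : Type*} {G : PlaneGraph V E} {F : Set ℂ} {a b u v w : V} {μ : V → ℝ≥0} {l : List V}

variable (G) in
/-- The list `l` continues `a` to a path whose other vertices lie off the boundary of `F`. -/
def IsInnerPath (F : Set ℂ) (a : V) (l : List V) : Prop :=
  (a :: l).IsChain G.Adj ∧ ∀ w ∈ l, w ∉ G.boundaryVertices F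

variable (G) in
/-- The infimum of the lengths of the paths from `a` to `v` off the boundary of `F`. -/
noncomputable def potential (F : Set ℂ) (a : V) (μ : V → ℝ≥0) (v : V) : ℝ≥0∞ :=
  ⨅ (l : List V) (_ : G.IsInnerPath F a (l ++ [v])), (vertexLength μ (l ++ [v]) : ℝ≥0∞)

theorem vertexLength_append (l l' : List V) :
    vertexLength μ (l ++ l') = vertexLength μ l + vertexLength μ l' := by
  simp [vertexLength]

theorem vertexLength_singleton : vertexLength μ [v] = μ v := by
  simp [vertexLength]

theorem vertexLength_cons (l : List V) : vertexLength μ (v :: l) = μ v + vertexLength μ l := by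
  simp [vertexLength]

theorem potential_le (h : G.IsInnerPath F a (l ++ [v])) :
    G.potential F a μ v ≤ vertexLength μ (l ++ [v]) := iInf₂_le l h

theorem exists_of_potential_lt {r : ℝ≥0∞} (h : G.potential F a μ v < r) :
    ∃ l, G.IsInnerPath F a (l ++ [v]) ∧ (vertexLength μ (l ++ [v]) : ℝ≥0∞) < r := by
  simpa [potential, iInf_lt_iff] using h

theorem IsInnerPath.concat (h : G.IsInnerPath F a (l ++ [u])) (hv : v ∉ G.boundaryVertices F)
    (huv : G.Adj u v) : G.IsInnerPath F a (l ++ [u] ++ [v]) := by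
  refine ⟨h.1.append (List.isChain_singleton _) ?_, ?_⟩
  · rw [← List.cons_append, List.getLast?_concat]
    simpa using huv
  · intro w hw
    rcases List.mem_append.1 hw with hw | hw
    · exact h.2 w hw
    · rwa [List.mem_singleton.1 hw]

theorem potential_le_add (hv : v ∉ G.boundaryVertices F) (huv : G.Adj u v) :
    G.potential F a μ v ≤ G.potential F a μ u + μ v := by
  refine le_of_forall_gt fun r hr => ?_
  rw [potential, ENNReal.iInf_add] at hr
  obtain ⟨l, hl⟩ := iInf_lt_iff.1 hr
  rw [ENNReal.iInf_add] at hl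
  obtain ⟨h, hl⟩ := iInf_lt_iff.1 hl
  refine (potential_le (h.concat hv huv)).trans_lt ?_
  rw [vertexLength_append, vertexLength_singleton]
  exact_mod_cast hl

theorem potential_le_of_adj (hv : v ∉ G.boundaryVertices F) (hav : G.Adj a v) :
    G.potential F a μ v ≤ μ v := by
  have := potential_le (G := G) (F := F) (μ := μ) (a := a) (v := v) (l := [])
    ⟨by simpa using hav, by simpa using hv⟩
  simpa [vertexLength_singleton] using this

/-- `toReal` turns an infinite distance into 0. This is harmless here: off `∂F`, adjacent vertices
have both finite or both infinite distance. -/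
theorem toReal_potential_le (hu : u ∉ G.boundaryVertices F) (hv : v ∉ G.boundaryVertices F)
    (huv : G.Adj u v) :
    (G.potential F a μ v).toReal ≤ (G.potential F a μ u).toReal + μ v := by
  by_cases htop : G.potential F a μ u = ⊤
  · have : G.potential F a μ v = ⊤ := by
      have h := potential_le_add (a := a) (μ := μ) hu huv.symm
      rw [htop, top_le_iff, ENNReal.add_eq_top] at h
      exact h.resolve_right ENNReal.coe_ne_top
    simp [htop, this]
  · have := ENNReal.toReal_mono (ENNReal.add_ne_top.2 ⟨htop, ENNReal.coe_ne_top⟩)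
      (potential_le_add (a := a) (μ := μ) hv huv)
    rwa [ENNReal.toReal_add htop ENNReal.coe_ne_top, ENNReal.coe_toReal] at this

variable (G) in
/-- The end `a` and the vertices at distance less than `t` from it. -/
def sublevel (F : Set ℂ) (a : V) (μ : V → ℝ≥0) (t : ℝ) : Set V :=
  {v | v = a ∨ G.potential F a μ v < ENNReal.ofReal t}

/-- A short path to `v` has short initial pieces, hence connectedness. If some `v` were adjacent to
`b`, a connecting path of length less than 1 would arise. -/
theorem isBasin_sublevel (ha : a ∈ G.boundaryVertices F) (hb : b ∈ G.boundaryVertices F)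
    (hμ : IsAdmissible (G.connecting F a b) (G.boundaryVertices F) μ) {t : ℝ} (ht : t ≤ 1) :
    G.IsBasin F a b (G.sublevel F a μ t) := by
  refine ⟨Or.inl rfl, ?_, ?_, ?_⟩
  · rintro v (h | h) hv
    · exact h
    · obtain ⟨l, hl, -⟩ := exists_of_potential_lt h
      exact absurd hv (hl.2 v (by simp))
  · rintro v (rfl | h)
    · exact ReflTransGen.refl
    · obtain ⟨l, hl, hlt⟩ := exists_of_potential_lt h
      refine reflTransGen_of_isChain hl.1 (fun w hw => Or.inr ?_) v (by simp)
      obtain ⟨l₁, l₂, hl₁₂⟩ := List.append_of_mem hw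
      have e : l ++ [v] = (l₁ ++ [w]) ++ l₂ := by simp [hl₁₂]
      rw [e] at hl hlt
      refine (potential_le (l := l₁) ⟨?_, fun x hx => hl.2 x (List.mem_append_left _ hx)⟩).trans_lt
        (lt_of_le_of_lt ?_ hlt)
      · have := hl.1
        rw [← List.cons_append] at this
        exact this.left_of_append
      · rw [vertexLength_append (l₁ ++ [w])]
        exact_mod_cast le_self_add
  · rintro v (rfl | h) hvb
    · have := hμ.1 [v, b] ⟨ha, hb, by simpa using hvb, [], rfl, by simp⟩
      simp [vertexLength, hμ.2 v ha, hμ.2 b hb] at this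
    · obtain ⟨l, hl, hlt⟩ := exists_of_potential_lt h
      have := hμ.1 (a :: (l ++ [v] ++ [b])) ⟨ha, hb, by
        refine hl.1.append (List.isChain_singleton _) ?_
        rw [← List.cons_append, List.getLast?_concat]
        simpa using hvb, l ++ [v], rfl, hl.2⟩
      rw [vertexLength_cons, vertexLength_append (l ++ [v]), vertexLength_singleton, hμ.2 a ha,
        hμ.2 b hb, zero_add, add_zero] at this
      refine absurd hlt (not_lt.2 (le_trans ?_ (ENNReal.coe_le_coe.2 this)))
      simpa using ht

/-- The last step onto `w` crosses the level `t` and costs `μ w`. Each vertex off `∂F` is thus on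
the shore only for `t` in an interval of length `μ w`. -/
theorem potential_mem_of_sublevel {t : ℝ} (ht : 0 ≤ t) (hw : w ∉ G.sublevel F a μ t)
    (hwF : w ∉ G.boundaryVertices F) (hadj : ∃ u ∈ G.sublevel F a μ t, G.Adj u w) :
    (G.potential F a μ w).toReal - μ w ≤ t ∧ t ≤ (G.potential F a μ w).toReal := by
  have hle : G.potential F a μ w ≤ ENNReal.ofReal t + μ w := by
    obtain ⟨u, rfl | hu, huw⟩ := hadj
    · exact (potential_le_of_adj hwF huw).trans le_add_self
    · exact (potential_le_add hwF huw).trans (by gcongr)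
  have htop : ENNReal.ofReal t + μ w ≠ ⊤ := by simp
  have hge : ENNReal.ofReal t ≤ G.potential F a μ w := not_lt.1 fun h => hw (Or.inr h)
  constructor
  · have := ENNReal.toReal_mono htop hle
    rw [ENNReal.toReal_add (by simp) (by simp), ENNReal.toReal_ofReal ht] at this
    simpa using this
  · exact (ENNReal.ofReal_le_iff_le_toReal (ne_top_of_le_ne_top htop hle)).1 hge

end PlaneGraph

/-! ### Gaps between levels and intervals. -/

section Gap

open Relation

/-- The distance from `t` to the interval `[d - m, d]`. -/
noncomputable def gap (d m t : ℝ) : ℝ := max 0 (max (d - m - t) (t - d))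

variable {d m t : ℝ}

theorem gap_nonneg : 0 ≤ gap d m t := le_max_left _ _

theorem gap_eq_zero (h : d - m ≤ t) (h' : t ≤ d) : gap d m t = 0 :=
  max_eq_left (max_le (by linarith) (by linarith))

theorem continuous_gap : Continuous (gap d m) := by
  unfold gap
  fun_prop

theorem one_add_inv_pow_le {n : ℕ} (hn : 1 ≤ n) : (1 + (n : ℝ)⁻¹) ^ n ≤ 3 := by
  have hn' : (n : ℝ) ≠ 0 := by positivity
  calc (1 + (n : ℝ)⁻¹) ^ n ≤ Real.exp (n : ℝ)⁻¹ ^ n := by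
        gcongr
        linarith [Real.add_one_le_exp (n : ℝ)⁻¹]
    _ = Real.exp 1 := by rw [← Real.exp_nat_mul, mul_inv_cancel₀ hn']
    _ ≤ 3 := by linarith [Real.exp_one_lt_d9]

theorem exists_step_of_notMem {V : Type*} {r : V → V → Prop} {A : Set V} {v w : V}
    (h : ReflTransGen r v w) (hv : v ∈ A) (hw : w ∉ A) : ∃ x ∈ A, ∃ y ∉ A, r x y := by
  by_contra! hcon
  refine hw ?_
  clear hw
  induction h with
  | refl => exact hv
  | tail _ hr ih => exact by_contra fun hw => hcon _ ih _ hw hr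

variable {V : Type*} {r : V → V → Prop} {D M : V → ℝ} {Q : Finset V} {w₀ : V} {n : ℕ}

/-- In a connected set of at most `n + 1` vertices, one of whose intervals `[D v - M v, D v]`
contains `t`, the total gap is controlled by the part of `M` that exceeds the gaps. -/
theorem sum_gap_le (hM : ∀ v, 0 ≤ M v) (hr : ∀ x ∈ Q, ∀ y ∈ Q, r x y → D y ≤ D x + M y ∧
      D x ≤ D y + M x) (hw₀ : w₀ ∈ Q) (ht : D w₀ - M w₀ ≤ t) (ht' : t ≤ D w₀)
    (hQ : ∀ v ∈ Q, ReflTransGen (fun x y => r x y ∧ y ∈ Q) w₀ v) (hn : 1 ≤ n)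
    (hcard : Q.card ≤ n + 1) :
    ∑ v ∈ Q, gap (D v) (M v) t ≤
      2 * n * ∑ v ∈ Q, max 0 (M v - gap (D v) (M v) t / n) := by
  classical
  set δ : V → ℝ := fun v => gap (D v) (M v) t
  set Y : ℝ := ∑ v ∈ Q, max 0 (M v - δ v / n)
  have hY : 0 ≤ Y := Finset.sum_nonneg fun v _ => le_max_left _ _
  have hn' : (0 : ℝ) < n := by exact_mod_cast hn
  -- `Y` is the excess of `M` over the scaled gaps.
  have hsum : ∀ A ⊆ Q, ∑ v ∈ A, M v ≤ Y + (∑ v ∈ A, δ v) / n := by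
    intro A hA
    calc ∑ v ∈ A, M v ≤ ∑ v ∈ A, (max 0 (M v - δ v / n) + δ v / n) :=
          Finset.sum_le_sum fun v _ => by linarith [le_max_right 0 (M v - δ v / n)]
      _ = ∑ v ∈ A, max 0 (M v - δ v / n) + (∑ v ∈ A, δ v) / n := by
          rw [Finset.sum_add_distrib, Finset.sum_div]
      _ ≤ Y + (∑ v ∈ A, δ v) / n := by
          gcongr
          exact Finset.sum_le_sum_of_subset_of_nonneg hA fun v _ _ => le_max_left _ _
  -- `A` grows from `w₀` by one neighbour at a time. The gap of a new vertex is at most the mass of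
  -- `A`, so by `hsum` the total gap `Δ` becomes at most `Y + (1 + 1 / n) Δ`; the bound below solves
  -- this recursion. After at most `n` steps the power is at most 3, whence the factor `2 * n`.
  have key : ∀ k < Q.card, ∃ A ⊆ Q, A.card = k + 1 ∧ w₀ ∈ A ∧
      (∀ v ∈ A, D v - t ≤ ∑ u ∈ A, M u ∧ t - (D v - M v) ≤ ∑ u ∈ A, M u) ∧
      ∑ v ∈ A, δ v ≤ n * Y * ((1 + (n : ℝ)⁻¹) ^ k - 1) := by
    intro k
    induction k with
    | zero =>
      refine fun _ => ⟨{w₀}, by simpa using hw₀, by simp, by simp, ?_, ?_⟩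
      · simpa using ⟨by linarith, by linarith⟩
      · simp [δ, gap_eq_zero ht ht']
    | succ k ih =>
      intro hk
      obtain ⟨A, hAQ, hAk, hw₀A, hA, hδ⟩ := ih (by omega)
      obtain ⟨v', hv', hv'A⟩ : ∃ v ∈ Q, v ∉ A := by
        by_contra! hcon
        have := Finset.card_le_card hcon
        omega
      obtain ⟨u, hu, v, hv, huv, hvQ⟩ :=
        exists_step_of_notMem (A := (A : Set V)) (hQ v' hv') hw₀A hv'A
      obtain ⟨h1, h2⟩ := hr u (hAQ hu) v hvQ huv
      obtain ⟨h3, h4⟩ := hA u hu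
      have hvA : v ∉ A := hv
      have hMA : 0 ≤ ∑ u ∈ A, M u := Finset.sum_nonneg fun v _ => hM v
      have hδv : δ v ≤ ∑ u ∈ A, M u :=
        max_le hMA (max_le (by linarith) (by linarith))
      refine ⟨insert v A, Finset.insert_subset hvQ hAQ, by simp [hvA, hAk], by simp [hw₀A], ?_, ?_⟩
      · intro x hx
        rw [Finset.sum_insert hvA]
        rcases Finset.mem_insert.1 hx with rfl | hx
        · constructor <;> linarith
        · have := hA x hx
          have := hM v
          constructor <;> linarith
      · rw [Finset.sum_insert hvA]
        calc δ v + ∑ v ∈ A, δ v ≤ Y + (1 + (n : ℝ)⁻¹) * ∑ v ∈ A, δ v := by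
              have := hsum A hAQ
              rw [div_eq_inv_mul] at this
              linarith
          _ ≤ Y + (1 + (n : ℝ)⁻¹) * (n * Y * ((1 + (n : ℝ)⁻¹) ^ k - 1)) := by gcongr
          _ = n * Y * ((1 + (n : ℝ)⁻¹) ^ (k + 1) - 1) := by
              have hρ : (n : ℝ) * (1 + (n : ℝ)⁻¹) = n + 1 := by field_simp
              rw [pow_succ]
              linear_combination (-Y) * hρ
  have hpos : 0 < Q.card := Finset.card_pos.2 ⟨_, hw₀⟩
  obtain ⟨A, hAQ, hAk, -, -, hA⟩ := key (Q.card - 1) (by omega)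
  rw [← Finset.eq_of_subset_of_card_le hAQ (by omega)]
  have h3 : (1 + (n : ℝ)⁻¹) ^ (Q.card - 1) ≤ 3 :=
    (pow_le_pow_right₀ (by linarith [inv_pos.2 hn']) (by omega)).trans (one_add_inv_pow_le hn)
  refine hA.trans ?_
  nlinarith [mul_nonneg hn'.le hY]

/-- The integral of a trapezoidal bump is at most its width times its height. -/
theorem integral_max_sub_gap_le {x K : ℝ} (hm : 0 ≤ m) (hx : 0 ≤ x) (hK : 0 < K) :
    ∫ t in (0 : ℝ)..1, max 0 (x - gap d m t / K) ≤ x * m + K * x ^ 2 := by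
  have hderiv : ∀ c s : ℝ, HasDerivAt (fun t => max 0 (t - c) ^ 2 / 2) (max 0 (s - c)) s := by
    intro c s
    have hne : ∀ y ≠ c, HasDerivAt (fun t => max 0 (t - c) ^ 2 / 2) (max 0 (y - c)) y := by
      intro y hy
      rcases lt_or_gt_of_ne hy with hy | hy
      · rw [max_eq_left (by linarith)]
        refine (hasDerivAt_const y (0 : ℝ)).congr_of_eventuallyEq ?_
        filter_upwards [eventually_lt_nhds hy] with z hz
        rw [max_eq_left (by linarith)]
        norm_num
      · rw [max_eq_right (by linarith)]
        have := (((hasDerivAt_id y).sub_const c).pow 2).div_const 2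
        refine (this.congr_of_eventuallyEq ?_).congr_deriv (by simp)
        filter_upwards [eventually_gt_nhds hy] with z hz
        rw [max_eq_right (by linarith)]
        simp
    rcases eq_or_ne s c with rfl | hs
    · exact hasDerivAt_of_hasDerivAt_of_ne' hne (by fun_prop) (by fun_prop) s
    · exact hne s hs
  -- `h` is the trapezoid of height `x` over `[d - m, d]` with slopes `±1 / K`, written with four
  -- ramps, and `H` is its antiderivative, which increases from 0 to the total area `x m + K x²`.
  set H : ℝ → ℝ := fun t => (max 0 (t - (d - m - K * x)) ^ 2 / 2 - max 0 (t - (d - m)) ^ 2 / 2 -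
    max 0 (t - d) ^ 2 / 2 + max 0 (t - (d + K * x)) ^ 2 / 2) / K
  set h : ℝ → ℝ := fun t => (max 0 (t - (d - m - K * x)) - max 0 (t - (d - m)) -
    max 0 (t - d) + max 0 (t - (d + K * x))) / K
  have hH : ∀ t, HasDerivAt H (h t) t := fun t =>
    ((((hderiv _ t).sub (hderiv _ t)).sub (hderiv _ t)).add (hderiv _ t)).div_const K
  have hc : Continuous h := by fun_prop
  have hKx : 0 ≤ K * x := by positivity
  have hle : ∀ t, max 0 (x - gap d m t / K) ≤ h t := by
    intro t
    have e : max 0 (x - gap d m t / K) = max 0 (K * x - gap d m t) / K := by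
      rw [← max_div_div_right hK.le, zero_div, sub_div, mul_div_cancel_left₀ _ hK.ne']
    rw [e]
    refine div_le_div_of_nonneg_right ?_ hK.le
    unfold gap
    rcases max_cases 0 (t - (d - m - K * x)) with h1 | h1 <;>
    rcases max_cases 0 (t - (d - m)) with h2 | h2 <;>
    rcases max_cases 0 (t - d) with h3 | h3 <;>
    rcases max_cases 0 (t - (d + K * x)) with h4 | h4 <;>
    rw [h1.1, h2.1, h3.1, h4.1] <;>
    refine max_le (by linarith) ?_ <;>
    linarith [le_max_left 0 (max (d - m - t) (t - d)), le_max_right 0 (max (d - m - t) (t - d)),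
      le_max_left (d - m - t) (t - d), le_max_right (d - m - t) (t - d)]
  calc ∫ t in (0 : ℝ)..1, max 0 (x - gap d m t / K) ≤ ∫ t in (0 : ℝ)..1, h t := by
        refine intervalIntegral.integral_mono_on zero_le_one ?_ (hc.intervalIntegrable _ _)
          fun t _ => hle t
        exact (continuous_const.max (continuous_const.sub
          (continuous_gap.div_const K))).intervalIntegrable _ _
    _ = H 1 - H 0 :=
        intervalIntegral.integral_eq_sub_of_hasDerivAt (fun t _ => hH t) (hc.intervalIntegrable _ _)
    _ ≤ x * m + K * x ^ 2 := by
        have hb : ∀ t, 0 ≤ H t ∧ H t ≤ x * m + K * x ^ 2 := by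
          intro t
          have e : x * m + K * x ^ 2 = (K * x * m + (K * x) ^ 2) / K := by
            field_simp
          rw [e]
          simp only [H]
          rw [div_le_div_iff_of_pos_right hK]
          generalize K * x = k at hKx ⊢
          suffices hs : 0 ≤ max 0 (t - (d - m - k)) ^ 2 / 2 - max 0 (t - (d - m)) ^ 2 / 2 -
              max 0 (t - d) ^ 2 / 2 + max 0 (t - (d + k)) ^ 2 / 2 ∧
              max 0 (t - (d - m - k)) ^ 2 / 2 - max 0 (t - (d - m)) ^ 2 / 2 -
              max 0 (t - d) ^ 2 / 2 + max 0 (t - (d + k)) ^ 2 / 2 ≤ k * m + k ^ 2 from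
            ⟨div_nonneg hs.1 hK.le, hs.2⟩
          have hkm := mul_nonneg hKx hm
          rcases max_cases 0 (t - (d - m - k)) with h1 | h1 <;>
          rcases max_cases 0 (t - (d - m)) with h2 | h2 <;>
          rcases max_cases 0 (t - d) with h3 | h3 <;>
          rcases max_cases 0 (t - (d + k)) with h4 | h4 <;>
          rw [h1.1, h2.1, h3.1, h4.1] <;>
          first
          | exfalso; linarith
          | constructor <;> nlinarith
        linarith [(hb 0).1, (hb 1).2]

end Gap

/-! ### Integration over the levels and choice of the scale `K`. -/

section Levels

variable {V : Type*} [Fintype V] {D M X : V → ℝ} {K L C : ℝ}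

theorem one_le_of_forall_level (hM : ∀ w, 0 ≤ M w) (hX : ∀ w, 0 ≤ X w) (hK : 0 < K) (hL : 0 < L)
    (hC : 0 ≤ C) (h : ∀ t ∈ Set.Ioo (0 : ℝ) 1, 1 ≤ ∑ w, max 0 (X w - gap (D w) (M w) t / K) +
      C * ∑ w, max 0 (M w - gap (D w) (M w) t / L)) :
    1 ≤ ∑ w, (X w * M w + K * X w ^ 2) + C * ∑ w, (M w * M w + L * M w ^ 2) := by
  have hc : ∀ (x d m K : ℝ), Continuous fun t => max 0 (x - gap d m t / K) := fun x d m K =>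
    continuous_const.max (continuous_const.sub (continuous_gap.div_const K))
  have hi : ∀ (x d m K : ℝ), IntervalIntegrable (fun t => max 0 (x - gap d m t / K))
      MeasureTheory.volume 0 1 := fun x d m K => (hc x d m K).intervalIntegrable _ _
  have hcs : ∀ (Y : V → ℝ) (K : ℝ), Continuous fun t =>
      ∑ w, max 0 (Y w - gap (D w) (M w) t / K) := fun Y K =>
    continuous_finsetSum _ fun w _ => hc _ _ _ _
  have hint : ∀ (Y : V → ℝ) (K : ℝ), (∀ w, 0 ≤ Y w) → 0 < K →
      ∫ t in (0 : ℝ)..1, ∑ w, max 0 (Y w - gap (D w) (M w) t / K) ≤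
        ∑ w, (Y w * M w + K * Y w ^ 2) := by
    intro Y K hY hK
    rw [intervalIntegral.integral_finsetSum fun w _ => hi _ _ _ _]
    exact Finset.sum_le_sum fun w _ => integral_max_sub_gap_le (hM w) (hY w) hK
  calc (1 : ℝ) = ∫ t in (0 : ℝ)..1, (1 : ℝ) := by simp
    _ ≤ ∫ t in (0 : ℝ)..1, (∑ w, max 0 (X w - gap (D w) (M w) t / K) +
          C * ∑ w, max 0 (M w - gap (D w) (M w) t / L)) :=
        intervalIntegral.integral_mono_on_of_le_Ioo zero_le_one
          (continuous_const.intervalIntegrable _ _)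
          (((hcs X K).add ((hcs M L).const_mul C)).intervalIntegrable _ _) h
    _ = (∫ t in (0 : ℝ)..1, ∑ w, max 0 (X w - gap (D w) (M w) t / K)) +
          C * ∫ t in (0 : ℝ)..1, ∑ w, max 0 (M w - gap (D w) (M w) t / L) := by
        rw [intervalIntegral.integral_add ((hcs X K).intervalIntegrable _ _)
          (((hcs M L).const_mul C).intervalIntegrable _ _), intervalIntegral.integral_const_mul]
    _ ≤ _ := by
        gcongr
        · exact hint X K hX hK
        · exact hint M L hM hL

/-- Let `K` tend to 0. -/
theorem one_le_mul_of_forall_le {s A B : ℝ} (hB : 0 ≤ B) (hs : s ^ 2 ≤ A * B)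
    (h : ∀ K > 0, 1 ≤ s + K * B) : 1 ≤ A * B := by
  have h1 : 1 ≤ s := by
    refine le_of_forall_pos_le_add fun ε hε => ?_
    refine (h (ε / (B + 1)) (by positivity)).trans ?_
    gcongr
    rw [div_mul_eq_mul_div, div_le_iff₀ (by positivity)]
    nlinarith
  nlinarith

theorem one_le_sq_mul_of_forall_le {s A B N : ℝ} (hA : 0 ≤ A) (hB : 0 ≤ B) (hs : s ^ 2 ≤ A * B)
    (hN : 1 ≤ N) (h : ∀ K > 0, 1 ≤ s + K * B + 4 * (N - 1) / K * (N * A)) :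
    1 ≤ (4 * N + 1) ^ 2 * (A * B) := by
  rcases hA.eq_or_lt with rfl | hA
  · have hs0 : s = 0 := by nlinarith
    have := h (1 / (2 * (B + 1))) (by positivity)
    rw [hs0, mul_zero, mul_zero, add_zero, zero_add, div_mul_eq_mul_div,
      le_div_iff₀ (by positivity)] at this
    linarith
  rcases hB.eq_or_lt with rfl | hB
  · have hs0 : s = 0 := by nlinarith
    have hc : 0 ≤ 4 * (N - 1) * (N * A) := by
      have : 0 ≤ N - 1 := by linarith
      positivity
    have := h (4 * (N - 1) * (N * A) + 1) (by positivity)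
    rw [hs0, mul_zero, add_zero, zero_add, div_mul_eq_mul_div, le_div_iff₀ (by positivity)] at this
    linarith
  obtain ⟨x, hx, rfl⟩ : ∃ x, 0 < x ∧ A = x ^ 2 := ⟨√A, by positivity, (Real.sq_sqrt hA.le).symm⟩
  obtain ⟨y, hy, rfl⟩ : ∃ y, 0 < y ∧ B = y ^ 2 := ⟨√B, by positivity, (Real.sq_sqrt hB.le).symm⟩
  have hsxy : s ≤ x * y := by
    rw [← mul_pow] at hs
    exact (abs_le_of_sq_le_sq' hs (by positivity)).2
  have hN0 : 0 < N := by linarith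
  -- With this `K` the error terms become `2 N x y` and `2 (N - 1) x y`; together with `s ≤ x y` the
  -- sum is at most `(4 N - 1) x y`.
  have := h (2 * N * x / y) (by positivity)
  have e1 : 2 * N * x / y * y ^ 2 = 2 * N * (x * y) := by field_simp
  have e2 : 4 * (N - 1) / (2 * N * x / y) * (N * x ^ 2) = 2 * (N - 1) * (x * y) := by
    field_simp
    ring
  rw [e1, e2] at this
  have h1 : 1 ≤ (4 * N + 1) * (x * y) := by nlinarith [mul_pos hx hy]
  nlinarith

end Levels

theorem sum_indicator_le_two_mul {V : Type*} {C : ℕ → Set V} {n : ℕ}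
    (hC : ∀ i j, i + 2 ≤ j → j ≤ n → Disjoint (C i) (C j)) {y : V → ℝ} {w : V} (hy : 0 ≤ y w) :
    ∑ i ∈ Finset.range (n + 1), (C i).indicator y w ≤ 2 * y w := by
  classical
  simp only [Set.indicator_apply]
  rw [← Finset.sum_filter, Finset.sum_const, nsmul_eq_mul]
  gcongr
  set T := (Finset.range (n + 1)).filter fun i => w ∈ C i
  have hT : T.card ≤ 2 := by
    rcases T.eq_empty_or_nonempty with hT | hT
    · simp [hT]
    -- Only the first cell that contains `w` and the next one can contain it.
    · refine (Finset.card_le_card (t := {T.min' hT, T.min' hT + 1}) fun i hi => ?_).trans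
        Finset.card_le_two
      have h1 := Finset.min'_le T i hi
      have h2 := Finset.mem_filter.1 (T.min'_mem hT)
      have h3 := Finset.mem_filter.1 hi
      have : ¬ T.min' hT + 2 ≤ i := fun h =>
        Set.disjoint_left.1 (hC _ _ h (Nat.lt_succ_iff.1 (Finset.mem_range.1 h3.1))) h2.2 h3.2
      simp only [Finset.mem_insert, Finset.mem_singleton]
      omega
  exact_mod_cast hT

/-! ### The lower bounds for the product of areas. -/

namespace PlaneGraph

open Set Relation

variable {V E : Type*} [Fintype V] [Finite E] {G : PlaneGraph V E} {F : Set ℂ} {a b : V}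
  {γ : ℝ → ℂ} {s : ℝ} {N : ℕ} {μ ν : V → ℝ≥0}

omit [Fintype V] [Finite E] in
theorem potential_mem_of_mem_shore {w : V} {t : ℝ} (ht : 0 ≤ t)
    (hS : G.IsBasin F a b (G.sublevel F a μ t)) (hw : w ∈ G.shore F a (G.sublevel F a μ t))
    (hwF : w ∉ G.boundaryVertices F) :
    (G.potential F a μ w).toReal - μ w ≤ t ∧ t ≤ (G.potential F a μ w).toReal :=
  potential_mem_of_sublevel ht (hS.notMem_of_mem_farSide hw.1) hwF hw.2

theorem one_le_vertexArea_mul (h : G.BoundaryParam F a b γ s)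
    (hab : ¬ G.AdjOnBoundary F a b) (hcon : (G.connecting F a b).Nonempty)
    (hsep : (G.separating F a b).Nonempty)
    (hfaces : ∀ f, G.IsFace f → f ≠ F → (G.boundaryVertices f).ncard ≤ 3)
    (hμ : IsAdmissible (G.connecting F a b) (G.boundaryVertices F) μ)
    (hν : IsAdmissible (G.separating F a b) (G.boundaryVertices F) ν) :
    1 ≤ vertexArea μ * vertexArea ν := by
  have key : ∀ K : ℝ, 0 < K → 1 ≤ ∑ w, ((ν w : ℝ) * μ w) + K * ∑ w, (ν w : ℝ) ^ 2 := by
    intro K hK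
    -- Shore vertices have gap 0 or `ν w = 0`, so no correction is needed: `C = 0`, and the value of
    -- `L` is immaterial.
    have := one_le_of_forall_level (D := fun w => (G.potential F a μ w).toReal)
      (M := fun w => (μ w : ℝ)) (X := fun w => (ν w : ℝ)) (K := K) (L := 1) (C := 0)
      (fun w => (μ w).2) (fun w => (ν w).2) hK one_pos le_rfl ?_
    · simpa [Finset.sum_add_distrib, Finset.mul_sum] using this
    · intro t ht
      have hS := isBasin_sublevel h.left_mem h.right_mem hμ ht.2.le
      have h1 : (1 : ℝ) ≤ ∑ w, ((G.shore F a (G.sublevel F a μ t)).indicator ν w : ℝ≥0) := by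
        exact_mod_cast one_le_sum_shore h hab hcon hsep hS hfaces hν
      rw [NNReal.coe_sum] at h1
      rw [zero_mul, add_zero]
      refine h1.trans (Finset.sum_le_sum fun w _ => ?_)
      by_cases hw : w ∈ G.shore F a (G.sublevel F a μ t)
      · rw [indicator_of_mem hw]
        by_cases hwF : w ∈ G.boundaryVertices F
        · simp [hν.2 w hwF]
        · obtain ⟨h1, h2⟩ := potential_mem_of_mem_shore ht.1.le hS hw hwF
          simp [gap_eq_zero h1 h2]
      · simp [indicator_of_notMem hw]
  have hcs := Finset.sum_mul_sq_le_sq_mul_sq Finset.univ (fun w => (μ w : ℝ)) fun w => (ν w : ℝ)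
  simp only [mul_comm (ν _ : ℝ)] at key
  have := one_le_mul_of_forall_le (by positivity) hcs key
  rw [← NNReal.coe_le_coe]
  simpa [vertexArea] using this

theorem one_le_sq_mul_vertexArea_mul (h : G.BoundaryParam F a b γ s)
    (hab : ¬ G.AdjOnBoundary F a b) (hcon : (G.connecting F a b).Nonempty)
    (hsep : (G.separating F a b).Nonempty) (hN : 2 ≤ N)
    (hfaces : ∀ f, G.IsFace f → f ≠ F → (G.boundaryVertices f).ncard ≤ N)
    (hμ : IsAdmissible (G.connecting F a b) (G.boundaryVertices F) μ)
    (hν : IsAdmissible (G.separating F a b) (G.boundaryVertices F) ν) :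
    1 ≤ (4 * (N : ℝ≥0) + 1) ^ 2 * (vertexArea μ * vertexArea ν) := by
  classical
  obtain ⟨n, rfl⟩ := Nat.exists_eq_add_of_le' (show 1 ≤ N by omega)
  have hn : 1 ≤ n := by omega
  have hn' : (0 : ℝ) < n := by exact_mod_cast hn
  have key : ∀ K : ℝ, 0 < K → 1 ≤ ∑ w, ((μ w : ℝ) * ν w) + K * ∑ w, (ν w : ℝ) ^ 2 +
      4 * (((n + 1 : ℕ) : ℝ) - 1) / K * (((n + 1 : ℕ) : ℝ) * ∑ w, (μ w : ℝ) ^ 2) := by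
    intro K hK
    -- `L = n` is the scale of `sum_gap_le` for cells of at most `n + 1` vertices. In `C` a factor
    -- `2 n` comes from that lemma, and a factor 2 from the overlap of consecutive cells.
    have := one_le_of_forall_level (D := fun w => (G.potential F a μ w).toReal)
      (M := fun w => (μ w : ℝ)) (X := fun w => (ν w : ℝ)) (K := K) (L := n) (C := 4 * n / K)
      (fun w => (μ w).2) (fun w => (ν w).2) hK hn' (by positivity) ?_
    · refine this.trans_eq ?_
      simp only [Finset.sum_add_distrib, ← Finset.mul_sum, mul_comm (ν _ : ℝ), ← pow_two]
      push_cast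
      ring
    · intro t ht
      set δ : V → ℝ := fun w => gap (G.potential F a μ w).toReal (μ w) t
      set y : V → ℝ := fun w => max 0 ((μ w : ℝ) - δ w / n)
      have hδ : ∀ w, 0 ≤ δ w := fun w => gap_nonneg
      have hy : ∀ w, 0 ≤ y w := fun w => le_max_left _ _
      have hS := isBasin_sublevel h.left_mem h.right_mem hμ ht.2.le
      obtain ⟨m, C, hC, hdis, h1⟩ := exists_cells h hab hcon hsep hS hfaces hν
      have hcell : ∀ i ≤ m, ∑ w, (C i).indicator δ w ≤ 2 * n * ∑ w, (C i).indicator y w := by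
        intro i hi
        obtain ⟨w₀, hw₀, hw₀S, hconn⟩ := (hC i hi).connected
        obtain ⟨ht1, ht2⟩ := potential_mem_of_mem_shore ht.1.le hS hw₀S ((hC i hi).disjoint w₀ hw₀)
        have := sum_gap_le (r := G.Adj) (Q := (C i).toFinset) (M := fun w => (μ w : ℝ))
          (D := fun w => (G.potential F a μ w).toReal) (n := n) (fun w => (μ w).2)
          (fun u hu v hv huv => ⟨toReal_potential_le ((hC i hi).disjoint u (mem_toFinset.1 hu))
            ((hC i hi).disjoint v (mem_toFinset.1 hv)) huv,
            toReal_potential_le ((hC i hi).disjoint v (mem_toFinset.1 hv))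
            ((hC i hi).disjoint u (mem_toFinset.1 hu)) huv.symm⟩) (mem_toFinset.2 hw₀) ht1 ht2
          (by simpa using hconn) hn (by rw [← ncard_eq_toFinset_card']; exact (hC i hi).ncard_le)
        rw [← Finset.sum_indicator_subset _ (Finset.subset_univ (C i).toFinset),
          ← Finset.sum_indicator_subset _ (Finset.subset_univ (C i).toFinset)] at this
        simpa using this
      set U : Set V := {w | ∃ i ≤ m, w ∈ C i}
      have h1 : (1 : ℝ) ≤ ∑ w, (U.indicator ν w : ℝ≥0) := by exact_mod_cast h1
      rw [NNReal.coe_sum] at h1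
      -- On the cells `ν` is split into the part that exceeds `δ / K`, whose integral is small, and
      -- `δ / K`, which is controlled cell by cell.
      have hU : ∀ w, ((U.indicator ν w : ℝ≥0) : ℝ) ≤ max 0 ((ν w : ℝ) - δ w / K) +
          (∑ i ∈ Finset.range (m + 1), (C i).indicator δ w) / K := by
        intro w
        by_cases hw : w ∈ U
        · obtain ⟨i, hi, hwi⟩ := id hw
          rw [indicator_of_mem hw]
          have h2 : δ w ≤ ∑ i ∈ Finset.range (m + 1), (C i).indicator δ w := by
            refine le_trans ?_ (Finset.single_le_sum (f := fun i => (C i).indicator δ w)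
              (fun i _ => indicator_nonneg (fun w _ => hδ w) w)
              (Finset.mem_range.2 (Nat.lt_succ_of_le hi)))
            simp [hwi]
          have h3 : δ w / K ≤ (∑ i ∈ Finset.range (m + 1), (C i).indicator δ w) / K := by gcongr
          linarith [le_max_right 0 ((ν w : ℝ) - δ w / K)]
        · rw [indicator_of_notMem hw]
          have : 0 ≤ ∑ i ∈ Finset.range (m + 1), (C i).indicator δ w :=
            Finset.sum_nonneg fun i _ => indicator_nonneg (fun w _ => hδ w) w
          have h3 : 0 ≤ max 0 ((ν w : ℝ) - δ w / K) := le_max_left _ _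
          simp only [NNReal.coe_zero]
          positivity
      calc (1 : ℝ) ≤ ∑ w, (max 0 ((ν w : ℝ) - δ w / K) +
            (∑ i ∈ Finset.range (m + 1), (C i).indicator δ w) / K) :=
            h1.trans (Finset.sum_le_sum fun w _ => hU w)
        _ = ∑ w, max 0 ((ν w : ℝ) - δ w / K) +
            (∑ i ∈ Finset.range (m + 1), ∑ w, (C i).indicator δ w) / K := by
            rw [Finset.sum_add_distrib, Finset.sum_comm, Finset.sum_div]
        _ ≤ ∑ w, max 0 ((ν w : ℝ) - δ w / K) +
            (∑ i ∈ Finset.range (m + 1), 2 * n * ∑ w, (C i).indicator y w) / K := by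
            gcongr with i hi
            exact hcell i (Nat.lt_succ_iff.1 (Finset.mem_range.1 hi))
        _ = ∑ w, max 0 ((ν w : ℝ) - δ w / K) +
            (2 * n * ∑ w, ∑ i ∈ Finset.range (m + 1), (C i).indicator y w) / K := by
            rw [← Finset.mul_sum, Finset.sum_comm]
        _ ≤ ∑ w, max 0 ((ν w : ℝ) - δ w / K) + (2 * n * ∑ w, 2 * y w) / K := by
            gcongr with w
            exact sum_indicator_le_two_mul hdis (hy w)
        _ = ∑ w, max 0 ((ν w : ℝ) - δ w / K) + 4 * n / K * ∑ w, y w := by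
            rw [← Finset.mul_sum]
            ring
  have hcs := Finset.sum_mul_sq_le_sq_mul_sq Finset.univ (fun w => (μ w : ℝ)) fun w => (ν w : ℝ)
  have := one_le_sq_mul_of_forall_le (N := ((n + 1 : ℕ) : ℝ)) (by positivity) (by positivity) hcs
    (by push_cast; linarith) key
  rw [← NNReal.coe_le_coe]
  simpa [vertexArea] using this

end PlaneGraph

/-! ### Extremal metrics and the upper bound. -/

section ExtremalWidth

variable {V : Type*} [Fintype V] {Γ : Set (List V)} {W : Set V} {μ ν : V → ℝ≥0}

theorem coe_vertexLength {V : Type*} (μ : V → ℝ≥0) (p : List V) :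
    (vertexLength μ p : ℝ) = (p.map fun v => (μ v : ℝ)).sum := by
  simp [vertexLength, NNReal.coe_list_sum, Function.comp_def]

/-- The variational inequality for the admissible metric of least area. -/
theorem exists_isAdmissible_forall_le (h : ∃ μ, IsAdmissible Γ W μ) :
    ∃ μ, IsAdmissible Γ W μ ∧ ∀ ν, IsAdmissible Γ W ν → vertexArea μ ≤ ∑ v, μ v * ν v := by
  set K : Set (EuclideanSpace ℝ V) :=
    {x | (∀ v, 0 ≤ x v) ∧ (∀ p ∈ Γ, 1 ≤ (p.map fun v => x v).sum) ∧ ∀ v ∈ W, x v = 0}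
  have hmem : ∀ μ : V → ℝ≥0, IsAdmissible Γ W μ → WithLp.toLp 2 (fun v => (μ v : ℝ)) ∈ K := by
    intro μ hμ
    refine ⟨fun v => (μ v).2, fun p hp => ?_, fun v hv => by simp [hμ.2 v hv]⟩
    have := NNReal.coe_le_coe.2 (hμ.1 p hp)
    rwa [coe_vertexLength] at this
  have hcont : ∀ v, Continuous fun x : EuclideanSpace ℝ V => x v := fun v => by fun_prop
  have hlist : ∀ p : List V, Continuous fun x : EuclideanSpace ℝ V => (p.map fun v => x v).sum :=
    fun p => continuous_list_sum p fun v _ => hcont v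
  have hclosed : IsClosed K := by
    simp only [K, Set.ofPred_and, Set.ofPred_forall]
    refine (isClosed_iInter fun v => isClosed_le continuous_const (hcont v)).inter
      ((isClosed_iInter fun p => isClosed_iInter fun _ => isClosed_le continuous_const
        (hlist p)).inter
      (isClosed_iInter fun v => isClosed_iInter fun _ => isClosed_eq (hcont v) continuous_const))
  have hconv : Convex ℝ K := by
    intro x hx y hy s t hs ht hst
    refine ⟨fun v => ?_, fun p hp => ?_, fun v hv => ?_⟩
    · have := hx.1 v
      have := hy.1 v
      simp only [PiLp.add_apply, PiLp.smul_apply, smul_eq_mul]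
      positivity
    · have e : (p.map fun v => (s • x + t • y) v).sum =
          s * (p.map fun v => x v).sum + t * (p.map fun v => y v).sum := by
        simp [List.sum_map_add, List.sum_map_mul_left]
      rw [e]
      nlinarith [hx.2.1 p hp, hy.2.1 p hp]
    · simp [hx.2.2 v hv, hy.2.2 v hv]
  obtain ⟨ν₀, hν₀⟩ := h
  -- The admissible metrics form a closed convex set. Its point nearest to the origin is
  -- characterized by an obtuse angle condition, which is the claimed inequality.
  obtain ⟨x, hx, hmin⟩ := exists_norm_eq_iInf_of_complete_convex ⟨_, hmem ν₀ hν₀⟩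
    hclosed.isComplete hconv 0
  rw [norm_eq_iInf_iff_real_inner_le_zero hconv hx] at hmin
  obtain ⟨μ, hμ⟩ : ∃ μ : V → ℝ≥0, ∀ v, (μ v : ℝ) = x v :=
    ⟨fun v => (x v).toNNReal, fun v => Real.coe_toNNReal _ (hx.1 v)⟩
  refine ⟨μ, ⟨fun p hp => ?_, fun v hv => ?_⟩, fun ν hν => ?_⟩
  · rw [← NNReal.coe_le_coe, coe_vertexLength]
    simpa only [hμ, NNReal.coe_one] using hx.2.1 p hp
  · rw [← NNReal.coe_inj, hμ, hx.2.2 v hv, NNReal.coe_zero]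
  · have := hmin _ (hmem ν hν)
    rw [zero_sub, inner_neg_left, inner_sub_right, neg_nonpos, sub_nonneg] at this
    simp only [PiLp.inner_apply, RCLike.inner_apply, conj_trivial, ← hμ] at this
    rw [← NNReal.coe_le_coe]
    simpa [vertexArea, pow_two, mul_comm] using this

/-- From `|μ|² ≤ ⟨μ, ν⟩` and `0 ≤ |μ - ν|²` follows `|μ|² ≤ |ν|²`. -/
theorem extremalWidth_eq (hμ : IsAdmissible Γ W μ)
    (h : ∀ ν, IsAdmissible Γ W ν → vertexArea μ ≤ ∑ v, μ v * ν v) :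
    extremalWidth Γ W = vertexArea μ := by
  refine le_antisymm (iInf₂_le μ hμ) (le_iInf₂ fun ν hν => ?_)
  rw [ENNReal.coe_le_coe]
  have h1 := NNReal.coe_le_coe.2 (h ν hν)
  have h2 : 0 ≤ ∑ v, ((μ v : ℝ) - ν v) ^ 2 := Finset.sum_nonneg fun v _ => sq_nonneg _
  have h3 : ∑ v, ((μ v : ℝ) - ν v) ^ 2 =
      ∑ v, (μ v : ℝ) ^ 2 + ∑ v, (ν v : ℝ) ^ 2 - 2 * ∑ v, (μ v : ℝ) * ν v := by
    rw [Finset.mul_sum, ← Finset.sum_add_distrib, ← Finset.sum_sub_distrib]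
    exact Finset.sum_congr rfl fun v _ => by ring
  rw [← NNReal.coe_le_coe]
  simp only [vertexArea, NNReal.coe_sum, NNReal.coe_pow, NNReal.coe_mul] at h1 ⊢
  linarith

theorem vertexArea_ne_zero (hΓ : Γ.Nonempty) (hμ : IsAdmissible Γ W μ) : vertexArea μ ≠ 0 := by
  intro h
  obtain ⟨p, hp⟩ := hΓ
  have h0 : μ = fun _ => 0 := funext (by simpa [vertexArea, Finset.sum_eq_zero_iff] using h)
  have := hμ.1 p hp
  simp [vertexLength, h0] at this

omit [Fintype V] in
theorem one_le_vertexLength_indicator {U : Set V} {p : List V} {v : V} (hv : v ∈ p) (hvU : v ∈ U) :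
    1 ≤ vertexLength (U.indicator 1) p := by
  have := List.single_le_sum (l := p.map (U.indicator (1 : V → ℝ≥0))) (fun _ _ => zero_le) _
    (List.mem_map_of_mem hv)
  simpa [vertexLength, hvU] using this

theorem sum_mul_indicator_le_vertexLength {p : List V} {U : Set V} (hU : ∀ v ∈ U, v ∈ p) :
    ∑ v, μ v * U.indicator 1 v ≤ vertexLength μ p := by
  classical
  calc ∑ v, μ v * U.indicator 1 v ≤ ∑ v ∈ p.toFinset, μ v := by
        rw [← Finset.sum_subset (Finset.subset_univ p.toFinset) fun v _ hv => ?_]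
        · refine Finset.sum_le_sum fun v _ => ?_
          by_cases hv : v ∈ U <;> simp [hv]
        · have : v ∉ U := fun h => hv (List.mem_toFinset.2 (hU v h))
          simp [this]
    _ = (p.dedup.map μ).sum := by
        rw [← List.sum_toFinset μ p.nodup_dedup]
        congr 1
        ext v
        simp
    _ ≤ vertexLength μ p :=
        ((List.dedup_sublist p).map μ).sum_le_sum fun _ _ => zero_le

/-- If any two paths of the families have a common vertex off `W`, then the product of the extremal
widths is at most one. -/
theorem exists_isAdmissible_mul_le_one {Γ' : Set (List V)} (hΓ : Γ.Nonempty)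
    (h : ∀ p ∈ Γ, ∀ q ∈ Γ', ∃ v ∈ p, v ∈ q ∧ v ∉ W) (hμ : IsAdmissible Γ W μ)
    (hmin : ∀ ν, IsAdmissible Γ W ν → vertexArea μ ≤ ∑ v, μ v * ν v) :
    ∃ ν, IsAdmissible Γ' W ν ∧ vertexArea μ * vertexArea ν = 1 := by
  have h0 := vertexArea_ne_zero hΓ hμ
  refine ⟨fun v => μ v / vertexArea μ, ⟨fun q hq => ?_, fun v hv => by simp [hμ.2 v hv]⟩, ?_⟩
  -- Every path in `Γ` meets `q` off `W`, so this indicator may be used in `hmin`; it gives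
  -- `vertexArea μ ≤ vertexLength μ q`.
  · have hadm : IsAdmissible Γ W ({v | v ∈ q ∧ v ∉ W}.indicator 1) := by
      refine ⟨fun p hp => ?_, fun v hv => ?_⟩
      · obtain ⟨v, hvp, hvq, hvW⟩ := h p hp q hq
        exact one_le_vertexLength_indicator hvp ⟨hvq, hvW⟩
      · simp [hv]
    have h1 := (hmin _ hadm).trans (sum_mul_indicator_le_vertexLength fun v hv => hv.1)
    have e : vertexLength (fun v => μ v / vertexArea μ) q = vertexLength μ q / vertexArea μ := by
      simp only [vertexLength, div_eq_mul_inv, List.sum_map_mul_right]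
    rw [e]
    exact (one_le_div₀ (pos_iff_ne_zero.2 h0)).2 h1
  · have e : vertexArea (fun v => μ v / vertexArea μ) = vertexArea μ / vertexArea μ ^ 2 := by
      conv_rhs => rw [vertexArea, Finset.sum_div]
      simp only [vertexArea, div_pow]
    rw [e]
    field_simp

end ExtremalWidth

theorem corollary3p2 {V E : Type*} [Fintype V] [Finite E] (G : PlaneGraph V E)
    (F : Set ℂ) (hF : G.IsJordanFace F) (N : ℕ) (hN : 3 ≤ N)
    (hfaces : ∀ f, G.IsFace f → f ≠ F → (G.boundaryVertices f).ncard ≤ N)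
    (a b : V) (ha : a ∈ G.boundaryVertices F) (hb : b ∈ G.boundaryVertices F)
    (hne : a ≠ b) (hab : ¬ G.AdjOnBoundary F a b)
    (hcon : (G.connecting F a b).Nonempty) (hsep : (G.separating F a b).Nonempty) :
    (N = 3 →
      extremalWidth (G.connecting F a b) (G.boundaryVertices F) *
        extremalWidth (G.separating F a b) (G.boundaryVertices F) = 1) ∧
    (1 / (4 * (N : ℝ≥0∞) + 1) ^ 2 ≤
        extremalWidth (G.connecting F a b) (G.boundaryVertices F) *
          extremalWidth (G.separating F a b) (G.boundaryVertices F) ∧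
      extremalWidth (G.connecting F a b) (G.boundaryVertices F) *
          extremalWidth (G.separating F a b) (G.boundaryVertices F) ≤ 1) ∧
    (1 ≤ extremalLength (G.connecting F a b) (G.boundaryVertices F) *
          extremalLength (G.separating F a b) (G.boundaryVertices F) ∧
      extremalLength (G.connecting F a b) (G.boundaryVertices F) *
          extremalLength (G.separating F a b) (G.boundaryVertices F) ≤
        (4 * (N : ℝ≥0∞) + 1) ^ 2) := by
  obtain ⟨γ, t, h⟩ := PlaneGraph.exists_boundaryParam hF ha hb hne
  have hcross : ∀ p ∈ G.connecting F a b, ∀ q ∈ G.separating F a b,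
      ∃ v ∈ p, v ∈ q ∧ v ∉ G.boundaryVertices F := fun p hp q hq => h.exists_common_vertex hp hq
  -- The metric that is 1 off `∂F` is admissible, since every connecting path meets a fixed
  -- separating path off `∂F`.
  have hex : ∃ μ, IsAdmissible (G.connecting F a b) (G.boundaryVertices F) μ := by
    obtain ⟨q, hq⟩ := hsep
    refine ⟨(G.boundaryVertices F)ᶜ.indicator 1, fun p hp => ?_, fun v hv => by simp [hv]⟩
    obtain ⟨v, hvp, -, hv⟩ := hcross p hp q hq
    exact one_le_vertexLength_indicator hvp hv
  obtain ⟨μ, hμ, hμmin⟩ := exists_isAdmissible_forall_le hex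
  obtain ⟨ν', hν', hμν'⟩ := exists_isAdmissible_mul_le_one hcon hcross hμ hμmin
  obtain ⟨ν, hν, hνmin⟩ := exists_isAdmissible_forall_le ⟨ν', hν'⟩
  have hμ0 := vertexArea_ne_zero hcon hμ
  have hν0 := vertexArea_ne_zero hsep hν
  have hle : (vertexArea μ : ℝ≥0∞) * vertexArea ν ≤ 1 := by
    rw [← extremalWidth_eq hν hνmin]
    refine (mul_le_mul_right (iInf₂_le ν' hν') _).trans ?_
    exact_mod_cast hμν'.le
  have hge : 1 ≤ (4 * (N : ℝ≥0∞) + 1) ^ 2 * (vertexArea μ * vertexArea ν) := by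
    exact_mod_cast PlaneGraph.one_le_sq_mul_vertexArea_mul h hab hcon hsep (by omega) hfaces hμ hν
  have htop : (vertexArea μ : ℝ≥0∞) * vertexArea ν ≠ ⊤ := by
    exact ENNReal.mul_ne_top ENNReal.coe_ne_top ENNReal.coe_ne_top
  have h0 : (vertexArea μ : ℝ≥0∞) * vertexArea ν ≠ 0 := by
    simp [hμ0, hν0]
  rw [extremalLength, extremalLength, extremalWidth_eq hμ hμmin, extremalWidth_eq hν hνmin,
    ← ENNReal.mul_inv (Or.inr ENNReal.coe_ne_top) (Or.inl ENNReal.coe_ne_top)]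
  refine ⟨?_, ⟨?_, hle⟩, ENNReal.one_le_inv.2 hle, ?_⟩
  · rintro rfl
    refine le_antisymm hle ?_
    exact_mod_cast PlaneGraph.one_le_vertexArea_mul h hab hcon hsep hfaces hμ hν
  · exact ENNReal.div_le_of_le_mul (by rwa [mul_comm] at hge)
  · rw [ENNReal.inv_le_iff_le_mul (fun _ => h0) fun h => absurd h htop]
    rwa [mul_comm] at hge
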